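/- **Theorem.** Let $G$ be a connected finite-dimensional Lie group with unit $e$, and let $S^1=\mathbb R/2\pi\mathbb Z$. Let $\Omega G$ be the Fréchet Lie group of smooth loops $\gamma:S^1\to G$ with $\gamma(0)=e$ that are flat at $0$ (all derivatives of all orders $\ge 1$ vanish there). For $I\subseteq S^1$ let $\Omega_I G=\{\gamma\in\Omega G\mid \gamma(t)=e \text{ for all } t\notin I\}$. Let $P_eG$ be the Fréchet Lie group of smooth paths $\gamma:[0,\pi]\to G$ with $\gamma(0)=e$ that are flat at both end points. For $\gamma\in P_eG$ let $\gamma\cup\gamma\in\Omega G$ be the loop given by $\gamma(t)$ for $t\in[0,\pi]$ and by $\gamma(2\pi-t)$ for $t\in[\pi,2\pi]$. Let $1\to \mathrm U(1)\to\widetilde{\Omega G}\xrightarrow{\ \pi\ }\Omega G\to 1$ be a central extension of Fréchet Lie groups, i.e. an exact sequence of Fréchet Lie groups and smooth homomorphisms such that $\mathrm U(1)$ is central in $\widetilde{\Omega G}$ and $\widetilde{\Omega G}$ is a smooth principal $\mathrm U(1)$-bundle over $\Omega G$. For $I\subseteq S^1$ let $\widetilde{\Omega_I G}=\pi^{-1}(\Omega_IG)$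 be the pullback of the extension to $\Omega_I G$. Suppose that the extension is disjoint commutative: for all $I,J\subseteq S^1$ with $I\cap J=\emptyset$, the subgroups $\widetilde{\Omega_IG}$ and $\widetilde{\Omega_JG}$ commute elementwise. Let $t:\widetilde{\Omega_{(0,\pi)}G}\to P_eG$ be the homomorphism $t(\Phi)=\pi(\Phi)|_{[0,\pi]}$, and let $\alpha$ be the canonical action of $P_eG$ on $\widetilde{\Omega_{(0,\pi)}G}$, $$\alpha_\gamma(\Phi)=\widetilde{\gamma\cup\gamma}\cdot\Phi\cdot(\widetilde{\gamma\cup\gamma})^{-1},$$ where $\widetilde{\gamma\cup\gamma}\in\widetilde{\Omega G}$ is any lift of $\gamma\cup\gamma$ (lifts exist, and the right hand side does not depend on the choice of the lift). Then $t$ and $\alpha$ form a central crossed module $X(\widetilde{\Omega G})$ of Fréchet Lie groups. That is: $\widetilde{\Omega_{(0,\pi)}G}$ and $P_eG$ are Fréchet Lie groups; $t$ is a smooth homomorphism; $\alpha:P_eG\times\widetilde{\Omega_{(0,\pi)}G}\to\widetilde{\Omega_{(0,\pi)}G}$ is smooth and is an action by group automorphisms; $t(\alpha_\gamma(\Phi))=\gamma\,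 t(\Phi)\,\gamma^{-1}$ and $\alpha_{t(\Psi)}(\Phi)=\Psi\Phi\Psi^{-1}$ for all $\gamma\in P_eG$ and $\Phi,\Psi\in\widetilde{\Omega_{(0,\pi)}G}$; and $\alpha_\gamma(\Phi)=\Phi$ for all $\gamma\in P_eG$ and all $\Phi$ with $t(\Phi)=e$. -/

import Mathlib

open Set Filter Topology
open scoped ContDiff Manifold Uniformity

namespace LoopCrossed

/-! ### Calculus in locally convex spaces, Fréchet manifolds and Fréchet Lie groups -/

section Frechet

/-- Fréchet spaces: complete metrizable locally convex real topological vector spaces.  (Metrizable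
means that the uniformity is Hausdorff and countably generated.) -/
class IsFrechetSpace (E : Type*) [AddCommGroup E] [Module ℝ E] [UniformSpace E] : Prop extends
    IsUniformAddGroup E, ContinuousSMul ℝ E, LocallyConvexSpace ℝ E, CompleteSpace E, T2Space E,
    (𝓤 E).IsCountablyGenerated

/-- `C^k`-maps on an open subset `U` of a topological vector space, in the sense of Michal and
Bastiani: `f` is `C^0` if it is continuous, and `C^(k+1)` if it is continuous, all directional
derivatives `df(x, v)` with `x ∈ U` exist, and `df : U × E → F` is `C^k`. -/
def BastianiContDiffOn {F : Type*} [AddCommGroup F] [Module ℝ F] [TopologicalSpace F] :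
    ℕ → ∀ (E : Type*) [AddCommGroup E] [Module ℝ E] [TopologicalSpace E], (E → F) → Set E → Prop
  | 0, _, _, _, _, f, U => ContinuousOn f U
  | k + 1, E, _, _, _, f, U => ContinuousOn f U ∧ ∃ df : E × E → F,
      (∀ x ∈ U, ∀ v : E, Tendsto (fun t : ℝ => t⁻¹ • (f (x + t • v) - f x)) (𝓝[≠] 0)
        (𝓝 (df (x, v)))) ∧
      BastianiContDiffOn k (E × E) df (U ×ˢ univ)

/-- Smooth maps on an open subset of a topological vector space. -/
def BastianiSmoothOn {E F : Type*} [AddCommGroup E] [Module ℝ E] [TopologicalSpace E]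
    [AddCommGroup F] [Module ℝ F] [TopologicalSpace F] (f : E → F) (U : Set E) : Prop :=
  ∀ k, BastianiContDiffOn k E f U

/-- The topology on a set `M` given by a collection of charts: it is generated by the preimages of
open sets under the charts. -/
@[reducible] def chartTopology {M E : Type*} [TopologicalSpace E] (A : Set (PartialEquiv M E)) :
    TopologicalSpace M :=
  TopologicalSpace.generateFrom
    {S | ∃ p ∈ A, ∃ W : Set E, IsOpen W ∧ S = p.source ∩ p ⁻¹' W}

/-- The product charts on `M × N`. -/
def prodCharts {M N E F : Type*} (A : Set (PartialEquiv M E)) (B : Set (PartialEquiv N F)) :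
    Set (PartialEquiv (M × N) (E × F)) :=
  image2 PartialEquiv.prod A B

/-- A map between two sets with charts is smooth on the open subset `S` if, for all charts `p` of
the source and `q` of the target, the local representative `q ∘ f ∘ p⁻¹` has open domain and is
smooth there.  (Openness of all these domains says that `S` is open and that `f` is continuous
on `S`.) -/
def SmoothMapOn {M N E F : Type*} [AddCommGroup E] [Module ℝ E] [TopologicalSpace E]
    [AddCommGroup F] [Module ℝ F] [TopologicalSpace F]
    (A : Set (PartialEquiv M E)) (B : Set (PartialEquiv N F)) (f : M → N) (S : Set M) : Prop :=
  ∀ p ∈ A, ∀ q ∈ B, IsOpen (p '' (p.source ∩ (S ∩ f ⁻¹' q.source))) ∧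
    BastianiSmoothOn (fun x => q (f (p.symm x))) (p '' (p.source ∩ (S ∩ f ⁻¹' q.source)))

/-- A map between two sets with charts is smooth. -/
def SmoothMap {M N E F : Type*} [AddCommGroup E] [Module ℝ E] [TopologicalSpace E]
    [AddCommGroup F] [Module ℝ F] [TopologicalSpace F]
    (A : Set (PartialEquiv M E)) (B : Set (PartialEquiv N F)) (f : M → N) : Prop :=
  SmoothMapOn A B f univ

/-- The collection `A` of charts is a smooth atlas that makes `M` a (Hausdorff) Fréchet manifold
modelled on the Fréchet space `E`. -/
structure IsFrechetManifold {M E : Type*} [AddCommGroup E] [Module ℝ E] [UniformSpace E]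
    (A : Set (PartialEquiv M E)) : Prop where
  frechet : IsFrechetSpace E
  cover : ∀ x : M, ∃ p ∈ A, x ∈ p.source
  isOpen_overlap : ∀ p ∈ A, ∀ q ∈ A, IsOpen (p '' (p.source ∩ q.source))
  smooth_transition : ∀ p ∈ A, ∀ q ∈ A,
    BastianiSmoothOn (fun x => q (p.symm x)) (p '' (p.source ∩ q.source))
  hausdorff : @T2Space M (chartTopology A)

/-- The group `K` with the atlas `A` is a Fréchet Lie group. -/
structure IsFrechetLieGroup {K E : Type*} [Group K] [AddCommGroup E] [Module ℝ E]
    [UniformSpace E] (A : Set (PartialEquiv K E)) : Prop extends IsFrechetManifold A where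
  smooth_mul : SmoothMap (prodCharts A A) A fun x : K × K => x.1 * x.2
  smooth_inv : SmoothMap A A fun x : K => x⁻¹

/-- The model space `ℝ¹` of the circle group `U(1)`. -/
abbrev LineModel : Type := EuclideanSpace ℝ (Fin 1)

/-- The standard charts of the circle group `U(1)`. -/
noncomputable def circleCharts : Set (PartialEquiv Circle LineModel) :=
  {p | ∃ e ∈ atlas LineModel Circle, p = e.toPartialEquiv}

end Frechet

/-! ### Central extensions and crossed modules of Fréchet Lie groups -/

section Extensions

variable {B EB T F : Type*} [Group B] [AddCommGroup EB] [Module ℝ EB] [UniformSpace EB]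
  [Group T] [AddCommGroup F] [Module ℝ F] [UniformSpace F]

/-- `τ` is a smooth local trivialization over the open set `V` of the principal `U(1)`-bundle
`proj : T → B`, where `U(1)` acts on `T` by right multiplication through `incl`. -/
structure IsLocalTrivialization (AB : Set (PartialEquiv B EB)) (AT : Set (PartialEquiv T F))
    (incl : Circle →* T) (proj : T →* B) (V : Set B) (τ : PartialEquiv T (B × Circle)) :
    Prop where
  isOpen_base : IsOpen[chartTopology AB] V
  source_eq : τ.source = proj ⁻¹' V
  target_eq : τ.target = V ×ˢ univ
  fst_eq : ∀ Φ ∈ τ.source, (τ Φ).1 = proj Φ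
  equivariant : ∀ Φ ∈ τ.source, ∀ z : Circle, (τ (Φ * incl z)).2 = (τ Φ).2 * z
  smooth : SmoothMapOn AT (prodCharts AB circleCharts) τ τ.source
  smooth_symm : SmoothMapOn (prodCharts AB circleCharts) AT τ.symm τ.target

/-- A central extension `1 → U(1) → T → B → 1` of Fréchet Lie groups, where `AB` are the charts of
`B` and `F` is the model space of `T`: an exact sequence of smooth homomorphisms that is a smooth
principal `U(1)`-bundle and has central kernel. -/
structure CentralExtension (AB : Set (PartialEquiv B EB)) (T F : Type*) [Group T]
    [AddCommGroup F] [Module ℝ F] [UniformSpace F] where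
  /-- the charts of the total group -/
  charts : Set (PartialEquiv T F)
  isFrechetLieGroup : IsFrechetLieGroup charts
  /-- the inclusion of `U(1)` -/
  incl : Circle →* T
  /-- the projection to the base group -/
  proj : T →* B
  smooth_incl : SmoothMap circleCharts charts incl
  smooth_proj : SmoothMap charts AB proj
  incl_injective : Function.Injective incl
  proj_surjective : Function.Surjective proj
  ker_eq_range : proj.ker = incl.range
  central : ∀ (z : Circle) (Φ : T), incl z * Φ = Φ * incl z
  locallyTrivial : ∀ b : B, ∃ V : Set B, b ∈ V ∧
    ∃ τ, IsLocalTrivialization AB charts incl proj V τ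

/-- The homomorphism `t : H → K` and the action `α` of `K` on `H` by automorphisms form a crossed
module of Fréchet Lie groups, where `AH` and `AK` are the charts of `H` and `K`. -/
structure IsCrossedModule {H EH K EK : Type*} [Group H] [AddCommGroup EH] [Module ℝ EH]
    [UniformSpace EH] [Group K] [AddCommGroup EK] [Module ℝ EK] [UniformSpace EK]
    (AH : Set (PartialEquiv H EH)) (AK : Set (PartialEquiv K EK))
    (t : H →* K) (α : K →* MulAut H) : Prop where
  lieGroup_H : IsFrechetLieGroup AH
  lieGroup_K : IsFrechetLieGroup AK
  smooth_t : SmoothMap AH AK t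
  smooth_action : SmoothMap (prodCharts AK AH) AH fun x : K × H => α x.1 x.2
  equivariant : ∀ (g : K) (h : H), t (α g h) = g * t h * g⁻¹
  peiffer : ∀ h k : H, α (t h) k = h * k * h⁻¹

/-- A crossed module is central if the action is trivial on the kernel of `t`. -/
structure IsCentralCrossedModule {H EH K EK : Type*} [Group H] [AddCommGroup EH] [Module ℝ EH]
    [UniformSpace EH] [Group K] [AddCommGroup EK] [Module ℝ EK] [UniformSpace EK]
    (AH : Set (PartialEquiv H EH)) (AK : Set (PartialEquiv K EK))
    (t : H →* K) (α : K →* MulAut H) : Prop extends IsCrossedModule AH AK t α where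
  central : ∀ (g : K) (a : H), t a = 1 → α g a = a

end Extensions

/-! ### Flat maps -/


section Flat

variable {V W : Type*} [NormedAddCommGroup V] [NormedSpace ℝ V] [NormedAddCommGroup W]
  [NormedSpace ℝ W]

theorem flat_comp_aux {f : ℝ → V} {g : V → W} {s : Set ℝ} {p : ℝ}
    (hs : UniqueDiffOn ℝ s) (hp : p ∈ s)
    (hf : ContDiffWithinAt ℝ ∞ f s p) (hg : ContDiffAt ℝ ∞ g (f p))
    (h0 : ∀ k, 1 ≤ k → iteratedDerivWithin k f s p = 0) (k : ℕ) (hk : 1 ≤ k) :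
    iteratedDerivWithin k (fun t => g (f t)) s p = 0 := by
  have := iteratedDerivWithin_vcomp_eq_sum_orderedFinpartition (i := k) (n := ∞)
    hg.contDiffWithinAt hf uniqueDiffOn_univ hs hp (mapsTo_univ f s) (by exact_mod_cast le_top)
  refine this.trans (Finset.sum_eq_zero fun c _ => ?_)
  have hc : 0 < c.length := c.length_pos hk
  exact ContinuousMultilinearMap.map_coord_zero _ ⟨0, hc⟩ (h0 _ (c.partSize_pos _))

theorem flat_prod_aux {f : ℝ → V} {g : ℝ → W} {s : Set ℝ} {p : ℝ}
    (hs : UniqueDiffOn ℝ s) (hp : p ∈ s)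
    (hf : ContDiffWithinAt ℝ ∞ f s p) (hg : ContDiffWithinAt ℝ ∞ g s p)
    (h0 : ∀ k, 1 ≤ k → iteratedDerivWithin k f s p = 0)
    (h1 : ∀ k, 1 ≤ k → iteratedDerivWithin k g s p = 0) (k : ℕ) (hk : 1 ≤ k) :
    iteratedDerivWithin k (fun t => (f t, g t)) s p = 0 := by
  have := iteratedFDerivWithin_prodMk (i := k) hf hg hs hp (by exact_mod_cast le_top)
  have e0 := h0 k hk
  have e1 := h1 k hk
  rw [iteratedDerivWithin] at e0 e1 ⊢
  rw [this]
  simp [e0, e1]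

theorem contDiffAt_glue {f : ℝ → V} {p : ℝ}
    (hl : ContDiffWithinAt ℝ ∞ f (Iic p) p) (hr : ContDiffWithinAt ℝ ∞ f (Ici p) p)
    (h : ∀ k, iteratedDerivWithin k f (Iic p) p = iteratedDerivWithin k f (Ici p) p) :
    ContDiffAt ℝ ∞ f p := by
  rw [contDiffAt_infty]
  intro n
  have hl' := (hl.of_le (m := n) (by exact_mod_cast le_top)).eventually_hasFTaylorSeriesUpToOn
    (uniqueDiffOn_Iic p) self_mem_Iic le_rfl
  have hr' := (hr.of_le (m := n) (by exact_mod_cast le_top)).eventually_hasFTaylorSeriesUpToOn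
    (uniqueDiffOn_Ici p) self_mem_Ici le_rfl
  obtain ⟨u, ⟨hpu, huo⟩, hu⟩ :=
    (nhdsWithin_basis_open p (Iic p)).smallSets.eventually_iff.mp hl'
  obtain ⟨v, ⟨hpv, hvo⟩, hv⟩ :=
    (nhdsWithin_basis_open p (Ici p)).smallSets.eventually_iff.mp hr'
  replace hu := hu (mem_powerset (Subset.refl _))
  replace hv := hv (mem_powerset (Subset.refl _))
  set P := ftaylorSeriesWithin ℝ f (Iic p) with hP
  set Q := ftaylorSeriesWithin ℝ f (Ici p) with hQ
  have hPQ : P p = Q p := by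
    ext1 k
    have := h k
    simp only [hP, hQ, ftaylorSeriesWithin]
    ext
    rw [iteratedFDerivWithin_apply_eq_iteratedDerivWithin_mul_prod,
      iteratedFDerivWithin_apply_eq_iteratedDerivWithin_mul_prod, this]
  classical
  let R : ℝ → FormalMultilinearSeries ℝ ℝ V := fun x => if x ≤ p then P x else Q x
  have hRl : ∀ x ∈ Iic p ∩ u, R x = P x := fun x hx => if_pos hx.1
  have hRr : ∀ x ∈ Ici p ∩ v, R x = Q x := by
    intro x hx
    by_cases hxp : x ≤ p
    · have : x = p := le_antisymm hxp hx.1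
      subst this
      simp [R, hPQ]
    · exact if_neg hxp
  have hu' : HasFTaylorSeriesUpToOn n f R (Iic p ∩ u) :=
    ⟨fun x hx => by rw [hRl x hx]; exact hu.zero_eq x (by tauto_set),
     fun m hm x hx => by
      have := hu.fderivWithin m hm x (by tauto_set)
      rw [hRl x hx]
      refine (this.mono (by tauto_set)).congr (fun y hy => by rw [hRl y hy]) (by rw [hRl x hx]),
     fun m hm => ((hu.cont m hm).mono (by tauto_set)).congr fun y hy => by rw [hRl y hy]⟩
  have hv' : HasFTaylorSeriesUpToOn n f R (Ici p ∩ v) :=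
    ⟨fun x hx => by rw [hRr x hx]; exact hv.zero_eq x (by tauto_set),
     fun m hm x hx => by
      have := hv.fderivWithin m hm x (by tauto_set)
      rw [hRr x hx]
      refine (this.mono (by tauto_set)).congr (fun y hy => by rw [hRr y hy]) (by rw [hRr x hx]),
     fun m hm => ((hv.cont m hm).mono (by tauto_set)).congr fun y hy => by rw [hRr y hy]⟩
  have hsplit : ∀ x ∈ u ∩ v, x ∈ Iic p ∩ u ∨ x ∈ Ici p ∩ v := fun x hx =>
    (le_total x p).imp (fun h => ⟨h, hx.1⟩) (fun h => ⟨h, hx.2⟩)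
  have key : ∀ m : ℕ, ∀ x ∈ u ∩ v, ∀ L : ℝ →L[ℝ] (ContinuousMultilinearMap ℝ (fun _ : Fin m => ℝ) V),
      (x ≤ p → HasFDerivWithinAt (R · m) L (Iic p ∩ u) x) →
      (p ≤ x → HasFDerivWithinAt (R · m) L (Ici p ∩ v) x) →
      HasFDerivWithinAt (R · m) L (u ∩ v) x := by
    intro m x hx L h1 h2
    have hsub : u ∩ v ⊆ (Iic p ∩ u) ∪ (Ici p ∩ v) := fun y hy => hsplit y hy
    refine HasFDerivWithinAt.mono ?_ hsub
    rcases lt_trichotomy x p with hxp | hxp | hxp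
    · refine (h1 hxp.le).mono_of_mem_nhdsWithin ?_
      refine mem_nhdsWithin_of_mem_nhds ?_
      exact inter_mem (Iic_mem_nhds hxp) (huo.mem_nhds hx.1)
    · exact (h1 hxp.le).union (h2 hxp.ge)
    · refine (h2 hxp.le).mono_of_mem_nhdsWithin ?_
      refine mem_nhdsWithin_of_mem_nhds ?_
      exact inter_mem (Ici_mem_nhds hxp) (hvo.mem_nhds hx.2)
  have hR : HasFTaylorSeriesUpToOn n f R (u ∩ v) := by
    refine ⟨fun x hx => (hsplit x hx).elim (hu'.zero_eq x) (hv'.zero_eq x),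
      fun m hm x hx => key m x hx _ (fun h => hu'.fderivWithin m hm x ⟨h, hx.1⟩)
        (fun h => hv'.fderivWithin m hm x ⟨h, hx.2⟩), fun m hm => ?_⟩
    intro x hx
    have hsub : u ∩ v ⊆ (Iic p ∩ u) ∪ (Ici p ∩ v) := fun y hy => hsplit y hy
    refine ContinuousWithinAt.mono ?_ hsub
    rcases lt_trichotomy x p with hxp | hxp | hxp
    · refine (hu'.cont m hm x ⟨hxp.le, hx.1⟩).mono_of_mem_nhdsWithin ?_
      exact mem_nhdsWithin_of_mem_nhds (inter_mem (Iic_mem_nhds hxp) (huo.mem_nhds hx.1))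
    · exact (hu'.cont m hm x ⟨hxp.le, hx.1⟩).union (hv'.cont m hm x ⟨hxp.ge, hx.2⟩)
    · refine (hv'.cont m hm x ⟨hxp.le, hx.2⟩).mono_of_mem_nhdsWithin ?_
      exact mem_nhdsWithin_of_mem_nhds (inter_mem (Ici_mem_nhds hxp) (hvo.mem_nhds hx.2))
  have hC : ContDiffOn ℝ n f (u ∩ v) := hR.contDiffOn
  exact hC.contDiffAt ((huo.inter hvo).mem_nhds ⟨hpu, hpv⟩)

end Flat

section FlatMaps

variable {E : Type*} [NormedAddCommGroup E] [NormedSpace ℝ E]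
  {G : Type*} [TopologicalSpace G] [ChartedSpace E G]

variable (E) in
/-- A map `f` from a subset `s` of the real line to a manifold is flat at `p` if, in a chart around
`f p`, all derivatives of order at least one vanish at `p`. -/
def FlatAt (f : ℝ → G) (s : Set ℝ) (p : ℝ) : Prop :=
  ∀ k : ℕ, 1 ≤ k → iteratedDerivWithin k (fun t => chartAt E (f p) (f t)) s p = 0

theorem contDiffWithinAt_chart {f : ℝ → G} {s : Set ℝ} {p : ℝ}
    (hf : ContMDiffWithinAt 𝓘(ℝ, ℝ) 𝓘(ℝ, E) ∞ f s p) :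
    ContDiffWithinAt ℝ ∞ (fun t => chartAt E (f p) (f t)) s p := by
  have := contMDiffWithinAt_iff_contDiffWithinAt.1 (contMDiffWithinAt_iff_target.1 hf).2
  simpa [Function.comp_def] using this

theorem contMDiffWithinAt_of_chart {f : ℝ → G} {s : Set ℝ} {p : ℝ}
    (hc : ContinuousWithinAt f s p)
    (hf : ContDiffWithinAt ℝ ∞ (fun t => chartAt E (f p) (f t)) s p) :
    ContMDiffWithinAt 𝓘(ℝ, ℝ) 𝓘(ℝ, E) ∞ f s p := by
  refine contMDiffWithinAt_iff_target.2 ⟨hc, contMDiffWithinAt_iff_contDiffWithinAt.2 ?_⟩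
  simpa [Function.comp_def] using hf

theorem FlatAt.congr {f g : ℝ → G} {s : Set ℝ} {p : ℝ} (h : FlatAt E f s p)
    (hfg : f =ᶠ[𝓝[s] p] g) (hp : p ∈ s) : FlatAt E g s p := by
  have hfp : f p = g p := hfg.eq_of_nhdsWithin hp
  intro k hk
  rw [← h k hk, ← hfp]
  refine (Filter.EventuallyEq.iteratedDerivWithin_eq ?_ (by simp [hfp])).symm
  filter_upwards [hfg] with t ht
  rw [ht]

theorem FlatAt.congr_set {f : ℝ → G} {s t : Set ℝ} {p : ℝ} (h : FlatAt E f s p)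
    (hst : s =ᶠ[𝓝 p] t) : FlatAt E f t p := by
  intro k hk
  rw [← h k hk, iteratedDerivWithin, iteratedDerivWithin, iteratedFDerivWithin_congr_set hst]

theorem flatAt_const (c : G) (s : Set ℝ) (p : ℝ) : FlatAt E (fun _ => c) s p := by
  intro k hk
  rw [iteratedDerivWithin_const]
  simp; omega

theorem flatAt_iff_univ {f : ℝ → G} {s : Set ℝ} {p : ℝ}
    (hf : ContMDiffAt 𝓘(ℝ, ℝ) 𝓘(ℝ, E) ∞ f p) (hs : UniqueDiffOn ℝ s) (hp : p ∈ s) :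
    FlatAt E f s p ↔ FlatAt E f univ p := by
  refine forall₂_congr fun k _ => ?_
  rw [iteratedDerivWithin_univ, iteratedDerivWithin_eq_iteratedDeriv hs ?_ hp]
  exact (contDiffWithinAt_univ.1 (contDiffWithinAt_chart hf)).of_le (by exact_mod_cast le_top)

open scoped Pointwise in
theorem FlatAt.comp_const_sub {f : ℝ → G} {s t : Set ℝ} {p c : ℝ} (h : FlatAt E f s (c - p))
    (hst : ∀ x, x ∈ t ↔ c - x ∈ s) : FlatAt E (fun x => f (c - x)) t p := by
  intro k hk
  have h1 := congrFun (iteratedDerivWithin_comp_const_sub (𝕜 := ℝ) (n := k) (s := t)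
    (f := fun x => chartAt E (f (c - p)) (f x)) c) p
  refine h1.trans ?_
  have h2 : c +ᵥ -t = s := by
    ext x
    rw [Set.mem_vadd_set_iff_neg_vadd_mem]
    simp only [vadd_eq_add, Set.mem_neg]
    rw [hst]; simp
  simp only [h2]
  rw [h k hk, smul_zero]

theorem contMDiffAt_glue {f : ℝ → G} {p : ℝ}
    (hl : ContMDiffWithinAt 𝓘(ℝ, ℝ) 𝓘(ℝ, E) ∞ f (Iic p) p)
    (hr : ContMDiffWithinAt 𝓘(ℝ, ℝ) 𝓘(ℝ, E) ∞ f (Ici p) p)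
    (fl : FlatAt E f (Iic p) p) (fr : FlatAt E f (Ici p) p) :
    ContMDiffAt 𝓘(ℝ, ℝ) 𝓘(ℝ, E) ∞ f p ∧ FlatAt E f univ p := by
  have hC : ContMDiffAt 𝓘(ℝ, ℝ) 𝓘(ℝ, E) ∞ f p := by
    refine contMDiffWithinAt_of_chart ?_ ?_
    · have := hl.continuousWithinAt.union hr.continuousWithinAt
      rwa [Iic_union_Ici] at this
    · refine (contDiffAt_glue (contDiffWithinAt_chart hl) (contDiffWithinAt_chart hr)
        fun k => ?_).contDiffWithinAt
      rcases Nat.eq_zero_or_pos k with rfl | hk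
      · simp
      · rw [fl k hk, fr k hk]
  exact ⟨hC, (flatAt_iff_univ hC (uniqueDiffOn_Ici p) self_mem_Ici).1 fr⟩

variable [Group G] [LieGroup 𝓘(ℝ, E) ∞ G]

theorem FlatAt.mul {f g : ℝ → G} {s : Set ℝ} {p : ℝ} (hs : UniqueDiffOn ℝ s) (hp : p ∈ s)
    (hf : ContMDiffWithinAt 𝓘(ℝ, ℝ) 𝓘(ℝ, E) ∞ f s p)
    (hg : ContMDiffWithinAt 𝓘(ℝ, ℝ) 𝓘(ℝ, E) ∞ g s p)
    (h0 : FlatAt E f s p) (h1 : FlatAt E g s p) : FlatAt E (fun t => f t * g t) s p := by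
  have hm : ContMDiffAt (𝓘(ℝ, E).prod 𝓘(ℝ, E)) 𝓘(ℝ, E) ∞ (fun q : G × G => q.1 * q.2)
      (f p, g p) := (contMDiff_mul 𝓘(ℝ, E) ∞).contMDiffAt
  have hm' := (contMDiffAt_iff.1 hm).2
  have hm2 : ContDiffAt ℝ ∞ (fun v : E × E => chartAt E (f p * g p)
      ((chartAt E (f p)).symm v.1 * (chartAt E (g p)).symm v.2))
      (chartAt E (f p) (f p), chartAt E (g p) (g p)) := by
    simp only [extChartAt, OpenPartialHomeomorph.extend, prodChartedSpace_chartAt] at hm'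
    simp [Function.comp_def, contDiffWithinAt_univ] at hm'
    exact hm'
  intro k hk
  have key := flat_comp_aux (f := fun t => (chartAt E (f p) (f t), chartAt E (g p) (g t))) hs hp
    ((contDiffWithinAt_chart hf).prodMk (contDiffWithinAt_chart hg)) hm2
    (flat_prod_aux hs hp (contDiffWithinAt_chart hf) (contDiffWithinAt_chart hg) h0 h1) k hk
  rw [← key]
  refine Filter.EventuallyEq.iteratedDerivWithin_eq ?_ ?_
  · filter_upwards [hf.continuousWithinAt.preimage_mem_nhdsWithin (chart_source_mem_nhds E (f p)),
      hg.continuousWithinAt.preimage_mem_nhdsWithin (chart_source_mem_nhds E (g p))] with t h2 h3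
    rw [(chartAt E (f p)).left_inv h2, (chartAt E (g p)).left_inv h3]
  · simp

theorem FlatAt.inv {f : ℝ → G} {s : Set ℝ} {p : ℝ} (hs : UniqueDiffOn ℝ s) (hp : p ∈ s)
    (hf : ContMDiffWithinAt 𝓘(ℝ, ℝ) 𝓘(ℝ, E) ∞ f s p)
    (h0 : FlatAt E f s p) : FlatAt E (fun t => (f t)⁻¹) s p := by
  have hm : ContMDiffAt 𝓘(ℝ, E) 𝓘(ℝ, E) ∞ (fun q : G => q⁻¹) (f p) :=
    (contMDiff_inv 𝓘(ℝ, E) ∞).contMDiffAt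
  have hm' := (contMDiffAt_iff.1 hm).2
  have hm2 : ContDiffAt ℝ ∞ (fun v : E => chartAt E (f p)⁻¹ ((chartAt E (f p)).symm v)⁻¹)
      (chartAt E (f p) (f p)) := by
    simpa [Function.comp_def, contDiffWithinAt_univ] using hm'
  intro k hk
  have key := flat_comp_aux (f := fun t => chartAt E (f p) (f t)) hs hp
    (contDiffWithinAt_chart hf) hm2 h0 k hk
  rw [← key]
  refine Filter.EventuallyEq.iteratedDerivWithin_eq ?_ ?_
  · filter_upwards [hf.continuousWithinAt.preimage_mem_nhdsWithin
      (chart_source_mem_nhds E (f p))] with t h2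
    rw [(chartAt E (f p)).left_inv h2]
  · simp

end FlatMaps

/-! ### The circle, path groups and loop groups -/

/-- The circle `ℝ / 2πℤ`. -/
abbrev S1 : Type := AddCircle (2 * Real.pi)

instance instFactTwoPi : Fact (0 < 2 * Real.pi) := ⟨Real.two_pi_pos⟩

/-- The closed interval `[0, π]`. -/
abbrev HalfInterval : Type := Icc (0 : ℝ) Real.pi

/-- The point `0` of `[0, π]`. -/
noncomputable def startPt : HalfInterval := ⟨0, left_mem_Icc.2 Real.pi_pos.le⟩

/-- The point `π` of `[0, π]`. -/
noncomputable def endPt : HalfInterval := ⟨Real.pi, right_mem_Icc.2 Real.pi_pos.le⟩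

/-- A map on `[0, π]` regarded as a map on `ℝ` (only its values on `[0, π]` matter). -/
noncomputable def extendPath {X : Type*} (γ : HalfInterval → X) : ℝ → X := IccExtend Real.pi_pos.le γ

theorem extendPath_of_mem {X : Type*} (γ : HalfInterval → X) {t : ℝ} (ht : t ∈ Icc 0 Real.pi) :
    extendPath γ t = γ ⟨t, ht⟩ := IccExtend_of_mem _ _ ht

/-- The open upper half circle `(0, π)`. -/
noncomputable def upperHalf : Set S1 := (fun t : ℝ => (t : S1)) '' Ioo 0 Real.pi

section Groups

variable (E : Type*) [NormedAddCommGroup E] [NormedSpace ℝ E]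
  (G : Type*) [TopologicalSpace G] [ChartedSpace E G] [Group G] [LieGroup 𝓘(ℝ, E) ∞ G]

/-- The loop group `LG = C^∞(S¹, G)`. -/
def loopGroup : Subgroup (S1 → G) where
  carrier := {γ | ContMDiff 𝓘(ℝ, ℝ) 𝓘(ℝ, E) ∞ fun t : ℝ => γ t}
  mul_mem' ha hb := ContMDiff.mul ha hb
  one_mem' := contMDiff_const
  inv_mem' ha := ContMDiff.inv ha

/-- The based loop group `ΩG`: smooth loops that are flat at `0` with value `e` there. -/
def basedLoopGroup : Subgroup (S1 → G) where
  carrier := {γ | γ ∈ loopGroup E G ∧ γ 0 = 1 ∧ FlatAt E (fun t : ℝ => γ t) univ 0}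
  mul_mem' := fun {a b} ha hb => ⟨mul_mem ha.1 hb.1, by simp [ha.2.1, hb.2.1],
    FlatAt.mul uniqueDiffOn_univ (mem_univ _) (ha.1.contMDiffAt) (hb.1.contMDiffAt)
      ha.2.2 hb.2.2⟩
  one_mem' := ⟨one_mem _, rfl, flatAt_const _ _ _⟩
  inv_mem' := fun {a} ha => ⟨inv_mem ha.1, by simp [ha.2.1],
    FlatAt.inv uniqueDiffOn_univ (mem_univ _) (ha.1.contMDiffAt) ha.2.2⟩

/-- The group `Ω_I G` of based loops `γ` with `γ(t) = e` for all `t ∉ I`. -/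
def basedLoopGroupIn (I : Set S1) : Subgroup (S1 → G) where
  carrier := {γ | γ ∈ basedLoopGroup E G ∧ ∀ t ∉ I, γ t = 1}
  mul_mem' := fun {a b} ha hb => ⟨mul_mem ha.1 hb.1, fun t ht => by simp [ha.2 t ht, hb.2 t ht]⟩
  one_mem' := ⟨one_mem _, fun _ _ => rfl⟩
  inv_mem' := fun {a} ha => ⟨inv_mem ha.1, fun t ht => by simp [ha.2 t ht]⟩

/-- The path group `P_e G`: smooth paths `[0, π] → G` that are flat at both end points and start
at `e`. -/
def pathGroup : Subgroup (HalfInterval → G) where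
  carrier := {γ | ContMDiffOn 𝓘(ℝ, ℝ) 𝓘(ℝ, E) ∞ (extendPath γ) (Icc 0 Real.pi) ∧
    γ startPt = 1 ∧ FlatAt E (extendPath γ) (Icc 0 Real.pi) 0 ∧
    FlatAt E (extendPath γ) (Icc 0 Real.pi) Real.pi}
  mul_mem' := fun {a b} ha hb => by
    have hu := uniqueDiffOn_Icc Real.pi_pos
    have h0 := left_mem_Icc.2 Real.pi_pos.le
    have h1 := right_mem_Icc.2 Real.pi_pos.le
    exact ⟨ContMDiffOn.mul ha.1 hb.1, by simp [ha.2.1, hb.2.1],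
      FlatAt.mul hu h0 (ha.1 _ h0) (hb.1 _ h0) ha.2.2.1 hb.2.2.1,
      FlatAt.mul hu h1 (ha.1 _ h1) (hb.1 _ h1) ha.2.2.2 hb.2.2.2⟩
  one_mem' := ⟨contMDiffOn_const, rfl, flatAt_const _ _ _, flatAt_const _ _ _⟩
  inv_mem' := fun {a} ha => by
    have hu := uniqueDiffOn_Icc Real.pi_pos
    have h0 := left_mem_Icc.2 Real.pi_pos.le
    have h1 := right_mem_Icc.2 Real.pi_pos.le
    exact ⟨ContMDiffOn.inv ha.1, by simp [ha.2.1],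
      FlatAt.inv hu h0 (ha.1 _ h0) ha.2.2.1, FlatAt.inv hu h1 (ha.1 _ h1) ha.2.2.2⟩

end Groups

section Maps

variable {E : Type*} [NormedAddCommGroup E] [NormedSpace ℝ E]
  {G : Type*} [TopologicalSpace G] [ChartedSpace E G] [Group G] [LieGroup 𝓘(ℝ, E) ∞ G]

/-- The restriction of a loop to `[0, π]`. -/
noncomputable def restrictHalf {X : Type*} (γ : S1 → X) : HalfInterval → X := fun t => γ ((t : ℝ) : S1)

theorem coe_notMem_upperHalf {t : ℝ} (ht : t ∈ Icc Real.pi (2 * Real.pi)) :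
    (t : S1) ∉ upperHalf := by
  have hpi := Real.pi_pos
  rintro ⟨s, hs, hst⟩
  rcases ht.2.lt_or_eq with h | h
  · have := (AddCircle.coe_eq_coe_iff_of_mem_Ico (p := 2 * Real.pi) (a := 0)
      (x := s) (y := t) ⟨hs.1.le, by linarith [hs.2]⟩ ⟨by linarith [ht.1], by linarith⟩).1 hst
    linarith [hs.2, ht.1]
  · have h0 : (t : S1) = ((0 : ℝ) : S1) := by rw [h]; simp
    have := (AddCircle.coe_eq_coe_iff_of_mem_Ico (p := 2 * Real.pi) (a := 0)
      (x := s) (y := 0) ⟨hs.1.le, by linarith [hs.2]⟩ ⟨le_rfl, by linarith⟩).1 (hst.trans h0)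
    linarith [hs.1]

theorem restrictHalf_mem {γ : S1 → G} (h : γ ∈ basedLoopGroupIn E G upperHalf) :
    restrictHalf γ ∈ pathGroup E G := by
  have hpi := Real.pi_pos
  obtain ⟨⟨hs, h1, hf⟩, hI⟩ := h
  have heq : EqOn (fun t : ℝ => γ t) (extendPath (restrictHalf γ)) (Icc 0 Real.pi) := fun t ht => by
    rw [extendPath_of_mem _ ht]; rfl
  have hu := uniqueDiffOn_Icc Real.pi_pos
  have m0 := left_mem_Icc.2 Real.pi_pos.le
  have m1 := right_mem_Icc.2 Real.pi_pos.le
  have hconst : FlatAt E (fun t : ℝ => γ t) (Icc Real.pi (2 * Real.pi)) Real.pi := by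
    refine (flatAt_const (1 : G) _ _).congr ?_ ⟨le_rfl, by linarith⟩
    filter_upwards [self_mem_nhdsWithin] with t ht
    exact (hI _ (coe_notMem_upperHalf ht)).symm
  have hpiflat := (flatAt_iff_univ (E := E) hs.contMDiffAt
    (uniqueDiffOn_Icc (by linarith)) ⟨le_rfl, by linarith⟩).1 hconst
  refine ⟨hs.contMDiffOn.congr fun t ht => (heq ht).symm, by simpa [restrictHalf, startPt] using h1,
    ?_, ?_⟩
  · exact ((flatAt_iff_univ hs.contMDiffAt hu m0).2 hf).congr heq.eventuallyEq_nhdsWithin m0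
  · exact ((flatAt_iff_univ hs.contMDiffAt hu m1).2 hpiflat).congr heq.eventuallyEq_nhdsWithin m1

/-- The homomorphism `Ω_{(0,π)} G → P_e G` restricting a loop to `[0, π]`. -/
noncomputable def restrictHom : basedLoopGroupIn E G upperHalf →* pathGroup E G where
  toFun γ := ⟨restrictHalf γ.1, restrictHalf_mem γ.2⟩
  map_one' := rfl
  map_mul' _ _ := rfl

/-- For paths `γ₁, γ₂`, the loop `γ₁ ∪ γ₂` that is `γ₁(t)` for `t ∈ [0, π]` and `γ₂(2π - t)` for
`t ∈ [π, 2π]`. -/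
noncomputable def cup {X : Type*} (γ₁ γ₂ : HalfInterval → X) : S1 → X :=
  AddCircle.liftIco (2 * Real.pi) 0
    fun t => if t ≤ Real.pi then extendPath γ₁ t else extendPath γ₂ (2 * Real.pi - t)

theorem cup_left {X : Type*} (γ₁ γ₂ : HalfInterval → X) {t : ℝ} (ht : t ∈ Icc 0 Real.pi) :
    cup γ₁ γ₂ (t : S1) = extendPath γ₁ t := by
  have hpi := Real.pi_pos
  rw [cup, AddCircle.liftIco_coe_apply ⟨ht.1, by linarith [ht.2]⟩, if_pos ht.2]

theorem cup_right {X : Type*} (γ₁ γ₂ : HalfInterval → X) (h0 : γ₁ startPt = γ₂ startPt)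
    (h1 : γ₁ endPt = γ₂ endPt) {t : ℝ} (ht : t ∈ Icc Real.pi (2 * Real.pi)) :
    cup γ₁ γ₂ (t : S1) = extendPath γ₂ (2 * Real.pi - t) := by
  have hpi := Real.pi_pos
  rcases ht.2.lt_or_eq with h | rfl
  · rw [cup, AddCircle.liftIco_coe_apply ⟨by linarith [ht.1], by linarith⟩]
    split_ifs with h2
    · have : t = Real.pi := le_antisymm h2 ht.1
      subst this
      rw [extendPath_of_mem _ ⟨hpi.le, le_rfl⟩, extendPath_of_mem _ ⟨by linarith, by linarith⟩]
      refine h1.trans (congrArg γ₂ (Subtype.ext ?_))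
      change Real.pi = 2 * Real.pi - Real.pi
      ring
    · rfl
  · have : ((2 * Real.pi : ℝ) : S1) = ((0 : ℝ) : S1) := by simp
    rw [this, cup_left _ _ ⟨le_rfl, hpi.le⟩, extendPath_of_mem _ ⟨le_rfl, hpi.le⟩,
      extendPath_of_mem _ ⟨by linarith, by linarith⟩]
    refine h0.trans (congrArg γ₂ (Subtype.ext ?_))
    change (0 : ℝ) = 2 * Real.pi - 2 * Real.pi
    ring

theorem cup_neg {X : Type*} (γ₁ γ₂ : HalfInterval → X) (h0 : γ₁ startPt = γ₂ startPt)
    (h1 : γ₁ endPt = γ₂ endPt) {t : ℝ} (ht : t ∈ Icc (-Real.pi) 0) :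
    cup γ₁ γ₂ (t : S1) = extendPath γ₂ (0 - t) := by
  have : (t : S1) = ((t + 2 * Real.pi : ℝ) : S1) := by simp
  rw [this, cup_right _ _ h0 h1 ⟨by linarith [ht.1], by linarith [ht.2]⟩]
  congr 1; ring

theorem cup_one {X : Type*} [One X] : cup (1 : HalfInterval → X) 1 = 1 := by
  funext t
  rw [← AddCircle.coe_equivIco (p := 2 * Real.pi) (a := 0) (y := t)]
  rw [cup, AddCircle.liftIco_coe_apply (AddCircle.equivIco _ 0 t).2]
  split_ifs <;> rfl

theorem cup_mul {X : Type*} [Mul X] (a b : HalfInterval → X) :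
    cup (a * b) (a * b) = cup a a * cup b b := by
  funext t
  rw [Pi.mul_apply, ← AddCircle.coe_equivIco (p := 2 * Real.pi) (a := 0) (y := t)]
  simp only [cup, AddCircle.liftIco_coe_apply (AddCircle.equivIco _ 0 t).2]
  split_ifs <;> rfl

theorem cup_mem {γ₁ γ₂ : HalfInterval → G} (m1 : γ₁ ∈ pathGroup E G) (m2 : γ₂ ∈ pathGroup E G)
    (h1 : γ₁ endPt = γ₂ endPt) : cup γ₁ γ₂ ∈ basedLoopGroup E G := by
  have hpi := Real.pi_pos
  have h0 : γ₁ startPt = γ₂ startPt := m1.2.1.trans m2.2.1.symm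
  set F : ℝ → G := fun t => cup γ₁ γ₂ (t : S1) with hF
  have e1 : Icc 0 Real.pi =ᶠ[𝓝 0] Ici 0 := by
    filter_upwards [Iio_mem_nhds hpi] with x hx
    exact propext ⟨fun h => h.1, fun h => ⟨h, le_of_lt hx⟩⟩
  have e2 : Icc 0 Real.pi =ᶠ[𝓝 Real.pi] Iic Real.pi := by
    filter_upwards [Ioi_mem_nhds hpi] with x hx
    exact propext ⟨fun h => h.2, fun h => ⟨le_of_lt hx, h⟩⟩
  have n1 : Icc 0 Real.pi ∈ 𝓝[Ici 0] (0 : ℝ) := Icc_mem_nhdsGE hpi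
  have n2 : Icc 0 Real.pi ∈ 𝓝[Iic Real.pi] Real.pi := Icc_mem_nhdsLE hpi
  have n3 : Icc (-Real.pi) 0 ∈ 𝓝[Iic 0] (0 : ℝ) := Icc_mem_nhdsLE (by linarith)
  have n4 : Icc Real.pi (2 * Real.pi) ∈ 𝓝[Ici Real.pi] Real.pi := Icc_mem_nhdsGE (by linarith)
  have l0 := left_mem_Icc.2 Real.pi_pos.le
  have l1 := right_mem_Icc.2 Real.pi_pos.le
  -- composition with a reflection
  have refl : ∀ (c p : ℝ) (s t : Set ℝ), (∀ x, x ∈ t → c - x ∈ s) →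
      ContMDiffWithinAt 𝓘(ℝ, ℝ) 𝓘(ℝ, E) ∞ (extendPath γ₂) s (c - p) →
      ContMDiffWithinAt 𝓘(ℝ, ℝ) 𝓘(ℝ, E) ∞ (fun x => extendPath γ₂ (c - x)) t p := by
    intro c p s t hst hs
    have hsm : ContMDiffWithinAt 𝓘(ℝ, ℝ) 𝓘(ℝ, ℝ) ∞ (fun x : ℝ => c - x) t p :=
      (contDiff_const.sub contDiff_id).contMDiff.contMDiffAt.contMDiffWithinAt
    exact ContMDiffWithinAt.comp p hs hsm hst
  -- smoothness and flatness at `0`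
  have g0 : ContMDiffAt 𝓘(ℝ, ℝ) 𝓘(ℝ, E) ∞ F 0 ∧ FlatAt E F univ 0 := by
    have hr : extendPath γ₁ =ᶠ[𝓝[Ici 0] 0] F := by
      filter_upwards [n1] with t ht using (cup_left _ _ ht).symm
    have hl : (fun t => extendPath γ₂ (0 - t)) =ᶠ[𝓝[Iic 0] 0] F := by
      filter_upwards [n3] with t ht using (cup_neg _ _ h0 h1 ht).symm
    have hcr : ContMDiffWithinAt 𝓘(ℝ, ℝ) 𝓘(ℝ, E) ∞ (extendPath γ₁) (Ici 0) 0 :=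
      (m1.1 0 l0).mono_of_mem_nhdsWithin n1
    have hcl : ContMDiffWithinAt 𝓘(ℝ, ℝ) 𝓘(ℝ, E) ∞ (extendPath γ₂) (Ici 0) (0 - 0) := by
      rw [sub_zero]; exact (m2.1 0 l0).mono_of_mem_nhdsWithin n1
    have hfl : FlatAt E (extendPath γ₂) (Ici 0) (0 - 0) := by
      rw [sub_zero]; exact m2.2.2.1.congr_set e1
    refine contMDiffAt_glue ?_ ?_ ?_ ?_
    · exact (refl 0 0 (Ici 0) (Iic 0) (fun x hx => by simpa using hx) hcl).congr_of_eventuallyEq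
        hl.symm (hl.symm.eq_of_nhdsWithin self_mem_Iic)
    · exact hcr.congr_of_eventuallyEq hr.symm (hr.symm.eq_of_nhdsWithin self_mem_Ici)
    · exact (hfl.comp_const_sub (t := Iic 0) (fun x => by simp)).congr hl self_mem_Iic
    · exact (m1.2.2.1.congr_set e1).congr hr self_mem_Ici
  -- smoothness at `π`
  have gpi : ContMDiffAt 𝓘(ℝ, ℝ) 𝓘(ℝ, E) ∞ F Real.pi := by
    have hl : extendPath γ₁ =ᶠ[𝓝[Iic Real.pi] Real.pi] F := by
      filter_upwards [n2] with t ht using (cup_left _ _ ht).symm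
    have hr : (fun t => extendPath γ₂ (2 * Real.pi - t)) =ᶠ[𝓝[Ici Real.pi] Real.pi] F := by
      filter_upwards [n4] with t ht using (cup_right _ _ h0 h1 ht).symm
    have hs : 2 * Real.pi - Real.pi = Real.pi := by ring
    have hcl : ContMDiffWithinAt 𝓘(ℝ, ℝ) 𝓘(ℝ, E) ∞ (extendPath γ₁) (Iic Real.pi) Real.pi :=
      (m1.1 _ l1).mono_of_mem_nhdsWithin n2
    have hcr : ContMDiffWithinAt 𝓘(ℝ, ℝ) 𝓘(ℝ, E) ∞ (extendPath γ₂) (Iic Real.pi)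
        (2 * Real.pi - Real.pi) := by
      rw [hs]; exact (m2.1 _ l1).mono_of_mem_nhdsWithin n2
    have hfr : FlatAt E (extendPath γ₂) (Iic Real.pi) (2 * Real.pi - Real.pi) := by
      rw [hs]; exact m2.2.2.2.congr_set e2
    refine (contMDiffAt_glue ?_ ?_ ?_ ?_).1
    · exact hcl.congr_of_eventuallyEq hl.symm (hl.symm.eq_of_nhdsWithin self_mem_Iic)
    · exact (refl _ _ (Iic Real.pi) (Ici Real.pi)
        (fun x hx => by simp only [mem_Iic, mem_Ici] at hx ⊢; linarith) hcr).congr_of_eventuallyEq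
        hr.symm (hr.symm.eq_of_nhdsWithin self_mem_Ici)
    · exact (m1.2.2.2.congr_set e2).congr hl self_mem_Iic
    · refine (hfr.comp_const_sub (t := Ici Real.pi) (fun x => ?_)).congr hr self_mem_Ici
      simp only [mem_Iic, mem_Ici]; constructor <;> intro h <;> linarith
  have gen : ∀ t ∈ Ico (0 : ℝ) (0 + 2 * Real.pi), ContMDiffAt 𝓘(ℝ, ℝ) 𝓘(ℝ, E) ∞ F t := by
    rintro t ⟨ht0, ht1⟩
    rcases ht0.eq_or_lt with rfl | ht0
    · exact g0.1
    rcases lt_trichotomy t Real.pi with h | rfl | h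
    · refine ((m1.1 t ⟨ht0.le, h.le⟩).contMDiffAt (Icc_mem_nhds ht0 h)).congr_of_eventuallyEq ?_
      filter_upwards [Icc_mem_nhds ht0 h] with s hs using cup_left _ _ hs
    · exact gpi
    · have hm : 2 * Real.pi - t ∈ Icc 0 Real.pi := ⟨by linarith, by linarith⟩
      have hn : Icc 0 Real.pi ∈ 𝓝 (2 * Real.pi - t) := Icc_mem_nhds (by linarith) (by linarith)
      have := refl (2 * Real.pi) t univ univ (fun _ _ => mem_univ _)
        ((m2.1 _ hm).contMDiffAt hn)
      refine ContMDiffAt.congr_of_eventuallyEq this ?_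
      filter_upwards [Icc_mem_nhds h (show t < 2 * Real.pi by linarith)] with s hs
        using cup_right _ _ h0 h1 hs
  refine ⟨?_, ?_, g0.2⟩
  · intro t
    set c := toIcoDiv Real.two_pi_pos 0 t • (2 * Real.pi) with hc
    have hmem : t - c ∈ Ico (0 : ℝ) (0 + 2 * Real.pi) :=
      sub_toIcoDiv_zsmul_mem_Ico Real.two_pi_pos 0 t
    have hper : F = fun s => F (s - c) := by
      funext s
      have : (c : S1) = 0 := (AddCircle.coe_eq_zero_iff _).2 ⟨_, rfl⟩
      simp [F, this]
    have hsm : ContMDiffAt 𝓘(ℝ, ℝ) 𝓘(ℝ, ℝ) ∞ (fun x : ℝ => x - c) t :=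
      (contDiff_id.sub contDiff_const).contMDiff.contMDiffAt
    change ContMDiffAt 𝓘(ℝ, ℝ) 𝓘(ℝ, E) ∞ F t
    rw [hper]
    have hF' : ContMDiffAt 𝓘(ℝ, ℝ) 𝓘(ℝ, E) ∞ F ((fun x : ℝ => x - c) t) := gen _ hmem
    exact ContMDiffAt.comp (I' := 𝓘(ℝ, ℝ)) (g := F) (f := fun x : ℝ => x - c) t hF' hsm
  · have := cup_left γ₁ γ₂ (t := 0) l0
    rw [extendPath_of_mem _ l0] at this
    exact this.trans m1.2.1

/-- The diagonal homomorphism `P_e G → ΩG`, `γ ↦ γ ∪ γ`. -/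
noncomputable def doubleHom : pathGroup E G →* basedLoopGroup E G where
  toFun γ := ⟨cup γ.1 γ.1, cup_mem γ.2 γ.2 rfl⟩
  map_one' := Subtype.ext (cup_one (X := G))
  map_mul' a b := Subtype.ext (cup_mul a.1 b.1)

end Maps

/-! ### Fréchet Lie group structures on loop and path groups -/

section Models

variable (E : Type*) [NormedAddCommGroup E] [NormedSpace ℝ E]

/-- Smooth loops in the vector space `E` that vanish at `0` with all their derivatives. -/
def basedLoopModule : Submodule ℝ (S1 → E) where
  carrier := {X | ContDiff ℝ ∞ (fun t : ℝ => X t) ∧ ∀ k, iteratedDeriv k (fun t : ℝ => X t) 0 = 0}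
  add_mem' := fun {a b} ha hb => ⟨ha.1.add hb.1, fun k => by
    have := iteratedDeriv_fun_add (n := k) (x := (0 : ℝ))
      (ha.1.contDiffAt.of_le (by exact_mod_cast le_top))
      (hb.1.contDiffAt.of_le (by exact_mod_cast le_top))
    exact this.trans (by rw [ha.2 k, hb.2 k, add_zero])⟩
  zero_mem' := ⟨contDiff_const, fun k => by
    change iteratedDeriv k (fun _ : ℝ => (0 : E)) 0 = 0
    simp⟩
  smul_mem' := fun c a ha => ⟨ha.1.const_smul c, fun k => by
    have := iteratedDeriv_fun_const_smul (n := k) (x := (0 : ℝ))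
      (ha.1.contDiffAt.of_le (by exact_mod_cast le_top)) c
    exact this.trans (by rw [ha.2 k, smul_zero])⟩

/-- The space `ΩE` of smooth loops in `E` that vanish at `0` with all their derivatives. -/
def BasedLoopSpace : Type _ := basedLoopModule E

noncomputable instance : AddCommGroup (BasedLoopSpace E) :=
  inferInstanceAs (AddCommGroup (basedLoopModule E))

noncomputable instance : Module ℝ (BasedLoopSpace E) :=
  inferInstanceAs (Module ℝ (basedLoopModule E))

instance : CoeFun (BasedLoopSpace E) (fun _ => S1 → E) := ⟨fun X => X.1⟩

/-- The `C^∞`-topology: uniform convergence of all derivatives. -/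
noncomputable instance : UniformSpace (BasedLoopSpace E) :=
  UniformSpace.comap
    (fun X (k : ℕ) => UniformFun.ofFun (iteratedDeriv k fun t : ℝ => X t)) inferInstance

/-- The subspace `Ω_I E` of loops vanishing outside of `I`, with the subspace topology. -/
def basedLoopSpaceIn (I : Set S1) : Submodule ℝ (BasedLoopSpace E) where
  carrier := {X | ∀ t ∉ I, X t = 0}
  add_mem' := fun {a b} ha hb t ht => by
    change a t + b t = 0
    rw [ha t ht, hb t ht, add_zero]
  zero_mem' := fun _ _ => rfl
  smul_mem' := fun c a ha t ht => by
    change c • a t = 0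
    rw [ha t ht, smul_zero]

/-- Smooth paths `[0, π] → E` that start at `0` and are flat at both end points. -/
def pathModule : Submodule ℝ (HalfInterval → E) where
  carrier := {X | ContDiffOn ℝ ∞ (extendPath X) (Icc 0 Real.pi) ∧ X startPt = 0 ∧
    ∀ k, 1 ≤ k → iteratedDerivWithin k (extendPath X) (Icc 0 Real.pi) 0 = 0 ∧
      iteratedDerivWithin k (extendPath X) (Icc 0 Real.pi) Real.pi = 0}
  add_mem' := fun {a b} ha hb => by
    have hu := uniqueDiffOn_Icc Real.pi_pos
    refine ⟨ContDiffOn.add ha.1 hb.1, by simp [ha.2.1, hb.2.1], fun k hk => ?_⟩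
    have key : ∀ p ∈ Icc 0 Real.pi, iteratedDerivWithin k (extendPath (a + b)) (Icc 0 Real.pi) p =
        iteratedDerivWithin k (extendPath a) (Icc 0 Real.pi) p +
        iteratedDerivWithin k (extendPath b) (Icc 0 Real.pi) p := fun p hp =>
      iteratedDerivWithin_add hp hu ((ha.1 p hp).of_le (by exact_mod_cast le_top))
        ((hb.1 p hp).of_le (by exact_mod_cast le_top))
    rw [key _ (left_mem_Icc.2 Real.pi_pos.le), key _ (right_mem_Icc.2 Real.pi_pos.le),
      (ha.2.2 k hk).1, (ha.2.2 k hk).2, (hb.2.2 k hk).1, (hb.2.2 k hk).2]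
    simp
  zero_mem' := ⟨contDiffOn_const, rfl, fun k hk => by
    have : extendPath (0 : HalfInterval → E) = 0 := rfl
    rw [this]
    simp⟩
  smul_mem' := fun c a ha => by
    have hu := uniqueDiffOn_Icc Real.pi_pos
    refine ⟨ContDiffOn.const_smul c ha.1, by simp [ha.2.1], fun k hk => ?_⟩
    have key : ∀ p ∈ Icc 0 Real.pi, iteratedDerivWithin k (extendPath (c • a)) (Icc 0 Real.pi) p =
        c • iteratedDerivWithin k (extendPath a) (Icc 0 Real.pi) p := fun p hp =>
      iteratedDerivWithin_const_smul hp hu c ((ha.1 p hp).of_le (by exact_mod_cast le_top))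
    rw [key _ (left_mem_Icc.2 Real.pi_pos.le), key _ (right_mem_Icc.2 Real.pi_pos.le),
      (ha.2.2 k hk).1, (ha.2.2 k hk).2]
    simp

/-- The space `P_0 E` of smooth paths `[0, π] → E` that start at `0` and are flat at both end
points. -/
def PathSpace : Type _ := pathModule E

noncomputable instance : AddCommGroup (PathSpace E) := inferInstanceAs (AddCommGroup (pathModule E))

noncomputable instance : Module ℝ (PathSpace E) := inferInstanceAs (Module ℝ (pathModule E))

instance : CoeFun (PathSpace E) (fun _ => HalfInterval → E) := ⟨fun X => X.1⟩

/-- The `C^∞`-topology: uniform convergence of all derivatives on `[0, π]`. -/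
noncomputable instance : UniformSpace (PathSpace E) :=
  UniformSpace.comap
    (fun X (k : ℕ) => UniformFun.ofFun fun t : HalfInterval =>
      iteratedDerivWithin k (extendPath X) (Icc 0 Real.pi) t) inferInstance

end Models

section Charts

variable {E : Type*} [NormedAddCommGroup E] [NormedSpace ℝ E]
  {G : Type*} [TopologicalSpace G] [ChartedSpace E G] [Group G]

/-- The standard charts of a mapping group: let `Γ` be a group of maps `γ` from a set `D` to `G`
(with values `ev γ t`), and let `Y` be the corresponding space of maps to the model space `E`.
Every `g ∈ Γ` and every smooth chart `φ` of `G` around `e` with `φ(e) = 0` give a chart of `Γ`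
around `g`, which is defined on all `γ` such that `g⁻¹γ` has values in the domain of `φ`, and which
sends `γ` to `φ ∘ (g⁻¹γ)`. -/
def mappingGroupCharts {Γ Y D : Type*} (ev : Γ → D → G) (evY : Y → D → E) :
    Set (PartialEquiv Γ Y) :=
  {p | ∃ g : Γ, ∃ φ ∈ IsManifold.maximalAtlas 𝓘(ℝ, E) ∞ G, (1 : G) ∈ φ.source ∧ φ 1 = 0 ∧
    p.source = {γ | ∀ t, (ev g t)⁻¹ * ev γ t ∈ φ.source} ∧
    p.target = {X | ∀ t, evY X t ∈ φ.target} ∧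
    ∀ γ ∈ p.source, ∀ t, evY (p γ) t = φ ((ev g t)⁻¹ * ev γ t)}

variable (E G)
variable [LieGroup 𝓘(ℝ, E) ∞ G]

/-- The charts of the Fréchet Lie group `ΩG`. -/
def basedLoopCharts : Set (PartialEquiv (basedLoopGroup E G) (BasedLoopSpace E)) :=
  mappingGroupCharts (D := S1) (fun γ => γ.1) (fun X => X.1)

/-- The charts of the Fréchet Lie group `Ω_I G`. -/
def basedLoopInCharts (I : Set S1) :
    Set (PartialEquiv (basedLoopGroupIn E G I) (basedLoopSpaceIn E I)) :=
  mappingGroupCharts (D := S1) (fun γ => γ.1) (fun X => X.1.1)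

/-- The charts of the Fréchet Lie group `P_e G`. -/
def pathCharts : Set (PartialEquiv (pathGroup E G) (PathSpace E)) :=
  mappingGroupCharts (D := HalfInterval) (fun γ => γ.1) (fun X => X.1)

/-- A central extension of the based loop group `ΩG` by `U(1)`, with total group `T` modelled on the
Fréchet space `F`. -/
abbrev LoopExtension (T F : Type*) [Group T] [AddCommGroup F] [Module ℝ F] [UniformSpace F] :=
  CentralExtension (basedLoopCharts E G) T F

end Charts

/-! ### Disjoint commutativity and the canonical action -/

namespace LoopExtension

variable {E : Type*} [NormedAddCommGroup E] [NormedSpace ℝ E]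
  {G : Type*} [TopologicalSpace G] [ChartedSpace E G] [Group G] [LieGroup 𝓘(ℝ, E) ∞ G]
  {T F : Type*} [Group T] [AddCommGroup F] [Module ℝ F] [UniformSpace F]
  (X : LoopExtension E G T F)

/-- The restriction of the central extension to `Ω_I G`, as a subgroup of the total group. -/
def above (I : Set S1) : Subgroup T where
  carrier := {Φ | (X.proj Φ : S1 → G) ∈ basedLoopGroupIn E G I}
  mul_mem' := fun {a b} ha hb => by
    simp only [mem_ofPred_eq, map_mul, Subgroup.coe_mul] at ha hb ⊢
    exact mul_mem ha hb
  one_mem' := by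
    simp only [mem_ofPred_eq, map_one, Subgroup.coe_one]
    exact one_mem _
  inv_mem' := fun {a} ha => by
    simp only [mem_ofPred_eq, map_inv, Subgroup.coe_inv] at ha ⊢
    exact inv_mem ha

/-- The projection of the restricted central extension to `Ω_I G`. -/
def projAbove (I : Set S1) : X.above I →* basedLoopGroupIn E G I where
  toFun Φ := ⟨X.proj Φ.1, Φ.2⟩
  map_one' := by ext1; simp
  map_mul' a b := by ext1; simp

/-- The charts of the restricted central extension over `Ω_I G`: it is the pullback of the principal
bundle along the inclusion of `Ω_I G`, so its charts are given by a local trivialization `τ`, a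
chart `c` of `Ω_I G` and a chart `u` of `U(1)`. -/
def aboveCharts (I : Set S1) : Set (PartialEquiv (X.above I) (basedLoopSpaceIn E I × LineModel)) :=
  {p | ∃ V τ, IsLocalTrivialization (basedLoopCharts E G) X.charts X.incl X.proj V τ ∧
    ∃ c ∈ basedLoopInCharts E G I, ∃ u ∈ circleCharts,
      p.source = {Φ : X.above I | X.proj Φ ∈ V ∧ X.projAbove I Φ ∈ c.source ∧ (τ Φ).2 ∈ u.source} ∧
      ∀ Φ ∈ p.source, p Φ = (c (X.projAbove I Φ), u (τ Φ).2)}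

/-- The central extension is disjoint commutative if its restrictions to `Ω_I G` and `Ω_J G`
commute whenever `I` and `J` are disjoint subsets of the circle. -/
def DisjointCommutative : Prop :=
  ∀ I J : Set S1, Disjoint I J → ∀ Φ ∈ X.above I, ∀ Ψ ∈ X.above J, Φ * Ψ = Ψ * Φ

instance above_normal (I : Set S1) : (X.above I).Normal where
  conj_mem := fun Φ hΦ Ψ => by
    refine ⟨(X.proj (Ψ * Φ * Ψ⁻¹)).2, fun t ht => ?_⟩
    have := hΦ.2 t ht
    simp [this]

/-- The homomorphism `t` from the restriction to `Ω_{(0,π)} G` to `P_e G`: it sends `Φ` to the first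
half of the loop below `Φ`. -/
noncomputable def toPath : X.above upperHalf →* pathGroup E G :=
  restrictHom.comp (X.projAbove upperHalf)

/-- The conjugation action of the central extension on its restriction to `Ω_I G` descends to an
action of `ΩG`. -/
noncomputable def loopAction (I : Set S1) : basedLoopGroup E G →* MulAut (X.above I) :=
  X.proj.liftOfSurjective X.proj_surjective
    ⟨MulAut.conjNormal (H := X.above I), fun Ψ hΨ => by
      rw [X.ker_eq_range] at hΨ
      obtain ⟨z, rfl⟩ := hΨ
      rw [MonoidHom.mem_ker]
      ext Φ
      rw [MulAut.conjNormal_apply, X.central z Φ]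
      simp⟩

theorem loopAction_proj (I : Set S1) (Ψ : T) (Φ : X.above I) :
    (X.loopAction I (X.proj Ψ) Φ : T) = Ψ * Φ * Ψ⁻¹ := by
  rw [loopAction]
  erw [MonoidHom.liftOfRightInverse_comp_apply]
  exact MulAut.conjNormal_apply _ _

/-- The canonical action of `P_e G` on the restriction to `Ω_{(0,π)} G`: the pullback of the
conjugation action of `ΩG` along `γ ↦ γ ∪ γ`. -/
noncomputable def canonicalAction : pathGroup E G →* MulAut (X.above upperHalf) :=
  (X.loopAction upperHalf).comp doubleHom

/-- `canonicalAction γ` is conjugation by any lift of `γ ∪ γ`. -/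
theorem canonicalAction_apply (γ : pathGroup E G) (Ψ : T) (hΨ : X.proj Ψ = doubleHom γ)
    (Φ : X.above upperHalf) : (X.canonicalAction γ Φ : T) = Ψ * Φ * Ψ⁻¹ := by
  rw [← X.loopAction_proj, hΨ]; rfl

end LoopExtension

end LoopCrossed

open LoopCrossed
open scoped Manifold ContDiff

namespace LoopCrossed

/-! ### Calculus of Bastiani maps -/

section Bastiani

universe u v w

variable {E : Type u} [AddCommGroup E] [Module ℝ E] [TopologicalSpace E]
  {F : Type v} [AddCommGroup F] [Module ℝ F] [TopologicalSpace F]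
  {H : Type w} [AddCommGroup H] [Module ℝ H] [TopologicalSpace H]

/-! The algebra is short. For `Φ` over `(0,π)`, let `Θ` be a lift of `t(Φ) ∪ t(Φ)`. This loop agrees
with the loop below `Φ` on `(0,π)`, so `Φ⁻¹Θ` lies over the complement of `(0,π)`, and disjoint
commutativity makes it commute with every `Ψ` over `(0,π)`. Hence conjugation by `Θ` and by `Φ`
agree on such `Ψ`, which is the Peiffer identity (`canonicalAction_toPath`). If `t(Φ) = e`, then the
loop below `Φ` is trivial on `(0,π)` and outside of it, so `Φ` comes from the central `U(1)` and the
action fixes it (`canonicalAction_of_toPath_eq_one`).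

Most of the work is smoothness. All mapping groups are treated at once by embedding them in `ΩG`:
`Ω_I G` by inclusion and `P_e G` by doubling `γ ↦ γ ∪ γ`, with model spaces embedded as closed
subspaces of `ΩE` (`IsMappingGroup`). In the standard charts, pointwise operations become
superposition operators sending `z` to the curve `t ↦ f(t, L z t)`, with `f` smooth on an open
subset of a normed space and `L` a linear family of curves. Such operators are Bastiani smooth
(`bastianiSmoothOn_superposition`): the directional derivative is again a superposition operator,
built from a derivative of `f`, so induction on the order applies. Convergence of all
`t`-derivatives reduces similarly to order zero by replacing `f` with its tangent map
(`tendsto_iteratedDeriv_quotient`). This yields the Lie group structures and the smoothness of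
doubling, restriction and conjugation.

The restricted extension is charted by a local trivialization together with charts of `Ω_I G` and
`U(1)`. A map into it is smooth once its composites to the total group and to `Ω_I G` are
(`smoothMap_above_of`). This gives its Lie group structure, and also the smoothness of the action:
locally `γ ∪ γ` has a smooth lift (`exists_smooth_lift`), so the action is conjugation by it in the
total group, while over `Ω_I G` it is the pointwise conjugation by `γ ∪ γ`. -/

theorem BastianiContDiffOn.continuousOn {k : ℕ} {f : E → F} {U : Set E}
    (h : BastianiContDiffOn k E f U) : ContinuousOn f U := by
  cases k with
  | zero => exact h
  | succ k => exact h.1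

theorem BastianiContDiffOn.mono {k : ℕ} {f : E → F} {U V : Set E}
    (h : BastianiContDiffOn k E f U) (hVU : V ⊆ U) : BastianiContDiffOn k E f V := by
  induction k generalizing E with
  | zero => exact ContinuousOn.mono h hVU
  | succ k ih =>
    obtain ⟨hc, df, hd, hk⟩ := h
    exact ⟨hc.mono hVU, df, fun x hx => hd x (hVU hx), ih hk (prod_mono hVU Subset.rfl)⟩

theorem BastianiContDiffOn.of_succ {k : ℕ} {f : E → F} {U : Set E}
    (h : BastianiContDiffOn (k + 1) E f U) : BastianiContDiffOn k E f U := by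
  induction k generalizing E with
  | zero => exact h.1
  | succ k ih =>
    obtain ⟨hc, df, hd, hk⟩ := h
    exact ⟨hc, df, hd, ih hk⟩

theorem continuous_line [ContinuousAdd E] [ContinuousSMul ℝ E] (x v : E) :
    Continuous fun t : ℝ => x + t • v := by fun_prop

theorem eventually_line_mem [ContinuousAdd E] [ContinuousSMul ℝ E] {U : Set E} (hU : IsOpen U)
    {x : E} (hx : x ∈ U) (v : E) : ∀ᶠ t : ℝ in 𝓝[≠] 0, x + t • v ∈ U := by
  have h : ∀ᶠ t : ℝ in 𝓝 0, x + t • v ∈ U :=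
    (continuous_line x v).continuousAt.eventually_mem (hU.mem_nhds (by simpa using hx))
  exact h.filter_mono nhdsWithin_le_nhds

theorem BastianiContDiffOn.congr [ContinuousAdd E] [ContinuousSMul ℝ E] {k : ℕ} {f g : E → F}
    {U : Set E} (h : BastianiContDiffOn k E f U) (hU : IsOpen U) (hfg : EqOn f g U) :
    BastianiContDiffOn k E g U := by
  cases k with
  | zero => exact ContinuousOn.congr h hfg.symm
  | succ k =>
    obtain ⟨hc, df, hd, hk⟩ := h
    refine ⟨hc.congr hfg.symm, df, fun x hx v => (hd x hx v).congr' ?_, hk⟩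
    filter_upwards [eventually_line_mem hU hx v] with t ht
    rw [hfg ht, hfg hx]

theorem bastianiContDiffOn_of_locally [ContinuousAdd E] [ContinuousSMul ℝ E] [T2Space F] {k : ℕ}
    {f : E → F} {U : Set E}
    (h : ∀ x ∈ U, ∃ V ⊆ U, IsOpen V ∧ x ∈ V ∧ BastianiContDiffOn k E f V) :
    BastianiContDiffOn k E f U := by
  have hc : ContinuousOn f U := fun x hx => by
    obtain ⟨V, -, hVo, hxV, hV⟩ := h x hx
    exact (hV.continuousOn.continuousAt (hVo.mem_nhds hxV)).continuousWithinAt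
  induction k generalizing E with
  | zero => exact hc
  | succ k ih =>
    choose! V hVU hVo hxV hV using h
    choose! df hd hk using fun x hx => (hV x hx).2
    -- The derivative at `q` is taken from the neighbourhood chosen at its own base point. On `V x`
    -- it agrees with the derivative chosen for `x`, because limits in `F` are unique.
    refine ⟨hc, fun q => df q.1 q, fun x hx v => hd x hx x (hxV x hx) v, ?_⟩
    have key : ∀ q ∈ U ×ˢ (univ : Set E), ∃ W ⊆ U ×ˢ (univ : Set E), IsOpen W ∧ q ∈ W ∧
        BastianiContDiffOn k (E × E) (fun q => df q.1 q) W := by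
      rintro ⟨x, v⟩ ⟨hx, -⟩
      refine ⟨V x ×ˢ univ, prod_mono (hVU x hx) Subset.rfl, (hVo x hx).prod isOpen_univ,
        ⟨hxV x hx, mem_univ _⟩, (hk x hx).congr ((hVo x hx).prod isOpen_univ) ?_⟩
      rintro ⟨y, w⟩ ⟨hy, -⟩
      have hyU := hVU x hx hy
      exact tendsto_nhds_unique (hd x hx y hy w) (hd y hyU y (hxV y hyU) w)
    refine ih key fun q hq => ?_
    obtain ⟨W, -, hWo, hqW, hW⟩ := key q hq
    exact (hW.continuousOn.continuousAt (hWo.mem_nhds hqW)).continuousWithinAt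

theorem BastianiContDiffOn.prodMk {k : ℕ} {f : E → F} {g : E → H} {U : Set E}
    (hf : BastianiContDiffOn k E f U) (hg : BastianiContDiffOn k E g U) :
    BastianiContDiffOn k E (fun x => (f x, g x)) U := by
  induction k generalizing E with
  | zero => exact ContinuousOn.prodMk hf hg
  | succ k ih =>
    obtain ⟨hc, df, hd, hk⟩ := hf
    obtain ⟨hc', dg, hd', hk'⟩ := hg
    exact ⟨hc.prodMk hc', fun q => (df q, dg q),
      fun x hx v => (hd x hx v).prodMk_nhds (hd' x hx v), ih hk hk'⟩

/-- Needs no local convexity, unlike the general chain rule, whose proof uses it to precompose with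
the projection `E × E → E`. -/
theorem BastianiContDiffOn.comp_clm {k : ℕ} {f : F → H} {U : Set F}
    (hf : BastianiContDiffOn k F f U) (L : E →L[ℝ] F) :
    BastianiContDiffOn k E (fun x => f (L x)) (L ⁻¹' U) := by
  induction k generalizing E F with
  | zero => exact ContinuousOn.comp hf L.continuous.continuousOn (mapsTo_preimage _ _)
  | succ k ih =>
    obtain ⟨hc, df, hd, hk⟩ := hf
    refine ⟨hc.comp L.continuous.continuousOn (mapsTo_preimage _ _),
      fun q => df ((L.prodMap L) q), fun x hx v => ?_, ?_⟩
    · simpa using hd (L x) hx (L v)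
    · exact (ih hk (L.prodMap L)).mono fun q hq => ⟨hq.1, mem_univ _⟩

theorem BastianiContDiffOn.clm_comp {k : ℕ} {f : E → F} {U : Set E}
    (hf : BastianiContDiffOn k E f U) (L : F →L[ℝ] H) :
    BastianiContDiffOn k E (fun x => L (f x)) U := by
  induction k generalizing E with
  | zero => exact L.continuous.comp_continuousOn hf
  | succ k ih =>
    obtain ⟨hc, df, hd, hk⟩ := hf
    refine ⟨L.continuous.comp_continuousOn hc, fun q => L (df q), fun x hx v => ?_, ih hk⟩
    have := (L.continuous.tendsto _).comp (hd x hx v)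
    simpa [Function.comp_def] using this

theorem bastianiContDiffOn_const (k : ℕ) (c : F) (U : Set E) :
    BastianiContDiffOn k E (fun _ => c) U := by
  induction k generalizing E c with
  | zero => exact continuousOn_const
  | succ k ih =>
    exact ⟨continuousOn_const, fun _ => 0, fun x _ v => by simpa using tendsto_const_nhds, ih 0 _⟩

/-! ### The mean value estimate and the chain rule -/

section Chain

variable [IsTopologicalAddGroup H] [ContinuousSMul ℝ H] [LocallyConvexSpace ℝ H]

theorem exists_isClosed_convex_subset {c : H} {N : Set H} (hN : N ∈ 𝓝 c) :
    ∃ C ∈ 𝓝 c, IsClosed C ∧ Convex ℝ C ∧ C ⊆ N := by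
  obtain ⟨K, hK, hKc, hKN⟩ := exists_mem_nhds_isClosed_subset hN
  obtain ⟨C, hC, hCK⟩ := ((LocallyConvexSpace.convex_basis (𝕜 := ℝ) c).mem_iff).1 hK
  exact ⟨closure C, mem_of_superset hC.1 subset_closure, isClosed_closure, hC.2.closure,
    (closure_minimal hCK hKc).trans hKN⟩

/-- Mean value estimate: a difference quotient lies in every closed convex set containing the
directional derivatives along the segment. -/
theorem differenceQuotient_mem_of_convex {F : Type v} [AddCommGroup F] [Module ℝ F] {g : F → H} {dg : F × F → H} {y w : F} {δ : ℝ}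
    (hd : ∀ s : ℝ, |s| < δ → Tendsto (fun t : ℝ => t⁻¹ • (g (y + s • w + t • w) - g (y + s • w)))
      (𝓝[≠] 0) (𝓝 (dg (y + s • w, w))))
    {C : Set H} (hC : IsClosed C) (hCc : Convex ℝ C)
    (hmem : ∀ s : ℝ, |s| < δ → dg (y + s • w, w) ∈ C) {t : ℝ} (ht : |t| < δ) (ht0 : t ≠ 0) :
    t⁻¹ • (g (y + t • w) - g y) ∈ C := by
  by_contra hq
  -- A functional separating the quotient from `C` reduces the claim to the real mean value theorem
  -- for `s ↦ l (g (y + s • w))`.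
  obtain ⟨l, a, hl, ha⟩ := geometric_hahn_banach_closed_point hCc hC hq
  have hder : ∀ s : ℝ, |s| < δ →
      HasDerivAt (fun r : ℝ => l (g (y + r • w))) (l (dg (y + s • w, w))) s := fun s hs => by
    rw [hasDerivAt_iff_tendsto_slope_zero]
    have := (l.continuous.tendsto _).comp (hd s hs)
    refine this.congr fun t => ?_
    simp only [Function.comp_apply, map_smul, map_sub, add_smul, add_assoc]
  have hval : ∃ s : ℝ, |s| < δ ∧ l (dg (y + s • w, w)) = t⁻¹ * (l (g (y + t • w)) - l (g y)) := by
    rcases ht0.lt_or_gt with h | h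
    · have hb : ∀ s ∈ Icc t 0, |s| < δ := fun s hs =>
        lt_of_le_of_lt (by rw [abs_of_nonpos hs.2, abs_of_neg h]; linarith [hs.1]) ht
      obtain ⟨s, hs, hs'⟩ := exists_hasDerivAt_eq_slope (fun r : ℝ => l (g (y + r • w)))
        (fun s => l (dg (y + s • w, w))) h
        (fun s hs => (hder s (hb s hs)).continuousAt.continuousWithinAt)
        (fun s hs => hder s (hb s (Ioo_subset_Icc_self hs)))
      refine ⟨s, hb s (Ioo_subset_Icc_self hs), hs'.trans ?_⟩
      simp only [zero_smul, add_zero]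
      field_simp
      ring
    · have hb : ∀ s ∈ Icc 0 t, |s| < δ := fun s hs =>
        lt_of_le_of_lt (by rw [abs_of_nonneg hs.1, abs_of_pos h]; exact hs.2) ht
      obtain ⟨s, hs, hs'⟩ := exists_hasDerivAt_eq_slope (fun r : ℝ => l (g (y + r • w)))
        (fun s => l (dg (y + s • w, w))) h
        (fun s hs => (hder s (hb s hs)).continuousAt.continuousWithinAt)
        (fun s hs => hder s (hb s (Ioo_subset_Icc_self hs)))
      refine ⟨s, hb s (Ioo_subset_Icc_self hs), hs'.trans ?_⟩
      simp only [zero_smul, add_zero]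
      field_simp
      ring
  obtain ⟨s, hs, hs'⟩ := hval
  have h1 := hl _ (hmem s hs)
  rw [hs'] at h1
  simp only [map_smul, map_sub, smul_eq_mul] at ha
  linarith

variable [IsTopologicalAddGroup F] [ContinuousSMul ℝ F]

/-- The direction may vary along with the step, which is what the chain rule needs. By continuity,
`dg` stays in a given closed convex neighbourhood of its limit value along all short segments with
nearby directions, and the mean value estimate then keeps the quotients there. -/
theorem tendsto_differenceQuotient {g : F → H} {dg : F × F → H} {V : Set F} (hV : IsOpen V)
    (hd : ∀ y ∈ V, ∀ w : F, Tendsto (fun t : ℝ => t⁻¹ • (g (y + t • w) - g y)) (𝓝[≠] 0)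
      (𝓝 (dg (y, w)))) (hdg : ContinuousOn dg (V ×ˢ univ)) {y : F} (hy : y ∈ V) (w₀ : F) :
    Tendsto (fun q : ℝ × F => q.1⁻¹ • (g (y + q.1 • q.2) - g y)) ((𝓝[≠] 0) ×ˢ 𝓝 w₀)
      (𝓝 (dg (y, w₀))) := by
  intro N hN
  obtain ⟨C, hC, hCc, hCv, hCN⟩ := exists_isClosed_convex_subset hN
  have h1 : ContinuousAt (fun q : ℝ × F => (y + q.1 • q.2, q.2)) (0, w₀) := by fun_prop
  have h2 : V ×ˢ univ ∈ 𝓝 (y + (0 : ℝ) • w₀, w₀) :=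
    (hV.prod isOpen_univ).mem_nhds ⟨by simpa using hy, mem_univ _⟩
  have h3 : ContinuousAt dg (y + (0 : ℝ) • w₀, w₀) := hdg.continuousAt h2
  have h4 : ∀ᶠ q : ℝ × F in 𝓝 (0, w₀), y + q.1 • q.2 ∈ V ∧ dg (y + q.1 • q.2, q.2) ∈ C := by
    have hC' : C ∈ 𝓝 (dg (y + (0 : ℝ) • w₀, w₀)) := by simpa using hC
    filter_upwards [h1.eventually_mem h2, h1.eventually (h3.eventually_mem hC')] with q hq hq'
    exact ⟨hq.1, hq'⟩
  rw [nhds_prod_eq] at h4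
  obtain ⟨pa, ha, pb, hb, hab⟩ := eventually_prod_iff.1 h4
  obtain ⟨δ, hδ, hδa⟩ := Metric.eventually_nhds_iff.1 ha
  have ha' : ∀ᶠ t : ℝ in 𝓝[≠] 0, |t| < δ ∧ t ≠ 0 := by
    have : ∀ᶠ t : ℝ in 𝓝 0, |t| < δ := by
      filter_upwards [Metric.ball_mem_nhds (0 : ℝ) hδ] with t ht
      simpa using ht
    exact (this.filter_mono nhdsWithin_le_nhds).and self_mem_nhdsWithin
  refine mem_map.2 ?_
  filter_upwards [ha'.prod_mk hb] with q hq
  have hs : ∀ s : ℝ, |s| < δ → y + s • q.2 ∈ V ∧ dg (y + s • q.2, q.2) ∈ C := fun s hs =>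
    hab (hδa (by simpa using hs)) hq.2
  exact hCN (differenceQuotient_mem_of_convex (fun s h => hd _ (hs s h).1 _) hCc hCv
    (fun s h => (hs s h).2) hq.1.1 hq.1.2)

/-- The increment of `f` is `t` times its difference quotient, so the quotient of `g ∘ f` is a
quotient of `g` with varying direction, and `tendsto_differenceQuotient` applies. The derivative `dg
(f x, df (x, v))` is again a composite, of one order less. -/
theorem BastianiContDiffOn.comp {k : ℕ} {g : F → H} {f : E → F} {V : Set F} {U : Set E}
    (hg : BastianiContDiffOn k F g V) (hf : BastianiContDiffOn k E f U) (hV : IsOpen V)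
    (hfV : MapsTo f U V) : BastianiContDiffOn k E (fun x => g (f x)) U := by
  induction k generalizing E F with
  | zero => exact ContinuousOn.comp hg hf hfV
  | succ k ih =>
    have hf' := hf.of_succ
    obtain ⟨hgc, dg, hgd, hgk⟩ := hg
    obtain ⟨hfc, df, hfd, hfk⟩ := hf
    refine ⟨hgc.comp hfc hfV, fun q => dg (f q.1, df q), fun x hx v => ?_, ?_⟩
    · have h := tendsto_differenceQuotient hV hgd hgk.continuousOn (hfV hx) (df (x, v))
      have h2 : Tendsto (fun t : ℝ => (t, t⁻¹ • (f (x + t • v) - f x))) (𝓝[≠] 0)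
          ((𝓝[≠] 0) ×ˢ 𝓝 (df (x, v))) := tendsto_id.prodMk (hfd x hx v)
      refine (h.comp h2).congr' ?_
      filter_upwards [self_mem_nhdsWithin] with t ht
      have ht' : t ≠ 0 := ht
      simp [smul_smul, ht']
    · have h1 : BastianiContDiffOn k (E × E) (fun q : E × E => f q.1) (U ×ˢ univ) :=
        (hf'.comp_clm (ContinuousLinearMap.fst ℝ E E)).mono fun q hq => hq.1
      exact ih hgk (h1.prodMk hfk) (hV.prod isOpen_univ) fun q hq => ⟨hfV hq.1, mem_univ _⟩

end Chain

/-! ### The same rules for smooth maps -/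

theorem BastianiSmoothOn.continuousOn {f : E → F} {U : Set E} (h : BastianiSmoothOn f U) :
    ContinuousOn f U := h 0

theorem BastianiSmoothOn.mono {f : E → F} {U V : Set E} (h : BastianiSmoothOn f U) (hVU : V ⊆ U) :
    BastianiSmoothOn f V := fun k => (h k).mono hVU

theorem BastianiSmoothOn.congr [ContinuousAdd E] [ContinuousSMul ℝ E] {f g : E → F} {U : Set E}
    (h : BastianiSmoothOn f U) (hU : IsOpen U) (hfg : EqOn f g U) : BastianiSmoothOn g U :=
  fun k => (h k).congr hU hfg

theorem bastianiSmoothOn_of_locally [ContinuousAdd E] [ContinuousSMul ℝ E] [T2Space F] {f : E → F}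
    {U : Set E} (h : ∀ x ∈ U, ∃ V ⊆ U, IsOpen V ∧ x ∈ V ∧ BastianiSmoothOn f V) :
    BastianiSmoothOn f U := fun k => bastianiContDiffOn_of_locally fun x hx => by
  obtain ⟨V, h1, h2, h3, h4⟩ := h x hx
  exact ⟨V, h1, h2, h3, h4 k⟩

theorem BastianiSmoothOn.prodMk {f : E → F} {g : E → H} {U : Set E}
    (hf : BastianiSmoothOn f U) (hg : BastianiSmoothOn g U) :
    BastianiSmoothOn (fun x => (f x, g x)) U := fun k => (hf k).prodMk (hg k)

theorem BastianiSmoothOn.comp_clm {f : F → H} {U : Set F} (hf : BastianiSmoothOn f U)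
    (L : E →L[ℝ] F) : BastianiSmoothOn (fun x => f (L x)) (L ⁻¹' U) := fun k => (hf k).comp_clm L

theorem BastianiSmoothOn.clm_comp {f : E → F} {U : Set E} (hf : BastianiSmoothOn f U)
    (L : F →L[ℝ] H) : BastianiSmoothOn (fun x => L (f x)) U := fun k => (hf k).clm_comp L

theorem BastianiSmoothOn.comp [IsTopologicalAddGroup F] [ContinuousSMul ℝ F]
    [IsTopologicalAddGroup H] [ContinuousSMul ℝ H] [LocallyConvexSpace ℝ H]
    {g : F → H} {f : E → F} {V : Set F} {U : Set E}
    (hg : BastianiSmoothOn g V) (hf : BastianiSmoothOn f U) (hV : IsOpen V)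
    (hfV : MapsTo f U V) : BastianiSmoothOn (fun x => g (f x)) U :=
  fun k => (hg k).comp (hf k) hV hfV

theorem bastianiSmoothOn_const (c : F) (U : Set E) : BastianiSmoothOn (fun _ => c) U :=
  fun k => bastianiContDiffOn_const k c U

end Bastiani

/-! ### Smooth maps between sets with charts -/

section SmoothMaps

/-- Preimages under `p.symm` commute with intersections, which makes this form of the domain easier
to handle than an image. -/
theorem smoothMapOn_iff {M E N F : Type*} [AddCommGroup E] [Module ℝ E] [TopologicalSpace E]
    [AddCommGroup F] [Module ℝ F] [TopologicalSpace F]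
    {A : Set (PartialEquiv M E)} {B : Set (PartialEquiv N F)} {f : M → N} {S : Set M} :
    SmoothMapOn A B f S ↔ ∀ p ∈ A, ∀ q ∈ B,
      IsOpen (p.target ∩ p.symm ⁻¹' (S ∩ f ⁻¹' q.source)) ∧
      BastianiSmoothOn (fun x => q (f (p.symm x))) (p.target ∩ p.symm ⁻¹' (S ∩ f ⁻¹' q.source)) := by
  simp only [SmoothMapOn, PartialEquiv.image_source_inter_eq']

set_option linter.unusedSectionVars false

variable {M E : Type*} [AddCommGroup E] [Module ℝ E] [UniformSpace E] [IsFrechetSpace E]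
  {N F : Type*} [AddCommGroup F] [Module ℝ F] [UniformSpace F] [IsFrechetSpace F]
  {P H : Type*} [AddCommGroup H] [Module ℝ H] [UniformSpace H] [IsFrechetSpace H]
  {A : Set (PartialEquiv M E)} {B : Set (PartialEquiv N F)} {C : Set (PartialEquiv P H)}

instance isFrechetSpace_prod : IsFrechetSpace (E × F) where

/-- The charts of `A` cover `M`. -/
def ChartsCover {M E : Type*} (A : Set (PartialEquiv M E)) : Prop :=
  ∀ x : M, ∃ p ∈ A, x ∈ p.source

/-- Around each point a chart of `N` at the image factors the local representative. The open pieces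
obtained this way prove the openness of the domain and smoothness on it together. -/
theorem SmoothMapOn.comp {f : M → N} {g : N → P} {S : Set M} {S' : Set N}
    (hg : SmoothMapOn B C g S') (hf : SmoothMapOn A B f S) (hB : ChartsCover B) :
    SmoothMapOn A C (fun x => g (f x)) (S ∩ f ⁻¹' S') := by
  rw [smoothMapOn_iff] at hf hg ⊢
  intro p hp r hr
  set D := p.target ∩ p.symm ⁻¹' (S ∩ f ⁻¹' S' ∩ (fun x => g (f x)) ⁻¹' r.source) with hD
  have key : ∀ x ∈ D, ∃ O ⊆ D, IsOpen O ∧ x ∈ O ∧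
      BastianiSmoothOn (fun x => r (g (f (p.symm x)))) O := by
    rintro x ⟨hx, ⟨hxS, hxS'⟩, hxr⟩
    obtain ⟨q, hq, hxq⟩ := hB (f (p.symm x))
    obtain ⟨o1, s1⟩ := hf p hp q hq
    obtain ⟨o2, s2⟩ := hg q hq r hr
    set D1 := p.target ∩ p.symm ⁻¹' (S ∩ f ⁻¹' q.source)
    set D2 := q.target ∩ q.symm ⁻¹' (S' ∩ g ⁻¹' r.source)
    have hO : IsOpen (D1 ∩ (fun x => q (f (p.symm x))) ⁻¹' D2) :=
      s1.continuousOn.isOpen_inter_preimage o1 o2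
    refine ⟨_, ?_, hO, ?_, ?_⟩
    · rintro y ⟨⟨hy, hyS, hyq⟩, hy2, hyS', hyr⟩
      simp only [mem_preimage] at hyq hyS' hyr
      rw [q.left_inv hyq] at hyS' hyr
      exact ⟨hy, ⟨hyS, hyS'⟩, hyr⟩
    · refine ⟨⟨hx, hxS, hxq⟩, q.map_source hxq, ?_, ?_⟩
      · simpa only [mem_preimage, q.left_inv hxq] using hxS'
      · simpa only [mem_preimage, q.left_inv hxq] using hxr
    · refine ((s2.comp (s1.mono inter_subset_left) o2 fun y hy => hy.2)).congr hO ?_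
      rintro y ⟨⟨-, -, hyq⟩, -⟩
      simp only [q.left_inv hyq]
  exact ⟨isOpen_iff_forall_mem_open.2 fun x hx => by
    obtain ⟨O, h1, h2, h3, -⟩ := key x hx; exact ⟨O, h1, h2, h3⟩, bastianiSmoothOn_of_locally key⟩

theorem SmoothMap.comp {f : M → N} {g : N → P} (hg : SmoothMap B C g) (hf : SmoothMap A B f)
    (hB : ChartsCover B) : SmoothMap A C fun x => g (f x) := by
  have := SmoothMapOn.comp hg hf hB
  rwa [preimage_univ, inter_univ] at this

theorem smoothMapOn_of_locally {f : M → N} {S : Set M}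
    (h : ∀ x ∈ S, ∃ S' ⊆ S, x ∈ S' ∧ SmoothMapOn A B f S') : SmoothMapOn A B f S := by
  simp only [smoothMapOn_iff] at h ⊢
  intro p hp q hq
  have key : ∀ x ∈ p.target ∩ p.symm ⁻¹' (S ∩ f ⁻¹' q.source),
      ∃ O ⊆ p.target ∩ p.symm ⁻¹' (S ∩ f ⁻¹' q.source), IsOpen O ∧ x ∈ O ∧
      BastianiSmoothOn (fun x => q (f (p.symm x))) O := by
    rintro x ⟨hx, hxS, hxq⟩
    obtain ⟨S', hS', hxS', hs⟩ := h _ hxS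
    obtain ⟨h1, h2⟩ := hs p hp q hq
    exact ⟨_, fun y hy => ⟨hy.1, hS' hy.2.1, hy.2.2⟩, h1, ⟨hx, hxS', hxq⟩, h2⟩
  exact ⟨isOpen_iff_forall_mem_open.2 fun x hx => by
    obtain ⟨O, h1, h2, h3, -⟩ := key x hx; exact ⟨O, h1, h2, h3⟩, bastianiSmoothOn_of_locally key⟩

theorem smoothMap_of_locally {f : M → N}
    (h : ∀ x, ∃ S, x ∈ S ∧ SmoothMapOn A B f S) : SmoothMap A B f :=
  smoothMapOn_of_locally fun x _ => by
    obtain ⟨S, h1, h2⟩ := h x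
    exact ⟨S, subset_univ _, h1, h2⟩

theorem SmoothMapOn.congr {f g : M → N} {S : Set M} (hf : SmoothMapOn A B f S) (h : EqOn f g S) :
    SmoothMapOn A B g S := by
  rw [smoothMapOn_iff] at hf ⊢
  intro p hp q hq
  obtain ⟨h1, h2⟩ := hf p hp q hq
  have hS : p.target ∩ p.symm ⁻¹' (S ∩ g ⁻¹' q.source) =
      p.target ∩ p.symm ⁻¹' (S ∩ f ⁻¹' q.source) := by
    ext x
    simp only [mem_inter_iff, mem_preimage]
    refine and_congr_right fun _ => and_congr_right fun hx => ?_
    rw [h hx]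
  rw [hS]
  refine ⟨h1, h2.congr h1 ?_⟩
  rintro x ⟨-, hx, -⟩
  simp only [h hx]

theorem SmoothMap.congr {f g : M → N} (hf : SmoothMap A B f) (h : ∀ x, f x = g x) :
    SmoothMap A B g := SmoothMapOn.congr hf fun x _ => h x

theorem SmoothMapOn.prodMk {f : M → N} {g : M → P} {S : Set M} (hf : SmoothMapOn A B f S)
    (hg : SmoothMapOn A C g S) : SmoothMapOn A (prodCharts B C) (fun x => (f x, g x)) S := by
  rw [smoothMapOn_iff] at hf hg ⊢
  rintro p hp _ ⟨q, hq, r, hr, rfl⟩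
  obtain ⟨h1, h2⟩ := hf p hp q hq
  obtain ⟨h3, h4⟩ := hg p hp r hr
  have hS : p.target ∩ p.symm ⁻¹' (S ∩ (fun x => (f x, g x)) ⁻¹' (q.prod r).source) =
      (p.target ∩ p.symm ⁻¹' (S ∩ f ⁻¹' q.source)) ∩
      (p.target ∩ p.symm ⁻¹' (S ∩ g ⁻¹' r.source)) := by
    ext x
    simp only [mem_inter_iff, mem_preimage, PartialEquiv.prod_source, mem_prod]
    tauto
  rw [hS]
  exact ⟨h1.inter h3, (h2.mono inter_subset_left).prodMk (h4.mono inter_subset_right)⟩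

theorem SmoothMap.prodMk {f : M → N} {g : M → P} (hf : SmoothMap A B f)
    (hg : SmoothMap A C g) : SmoothMap A (prodCharts B C) fun x => (f x, g x) :=
  SmoothMapOn.prodMk hf hg

/-- Smoothness of the identity says exactly that overlaps are open and transitions smooth. It serves
here and below as the atlas condition; the overlap of `p` with itself is its whole target. -/
theorem isOpen_target_of_smoothMap_id (hA : SmoothMap A A fun x => x) {p : PartialEquiv M E}
    (hp : p ∈ A) : IsOpen p.target := by
  have h := (smoothMapOn_iff.1 hA p hp p hp).1
  have hS : p.target ∩ p.symm ⁻¹' (univ ∩ (fun x => x) ⁻¹' p.source) = p.target :=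
    inter_eq_left.2 fun x hx => ⟨mem_univ _, p.map_target hx⟩
  rwa [hS] at h

theorem smoothMap_const (hA : SmoothMap A A fun x => x) (c : N) :
    SmoothMap A B fun _ : M => c := by
  rw [SmoothMap, smoothMapOn_iff]
  intro p hp q hq
  refine ⟨?_, bastianiSmoothOn_const _ _⟩
  by_cases hc : c ∈ q.source
  · simpa [hc] using isOpen_target_of_smoothMap_id hA hp
  · simp [hc]

theorem smoothMap_fst (hA : SmoothMap A A fun x => x) (hB : SmoothMap B B fun x => x) :
    SmoothMap (prodCharts A B) A Prod.fst := by
  rw [SmoothMap, smoothMapOn_iff] at hA ⊢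
  rintro _ ⟨p, hp, q, hq, rfl⟩ p' hp'
  obtain ⟨h1, h2⟩ := hA p hp p' hp'
  have ho := isOpen_target_of_smoothMap_id hB hq
  have hS : (p.prod q).target ∩ (p.prod q).symm ⁻¹' (univ ∩ Prod.fst ⁻¹' p'.source) =
      (p.target ∩ p.symm ⁻¹' (univ ∩ (fun x => x) ⁻¹' p'.source)) ×ˢ q.target := by
    ext ⟨x, y⟩
    simp [PartialEquiv.prod_target, PartialEquiv.prod_symm]
    tauto
  rw [hS]
  exact ⟨h1.prod ho, (h2.comp_clm (ContinuousLinearMap.fst ℝ E F)).mono fun x hx => hx.1⟩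

theorem smoothMap_snd (hA : SmoothMap A A fun x => x) (hB : SmoothMap B B fun x => x) :
    SmoothMap (prodCharts A B) B Prod.snd := by
  rw [SmoothMap, smoothMapOn_iff] at hB ⊢
  rintro _ ⟨p, hp, q, hq, rfl⟩ p' hp'
  obtain ⟨h1, h2⟩ := hB q hq p' hp'
  have ho := isOpen_target_of_smoothMap_id hA hp
  have hS : (p.prod q).target ∩ (p.prod q).symm ⁻¹' (univ ∩ Prod.snd ⁻¹' p'.source) =
      p.target ×ˢ (q.target ∩ q.symm ⁻¹' (univ ∩ (fun x => x) ⁻¹' p'.source)) := by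
    ext ⟨x, y⟩
    simp [PartialEquiv.prod_target, PartialEquiv.prod_symm]
    tauto
  rw [hS]
  exact ⟨ho.prod h1, (h2.comp_clm (ContinuousLinearMap.snd ℝ E F)).mono fun x hx => hx.2⟩

theorem ChartsCover.prod {M E N F : Type*} {A : Set (PartialEquiv M E)}
    {B : Set (PartialEquiv N F)} (hA : ChartsCover A) (hB : ChartsCover B) :
    ChartsCover (prodCharts A B) := fun x => by
  obtain ⟨p, hp, hxp⟩ := hA x.1
  obtain ⟨q, hq, hxq⟩ := hB x.2
  exact ⟨p.prod q, ⟨p, hp, q, hq, rfl⟩, hxp, hxq⟩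

/-- Around each of its points, `S` contains the part cut out by one chart, which is a generator of
the topology. -/
theorem SmoothMapOn.mem_chartTopology {M E : Type*} [TopologicalSpace E]
    {A : Set (PartialEquiv M E)} (hA : ChartsCover A) {S : Set M}
    (h : ∀ p ∈ A, IsOpen (p.target ∩ p.symm ⁻¹' S)) : IsOpen[chartTopology A] S := by
  have hS : S = ⋃₀ {T | T ⊆ S ∧ IsOpen[chartTopology A] T} := by
    ext x
    refine ⟨fun hx => ?_, fun ⟨T, hT, hx⟩ => hT.1 hx⟩
    obtain ⟨p, hp, hxp⟩ := hA x
    refine ⟨p.source ∩ p ⁻¹' (p.target ∩ p.symm ⁻¹' S), ⟨?_, ?_⟩, hxp, p.map_source hxp, ?_⟩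
    · rintro y ⟨hy, -, hyS⟩
      simpa only [mem_preimage, p.left_inv hy] using hyS
    · exact TopologicalSpace.isOpen_generateFrom_of_mem ⟨p, hp, _, h p hp, rfl⟩
    · simpa only [mem_preimage, p.left_inv hxp] using hx
  rw [hS]
  exact @isOpen_sUnion M (chartTopology A) _ fun T hT => hT.2

theorem SmoothMap.continuous_chartTopology {f : M → N} (hf : SmoothMap A B f)
    (hA : ChartsCover A) : @Continuous M N (chartTopology A) (chartTopology B) f := by
  rw [SmoothMap, smoothMapOn_iff] at hf
  refine continuous_generateFrom_iff.2 ?_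
  rintro _ ⟨q, hq, W, hW, rfl⟩
  refine SmoothMapOn.mem_chartTopology hA fun p hp => ?_
  obtain ⟨h1, h2⟩ := hf p hp q hq
  have := h2.continuousOn.isOpen_inter_preimage h1 hW
  convert this using 1
  ext x
  simp only [mem_inter_iff, mem_preimage, mem_univ, true_and]
  tauto

end SmoothMaps

/-! ### Iterated derivatives of families of curves -/

section Families

universe u v

variable {V : Type u} [NormedAddCommGroup V] [NormedSpace ℝ V]
  {E : Type v} [NormedAddCommGroup E] [NormedSpace ℝ E]

theorem ContDiff.deriv_infty {c : ℝ → V} (hc : ContDiff ℝ ∞ c) : ContDiff ℝ ∞ (deriv c) :=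
  (contDiff_infty_iff_deriv.1 hc).2

theorem ContDiff.hasDerivAt_deriv {c : ℝ → V} (hc : ContDiff ℝ ∞ c) (t : ℝ) :
    HasDerivAt c (deriv c t) t := ((contDiff_infty_iff_deriv.1 hc).1 t).hasDerivAt

theorem iteratedDeriv_prodMk {a : ℝ → V} {b : ℝ → E} (ha : ContDiff ℝ ∞ a) (hb : ContDiff ℝ ∞ b)
    (k : ℕ) : iteratedDeriv k (fun t => (a t, b t)) =
      fun t => (iteratedDeriv k a t, iteratedDeriv k b t) := by
  induction k generalizing a b with
  | zero => simp
  | succ k ih =>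
    have h : deriv (fun t => (a t, b t)) = fun t => (deriv a t, deriv b t) := by
      ext1 t
      exact ((ContDiff.hasDerivAt_deriv ha t).prodMk (ContDiff.hasDerivAt_deriv hb t)).deriv
    simp only [iteratedDeriv_succ', h, ih (ContDiff.deriv_infty ha) (ContDiff.deriv_infty hb)]

/-- The tangent map `(x, w) ↦ Df(x) w`. -/
theorem contDiffOn_fderiv_apply {f : V → E} {W : Set V} (hW : IsOpen W)
    (hf : ContDiffOn ℝ ∞ f W) :
    ContDiffOn ℝ ∞ (fun q : V × V => fderiv ℝ f q.1 q.2) (W ×ˢ univ) := by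
  have h1 : ContDiffOn ℝ ∞ (fderiv ℝ f) W := hf.fderiv_of_isOpen hW (by simp)
  exact (h1.comp contDiff_fst.contDiffOn fun q hq => hq.1).clm_apply contDiff_snd.contDiffOn

theorem hasDerivAt_comp_of_contDiffOn {f : V → E} {W : Set V} (hW : IsOpen W)
    (hf : ContDiffOn ℝ ∞ f W) {c : ℝ → V} {c' : V} {t : ℝ} (hc : HasDerivAt c c' t)
    (ht : c t ∈ W) : HasDerivAt (fun t => f (c t)) (fderiv ℝ f (c t) c') t :=
  (((hf.contDiffAt (hW.mem_nhds ht)).differentiableAt (by simp)).hasFDerivAt).comp_hasDerivAt t hc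

/-- The derivative of `f ∘ c` is the tangent map of `f` along `(c, c')`. So order `k + 1` for `f` is
order `k` for its tangent map, and no formula for higher derivatives of a composite is needed. -/
theorem continuousOn_iteratedDeriv_comp {P : Type*} [TopologicalSpace P] {S : Set P} (k : ℕ)
    {f : V → E} {W : Set V} (hW : IsOpen W) (hf : ContDiffOn ℝ ∞ f W) {c : P → ℝ → V}
    (hc : ∀ x ∈ S, ContDiff ℝ ∞ (c x))
    (hcc : ∀ k, ContinuousOn (fun q : P × ℝ => iteratedDeriv k (c q.1) q.2) (S ×ˢ univ))
    (hcW : ∀ x ∈ S, ∀ t, c x t ∈ W) :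
    ContinuousOn (fun q : P × ℝ => iteratedDeriv k (fun t => f (c q.1 t)) q.2) (S ×ˢ univ) := by
  induction k generalizing V with
  | zero =>
    have := hcc 0
    simp only [iteratedDeriv_zero] at this ⊢
    exact hf.continuousOn.comp this fun q hq => hcW q.1 hq.1 q.2
  | succ k ih =>
    have h := ih (V := V × V) (hW.prod isOpen_univ) (contDiffOn_fderiv_apply hW hf)
      (c := fun x t => (c x t, deriv (c x) t))
      (fun x hx => (hc x hx).prodMk (ContDiff.deriv_infty (hc x hx)))
      (fun j => by
        refine ((hcc j).prodMk (hcc (j + 1))).congr fun q hq => ?_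
        simp only [iteratedDeriv_prodMk (hc _ hq.1) (ContDiff.deriv_infty (hc _ hq.1)),
          iteratedDeriv_succ']) fun x hx t => ⟨hcW x hx t, mem_univ _⟩
    refine h.congr fun q hq => ?_
    rw [iteratedDeriv_succ']
    congr 1
    ext1 t
    exact (hasDerivAt_comp_of_contDiffOn hW hf (ContDiff.hasDerivAt_deriv (hc _ hq.1) t)
      (hcW _ hq.1 t)).deriv

/-- Strict differentiability at `u t₀` controls increments between two moving points, which gives
the limit jointly in the step and in `t`. -/
theorem tendsto_quotient {f : V → E} {W : Set V} (hW : IsOpen W)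
    (hf : ContDiffOn ℝ ∞ f W) {u v : ℝ → V} {t₀ : ℝ} (hu : ContinuousAt u t₀)
    (hv : ContinuousAt v t₀) (huW : u t₀ ∈ W) :
    Tendsto (fun q : ℝ × ℝ => q.1⁻¹ • (f (u q.2 + q.1 • v q.2) - f (u q.2)))
      ((𝓝[≠] 0) ×ˢ 𝓝 t₀) (𝓝 (fderiv ℝ f (u t₀) (v t₀))) := by
  set l : Filter (ℝ × ℝ) := (𝓝[≠] 0) ×ˢ 𝓝 t₀
  have hstr : HasStrictFDerivAt f (fderiv ℝ f (u t₀)) (u t₀) :=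
    (hf.contDiffAt (hW.mem_nhds huW)).hasStrictFDerivAt (by simp)
  have l1 : Tendsto (fun q : ℝ × ℝ => q.1) l (𝓝 0) := tendsto_fst.mono_right nhdsWithin_le_nhds
  have lu : Tendsto (fun q : ℝ × ℝ => u q.2) l (𝓝 (u t₀)) := hu.tendsto.comp tendsto_snd
  have lv : Tendsto (fun q : ℝ × ℝ => v q.2) l (𝓝 (v t₀)) := hv.tendsto.comp tendsto_snd
  have l2 : Tendsto (fun q : ℝ × ℝ => (u q.2 + q.1 • v q.2, u q.2)) l (𝓝 (u t₀, u t₀)) := by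
    have := (lu.add (l1.smul lv)).prodMk_nhds lu
    simpa using this
  have ho := hstr.isLittleO.comp_tendsto l2
  have hO : (fun q : ℝ × ℝ => q.1 • v q.2) =O[l] fun q => q.1 := by
    have := (Asymptotics.isBigO_refl (fun q : ℝ × ℝ => q.1) l).smul (lv.isBigO_one ℝ)
    simpa using this
  have ho2 : (fun q : ℝ × ℝ => f (u q.2 + q.1 • v q.2) - f (u q.2) -
      fderiv ℝ f (u t₀) (q.1 • v q.2)) =o[l] fun q => q.1 := by
    refine Asymptotics.IsLittleO.trans_isBigO ?_ hO
    simpa [Function.comp_def] using ho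
  have h3 := ho2.tendsto_inv_smul_nhds_zero
  have h4 := ((fderiv ℝ f (u t₀)).continuous.tendsto _).comp lv
  have h5 := h3.add h4
  rw [zero_add] at h5
  refine h5.congr' ?_
  have hne : ∀ᶠ q : ℝ × ℝ in l, q.1 ≠ 0 :=
    (tendsto_fst (f := 𝓝[≠] (0 : ℝ)) (g := 𝓝 t₀)).eventually self_mem_nhdsWithin
  filter_upwards [hne] with q hq
  simp only [map_smul, Function.comp_apply, smul_sub, smul_smul, inv_mul_cancel₀ hq, one_smul]
  abel

theorem two_le_infty : (2 : WithTop ℕ∞) ≤ ∞ := by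
  have : ((2 : ℕ∞) : WithTop ℕ∞) ≤ ((⊤ : ℕ∞) : WithTop ℕ∞) := WithTop.coe_le_coe.2 le_top
  exact this

/-- Differentiation along the curve and in the direction `v` commute, by symmetry of the second
derivative of `f`. -/
theorem deriv_fderiv_apply {f : V → E} {W : Set V} (hW : IsOpen W) (hf : ContDiffOn ℝ ∞ f W)
    {u v : ℝ → V} (hu : ContDiff ℝ ∞ u) (hv : ContDiff ℝ ∞ v) {t : ℝ} (ht : u t ∈ W) :
    deriv (fun t => fderiv ℝ f (u t) (v t)) t =
      fderiv ℝ (fun q : V × V => fderiv ℝ f q.1 q.2) (u t, deriv u t) (v t, deriv v t) := by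
  have hfa := hf.contDiffAt (hW.mem_nhds ht)
  have hd : HasFDerivAt (fderiv ℝ f) (fderiv ℝ (fderiv ℝ f) (u t)) (u t) :=
    ((hfa.fderiv_right (m := 1) (le_of_eq_of_le one_add_one_eq_two two_le_infty)).differentiableAt (by simp)).hasFDerivAt
  have h1 := (hd.comp_hasDerivAt t (ContDiff.hasDerivAt_deriv hu t)).clm_apply
    (ContDiff.hasDerivAt_deriv hv t)
  have h2 := (hd.comp (u t, deriv u t) (hasFDerivAt_fst (𝕜 := ℝ) (E := V) (F := V))).clm_apply
    (hasFDerivAt_snd (𝕜 := ℝ) (p := (u t, deriv u t)))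
  have hsymm := (hfa.isSymmSndFDerivAt (by simpa using two_le_infty)) (deriv u t) (v t)
  refine h1.deriv.trans ?_
  simp only [Function.comp_def] at h2
  rw [h2.fderiv]
  simp [hsymm, add_comm]

/-- The `t`-derivative of a difference quotient of `f` is the difference quotient of its tangent map
at `(u, u')` in the direction `(v, v')`. Induction thus lowers the order to zero, where
`tendsto_quotient` applies. -/
theorem tendsto_iteratedDeriv_quotient (k : ℕ) {f : V → E} {W : Set V} (hW : IsOpen W)
    (hf : ContDiffOn ℝ ∞ f W) {u v : ℝ → V} (hu : ContDiff ℝ ∞ u) (hv : ContDiff ℝ ∞ v)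
    (huW : ∀ t, u t ∈ W) (t₀ : ℝ) :
    Tendsto (fun q : ℝ × ℝ =>
        iteratedDeriv k (fun t => q.1⁻¹ • (f (u t + q.1 • v t) - f (u t))) q.2)
      ((𝓝[≠] 0) ×ˢ 𝓝 t₀) (𝓝 (iteratedDeriv k (fun t => fderiv ℝ f (u t) (v t)) t₀)) := by
  induction k generalizing V with
  | zero =>
    simpa using tendsto_quotient hW hf hu.continuous.continuousAt hv.continuous.continuousAt
      (huW t₀)
  | succ k ih =>
    have h := ih (V := V × V) (hW.prod isOpen_univ) (contDiffOn_fderiv_apply hW hf)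
      (hu.prodMk (ContDiff.deriv_infty hu)) (hv.prodMk (ContDiff.deriv_infty hv))
      fun t => ⟨huW t, mem_univ _⟩
    have hlim : iteratedDeriv (k + 1) (fun t => fderiv ℝ f (u t) (v t)) t₀ =
        iteratedDeriv k (fun t => fderiv ℝ (fun q : V × V => fderiv ℝ f q.1 q.2)
          (u t, deriv u t) (v t, deriv v t)) t₀ := by
      rw [iteratedDeriv_succ']
      congr 1
      ext1 t
      exact deriv_fderiv_apply hW hf hu hv (huW t)
    rw [hlim]
    refine h.congr' ?_
    -- `f` is only differentiable on `W`, so the identity between the derivatives holds only where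
    -- the displaced curve stays in `W`; this is eventually the case.
    set O : Set (ℝ × ℝ) := {q | u q.2 + q.1 • v q.2 ∈ W}
    have hO : IsOpen O := hW.preimage (by
      have := hu.continuous
      have := hv.continuous
      fun_prop)
    have hev : ∀ᶠ q : ℝ × ℝ in (𝓝[≠] 0) ×ˢ 𝓝 t₀, q ∈ O := by
      have h0 : O ∈ 𝓝 ((0 : ℝ), t₀) := hO.mem_nhds (by simpa [O] using huW t₀)
      rw [nhds_prod_eq] at h0
      exact (Filter.prod_mono_left _ nhdsWithin_le_nhds) h0
    filter_upwards [hev] with q hq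
    rw [iteratedDeriv_succ']
    refine Filter.EventuallyEq.iteratedDeriv_eq k ?_
    have hq' : ∀ᶠ t in 𝓝 q.2, (q.1, t) ∈ O :=
      (Continuous.prodMk_right q.1).continuousAt.eventually_mem (hO.mem_nhds hq)
    filter_upwards [hq'] with t ht
    have hc : HasDerivAt (fun t => u t + q.1 • v t) (deriv u t + q.1 • deriv v t) t :=
      (ContDiff.hasDerivAt_deriv hu t).add ((ContDiff.hasDerivAt_deriv hv t).const_smul q.1)
    have := ((hasDerivAt_comp_of_contDiffOn hW hf hc ht).sub
      (hasDerivAt_comp_of_contDiffOn hW hf (ContDiff.hasDerivAt_deriv hu t) (huW t))).const_smul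
        q.1⁻¹
    exact this.deriv.symm

end Families

/-! ### The Fréchet space of based loops in a vector space -/

/-- Each defining property passes to a subspace; only completeness uses that the image is closed. -/
theorem IsFrechetSpace.of_isUniformInducing {Y Z : Type*} [AddCommGroup Y] [Module ℝ Y]
    [UniformSpace Y] [AddCommGroup Z] [Module ℝ Z] [UniformSpace Z] [hZ : IsFrechetSpace Z]
    (J : Y →ₗ[ℝ] Z) (hJ : IsUniformInducing J) (hinj : Function.Injective J)
    (hcl : IsClosed (range J)) : IsFrechetSpace Y := by
  have h1 : IsUniformAddGroup Y := IsUniformInducing.isUniformAddGroup J hJ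
  have h2 : ContinuousSMul ℝ Y :=
    hJ.isInducing.continuousSMul continuous_id fun {c x} => map_smul J c x
  have h3 : LocallyConvexSpace ℝ Y := by
    have := LocallyConvexSpace.induced (𝕜 := ℝ) J
    rwa [← hJ.isInducing.eq_induced] at this
  have h4 : CompleteSpace Y := (completeSpace_iff_isComplete_range hJ).2 hcl.isComplete
  have h5 : T2Space Y := T2Space.of_injective_continuous hinj hJ.isInducing.continuous
  have h6 : (𝓤 Y).IsCountablyGenerated := by
    rw [← hJ.comap_uniformity]
    infer_instance
  exact { }

/-! ### Smooth and periodic curves -/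

section Curves

variable {E : Type*} [NormedAddCommGroup E] [NormedSpace ℝ E]

theorem iteratedDeriv_eq_of_hasDerivAt {H : ℕ → ℝ → E}
    (hH : ∀ k t, HasDerivAt (H k) (H (k + 1) t) t) (k : ℕ) : iteratedDeriv k (H 0) = H k := by
  induction k with
  | zero => simp
  | succ k ih =>
    rw [iteratedDeriv_succ, ih]
    ext1 t
    exact (hH k t).deriv

theorem contDiff_of_hasDerivAt {H : ℕ → ℝ → E} (hH : ∀ k t, HasDerivAt (H k) (H (k + 1) t) t) :
    ContDiff ℝ ∞ (H 0) := by
  refine contDiff_of_differentiable_iteratedDeriv fun m _ => ?_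
  rw [iteratedDeriv_eq_of_hasDerivAt hH]
  exact fun t => (hH m t).differentiableAt

theorem hasDerivAt_iteratedDeriv {c : ℝ → E} (hc : ContDiff ℝ ∞ c) (k : ℕ) (t : ℝ) :
    HasDerivAt (iteratedDeriv k c) (iteratedDeriv (k + 1) c t) t := by
  rw [iteratedDeriv_succ]
  exact ((hc.differentiable_iteratedDeriv k (by exact_mod_cast WithTop.coe_lt_top _)) t).hasDerivAt

theorem periodic_iteratedDeriv {c : ℝ → E} {T : ℝ} (hc : Function.Periodic c T) (k : ℕ) :
    Function.Periodic (iteratedDeriv k c) T := fun t => by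
  have := congrFun (iteratedDeriv_comp_add_const k c T) t
  rw [← this]
  congr 1
  ext1 x
  exact hc x

/-- The representative `s` is independent of `c`, so different periodic functions can be compared at
the same point. -/
theorem exists_mem_Icc_of_periodic (E : Type*) (t : ℝ) :
    ∃ s ∈ Icc 0 (2 * Real.pi), ∀ c : ℝ → E, Function.Periodic c (2 * Real.pi) → c t = c s := by
  refine ⟨toIcoMod Real.two_pi_pos 0 t, ?_, fun c hc => ?_⟩
  · have := toIcoMod_mem_Ico Real.two_pi_pos 0 t
    exact ⟨this.1, by linarith [this.2]⟩
  · rw [toIcoMod, hc.sub_zsmul_eq]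

/-- Joint limits at each `t₀` amount to locally uniform convergence, which is uniform on the compact
interval `[0, 2π]` and hence everywhere by periodicity. -/
theorem tendstoUniformly_of_periodic {ι : Type*} {l : Filter ι} {c : ι → ℝ → E} {d : ℝ → E}
    (hc : ∀ i, Function.Periodic (c i) (2 * Real.pi)) (hd : Function.Periodic d (2 * Real.pi))
    (hdc : Continuous d)
    (h : ∀ t₀, Tendsto (fun q : ι × ℝ => c q.1 q.2) (l ×ˢ 𝓝 t₀) (𝓝 (d t₀))) :
    TendstoUniformly c d l := by
  have h1 : TendstoUniformlyOn c d l (Icc 0 (2 * Real.pi)) := by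
    rw [← tendstoLocallyUniformlyOn_iff_tendstoUniformlyOn_of_compact isCompact_Icc,
      tendstoLocallyUniformlyOn_iff_forall_tendsto]
    intro t _
    have h2 : Tendsto (fun q : ι × ℝ => (d q.2, c q.1 q.2)) (l ×ˢ 𝓝 t) (𝓝 (d t, d t)) :=
      (hdc.continuousAt.tendsto.comp tendsto_snd).prodMk_nhds (h t)
    exact (h2.mono_left (prod_mono_right _ nhdsWithin_le_nhds)).mono_right (nhds_le_uniformity _)
  intro u hu
  filter_upwards [h1 u hu] with i hi t
  obtain ⟨s, hs, hs'⟩ := exists_mem_Icc_of_periodic E t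
  rw [hs' _ hd, hs' _ (hc i)]
  exact hi s hs

end Curves

/-! ### The space `ΩE` is a Fréchet space -/

namespace BasedLoopSpace

variable {E : Type*} [NormedAddCommGroup E] [NormedSpace ℝ E]

/-- The periodic function on the real line given by a loop. -/
noncomputable def curve : BasedLoopSpace E →ₗ[ℝ] (ℝ → E) where
  toFun X := fun t => X.1 (t : S1)
  map_add' _ _ := rfl
  map_smul' _ _ := rfl

theorem contDiff_curve (X : BasedLoopSpace E) : ContDiff ℝ ∞ (curve X) := X.2.1

theorem iteratedDeriv_curve_zero (X : BasedLoopSpace E) (k : ℕ) :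
    iteratedDeriv k (curve X) 0 = 0 := X.2.2 k

theorem periodic_curve (X : BasedLoopSpace E) : Function.Periodic (curve X) (2 * Real.pi) :=
  fun t => by
    change X.1 ((t + 2 * Real.pi : ℝ) : S1) = X.1 (t : S1)
    simp

theorem continuous_iteratedDeriv_curve (X : BasedLoopSpace E) (k : ℕ) :
    Continuous (iteratedDeriv k (curve X)) :=
  (contDiff_curve X).continuous_iteratedDeriv k (by exact_mod_cast le_top)

theorem curve_injective : Function.Injective (curve (E := E)) := fun X Y h => by
  refine Subtype.ext (funext fun t => ?_)
  induction t using QuotientAddGroup.induction_on with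
  | H t => exact congrFun h t

/-- A based loop in a vector space, given by a periodic function on the real line. -/
noncomputable def ofPeriodic (c : ℝ → E) (hc : Function.Periodic c (2 * Real.pi)) (hs : ContDiff ℝ ∞ c)
    (h0 : ∀ k, iteratedDeriv k c 0 = 0) : BasedLoopSpace E :=
  ⟨fun t => hc.lift t, hs, h0⟩

theorem isUniformInducing_iteratedDeriv : IsUniformInducing
    (fun (X : BasedLoopSpace E) (k : ℕ) => UniformFun.ofFun (iteratedDeriv k (curve X))) := ⟨rfl⟩

/-- Turns convergence in the `C^∞`-topology into the joint limits that the results on families of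
curves provide. -/
theorem tendsto_of_tendsto_iteratedDeriv {ι : Type*} {l : Filter ι} {X : ι → BasedLoopSpace E}
    {Y : BasedLoopSpace E}
    (h : ∀ k t₀, Tendsto (fun q : ι × ℝ => iteratedDeriv k (curve (X q.1)) q.2) (l ×ˢ 𝓝 t₀)
      (𝓝 (iteratedDeriv k (curve Y) t₀))) : Tendsto X l (𝓝 Y) := by
  rw [isUniformInducing_iteratedDeriv.isInducing.tendsto_nhds_iff, tendsto_pi_nhds]
  intro k
  rw [UniformFun.tendsto_iff_tendstoUniformly]
  exact tendstoUniformly_of_periodic (fun i => periodic_iteratedDeriv (periodic_curve _) k)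
    (periodic_iteratedDeriv (periodic_curve _) k) (continuous_iteratedDeriv_curve _ k) (h k)

theorem exists_bound (X : BasedLoopSpace E) (k : ℕ) :
    ∃ C, ∀ t, ‖iteratedDeriv k (curve X) t‖ ≤ C := by
  obtain ⟨C, hC⟩ := isCompact_Icc.exists_bound_of_continuousOn (s := Icc 0 (2 * Real.pi))
    (continuous_iteratedDeriv_curve X k).continuousOn
  refine ⟨C, fun t => ?_⟩
  have hp := periodic_iteratedDeriv (periodic_curve X) k
  obtain ⟨s, hs, hs'⟩ := exists_mem_Icc_of_periodic E t
  rw [hs' _ hp]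
  exact hC s hs

/-- The family of all derivatives of a based loop, as bounded continuous functions. -/
noncomputable def jet : BasedLoopSpace E →ₗ[ℝ] (ℕ → BoundedContinuousFunction ℝ E) where
  toFun X k := BoundedContinuousFunction.ofNormedAddCommGroup (iteratedDeriv k (curve X))
    (continuous_iteratedDeriv_curve X k) _ (exists_bound X k).choose_spec
  map_add' X Y := by
    ext k t
    simp only [BoundedContinuousFunction.coe_ofNormedAddCommGroup, Pi.add_apply,
      BoundedContinuousFunction.coe_add, map_add]
    exact iteratedDeriv_add ((contDiff_curve X).contDiffAt.of_le (by exact_mod_cast le_top))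
      ((contDiff_curve Y).contDiffAt.of_le (by exact_mod_cast le_top))
  map_smul' a X := by
    ext k t
    simp only [BoundedContinuousFunction.coe_ofNormedAddCommGroup, Pi.smul_apply,
      BoundedContinuousFunction.coe_smul, map_smul, RingHom.id_apply]
    exact iteratedDeriv_const_smul ((contDiff_curve X).contDiffAt.of_le
      (by exact_mod_cast le_top)) a

theorem jet_apply (X : BasedLoopSpace E) (k : ℕ) (t : ℝ) :
    jet X k t = iteratedDeriv k (curve X) t := rfl

instance : IsUniformAddGroup (BasedLoopSpace E) := by
  let Φ : BasedLoopSpace E →+ (ℕ → UniformFun ℝ E) :=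
    { toFun := fun X k => UniformFun.ofFun (jet X k)
      map_zero' := by rw [map_zero]; rfl
      map_add' := fun X Y => by rw [map_add]; rfl }
  exact IsUniformInducing.isUniformAddGroup Φ isUniformInducing_iteratedDeriv

/-- For homomorphisms of uniform groups it suffices to induce the topology, and bounded continuous
functions carry the topology of uniform convergence. -/
theorem isUniformInducing_jet : IsUniformInducing (jet (E := E)) := by
  refine AddMonoidHom.isUniformInducing_of_isInducing (f := (jet (E := E))) ?_
  have h1 : IsInducing (fun (f : ℕ → BoundedContinuousFunction ℝ E) (k : ℕ) =>
      UniformFun.ofFun (f k : ℝ → E)) :=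
    IsInducing.piMap fun _ => BoundedContinuousFunction.isInducing_coeFn
  exact (h1.of_comp_iff).1 isUniformInducing_iteratedDeriv.isInducing

theorem jet_injective : Function.Injective (jet (E := E)) := fun X Y h => by
  refine curve_injective (funext fun t => ?_)
  have := congrArg (fun f : ℕ → BoundedContinuousFunction ℝ E => f 0 t) h
  simpa [jet_apply] using this

/-- A uniform limit of derivatives is the derivative of the limit, so limits of jets are jets of
smooth functions. Periodicity and flatness at `0` survive pointwise limits. Sequences suffice in a
countable product of normed spaces. -/
theorem isClosed_range_jet : IsClosed (range (jet (E := E))) := by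
  refine IsSeqClosed.isClosed ?_
  intro x y hx hxy
  choose X hX using hx
  have hu : ∀ k, TendstoUniformly (fun n => iteratedDeriv k (curve (X n))) (y k) atTop := fun k => by
    have := (tendsto_pi_nhds.1 hxy) k
    rw [BoundedContinuousFunction.tendsto_iff_tendstoUniformly] at this
    simp only [← hX] at this
    exact this
  have hp : ∀ k t, Tendsto (fun n => iteratedDeriv k (curve (X n)) t) atTop (𝓝 (y k t)) :=
    fun k t => (hu k).tendsto_at t
  have hd : ∀ k t, HasDerivAt (y k) (y (k + 1) t) t := fun k t =>
    hasDerivAt_of_tendstoUniformly (hu (k + 1))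
      (Eventually.of_forall fun n => hasDerivAt_iteratedDeriv (contDiff_curve (X n)) k) (hp k) t
  have hi := iteratedDeriv_eq_of_hasDerivAt (H := fun k => y k) hd
  refine ⟨ofPeriodic (y 0) (fun t => ?_) (contDiff_of_hasDerivAt (H := fun k => y k) hd)
    fun k => ?_, ?_⟩
  · refine tendsto_nhds_unique (hp 0 _) ((hp 0 t).congr fun n => ?_)
    exact (periodic_iteratedDeriv (periodic_curve (X n)) 0 t).symm
  · rw [hi]
    refine tendsto_nhds_unique (hp k 0) (tendsto_const_nhds.congr fun n => ?_)
    exact (iteratedDeriv_curve_zero (X n) k).symm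
  · ext k t
    exact congrFun (hi k) t

instance [CompleteSpace E] : IsFrechetSpace (ℕ → BoundedContinuousFunction ℝ E) where

instance [CompleteSpace E] : IsFrechetSpace (BasedLoopSpace E) :=
  .of_isUniformInducing jet isUniformInducing_jet jet_injective isClosed_range_jet

theorem continuous_iteratedDeriv_curve_uncurry (k : ℕ) :
    Continuous fun q : BasedLoopSpace E × ℝ => iteratedDeriv k (curve q.1) q.2 := by
  have h1 : Continuous fun q : BasedLoopSpace E × ℝ => (jet q.1 k, q.2) :=
    (((continuous_apply k).comp isUniformInducing_jet.isInducing.continuous).comp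
      continuous_fst).prodMk continuous_snd
  exact continuous_eval.comp h1

end BasedLoopSpace

/-! ### Smoothness of superposition operators -/

section Superposition

universe u v

/-- A linear family of smooth curves, all of whose derivatives are jointly continuous. -/
structure IsSmoothFamily {Z V : Type*} [AddCommGroup Z] [Module ℝ Z] [TopologicalSpace Z]
    [NormedAddCommGroup V] [NormedSpace ℝ V] (L : Z →ₗ[ℝ] (ℝ → V)) : Prop where
  contDiff : ∀ z, ContDiff ℝ ∞ (L z)
  continuous : ∀ k, Continuous fun q : Z × ℝ => iteratedDeriv k (L q.1) q.2

theorem IsSmoothFamily.prod {Z Z' V V' : Type*} [AddCommGroup Z] [Module ℝ Z] [TopologicalSpace Z]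
    [AddCommGroup Z'] [Module ℝ Z'] [TopologicalSpace Z']
    [NormedAddCommGroup V] [NormedSpace ℝ V] [NormedAddCommGroup V'] [NormedSpace ℝ V']
    {L : Z →ₗ[ℝ] (ℝ → V)} {L' : Z' →ₗ[ℝ] (ℝ → V')} (hL : IsSmoothFamily L)
    (hL' : IsSmoothFamily L') {L₂ : Z × Z' →ₗ[ℝ] (ℝ → V × V')}
    (h : ∀ q t, L₂ q t = (L q.1 t, L' q.2 t)) : IsSmoothFamily L₂ where
  contDiff q := by
    have : L₂ q = fun t => (L q.1 t, L' q.2 t) := funext (h q)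
    rw [this]
    exact (hL.contDiff _).prodMk (hL'.contDiff _)
  continuous k := by
    have : ∀ q, L₂ q = fun t => (L q.1 t, L' q.2 t) := fun q => funext (h q)
    simp only [this, iteratedDeriv_prodMk (hL.contDiff _) (hL'.contDiff _)]
    exact ((hL.continuous k).comp (by fun_prop : Continuous fun q : (Z × Z') × ℝ => (q.1.1, q.2))).prodMk
      ((hL'.continuous k).comp (by fun_prop : Continuous fun q : (Z × Z') × ℝ => (q.1.2, q.2)))

/-- The linear family `(z, z') ↦ (L z, L' z')`. -/
def prodFamily {Z Z' V V' : Type*} [AddCommGroup Z] [Module ℝ Z] [AddCommGroup Z'] [Module ℝ Z']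
    [AddCommGroup V] [Module ℝ V] [AddCommGroup V'] [Module ℝ V']
    (L : Z →ₗ[ℝ] (ℝ → V)) (L' : Z' →ₗ[ℝ] (ℝ → V')) : Z × Z' →ₗ[ℝ] (ℝ → V × V') where
  toFun q t := (L q.1 t, L' q.2 t)
  map_add' p q := by ext t <;> simp
  map_smul' a q := by ext t <;> simp

variable {E : Type*} [NormedAddCommGroup E] [NormedSpace ℝ E]
  {Y : Type*} [AddCommGroup Y] [Module ℝ Y] [TopologicalSpace Y]
  {Z : Type u} [AddCommGroup Z] [Module ℝ Z] [TopologicalSpace Z]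
  [ContinuousAdd Z] [ContinuousSMul ℝ Z]
  {V : Type v} [NormedAddCommGroup V] [NormedSpace ℝ V]

open BasedLoopSpace

theorem tendsto_of_curve {ι : Type*} {l : Filter ι} {j : Y →ₗ[ℝ] BasedLoopSpace E}
    (hj : IsInducing j) {X : ι → Y} {y : Y} {c : ι → ℝ → E}
    (hc : ∀ᶠ i in l, ∀ t, curve (j (X i)) t = c i t)
    (h : ∀ k t₀, Tendsto (fun q : ι × ℝ => iteratedDeriv k (c q.1) q.2) (l ×ˢ 𝓝 t₀)
      (𝓝 (iteratedDeriv k (curve (j y)) t₀))) : Tendsto X l (𝓝 y) := by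
  rw [hj.tendsto_nhds_iff]
  refine tendsto_of_tendsto_iteratedDeriv fun k t₀ => (h k t₀).congr' ?_
  filter_upwards [hc.prod_inl (𝓝 t₀)] with q hq
  rw [Function.comp_apply, (funext hq : curve (j (X q.1)) = c q.1)]

-- The function `f` depends explicitly on `t` because a chart of a mapping group is translated by a
-- loop `g(t)`. It need not be periodic in `t`.
omit [ContinuousAdd Z] [ContinuousSMul ℝ Z] in
theorem continuousOn_superposition {j : Y →ₗ[ℝ] BasedLoopSpace E} (hj : IsInducing j)
    {L : Z →ₗ[ℝ] (ℝ → V)} (hL : IsSmoothFamily L) {f : ℝ × V → E} {W : Set (ℝ × V)}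
    (hW : IsOpen W) (hf : ContDiffOn ℝ ∞ f W) {F : Z → Y} {U : Set Z}
    (hUW : ∀ z ∈ U, ∀ t, (t, L z t) ∈ W)
    (hF : ∀ z ∈ U, ∀ t, curve (j (F z)) t = f (t, L z t)) : ContinuousOn F U := by
  intro z hz
  refine tendsto_of_curve hj (c := fun z t => f (t, L z t)) ?_ fun k t₀ => ?_
  · filter_upwards [self_mem_nhdsWithin] with z hz using hF z hz
  · have h := continuousOn_iteratedDeriv_comp (S := U) k hW hf (c := fun z t => (t, L z t))
      (fun z _ => contDiff_id.prodMk (hL.contDiff z)) (fun i => ?_) hUW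
    · have h1 := h (z, t₀) ⟨hz, mem_univ _⟩
      rw [ContinuousWithinAt, nhdsWithin_prod_eq, nhdsWithin_univ] at h1
      rwa [(funext (hF z hz) : curve (j (F z)) = _)]
    · have h1 : ∀ z, iteratedDeriv i (fun t => (t, L z t)) = fun t =>
          (iteratedDeriv i (fun t : ℝ => t) t, iteratedDeriv i (L z) t) := fun z =>
        iteratedDeriv_prodMk contDiff_id (hL.contDiff z) i
      simp only [h1]
      have h2 : Continuous (iteratedDeriv i (fun t : ℝ => t)) :=
        ContDiff.continuous_iteratedDeriv (n := ∞) i contDiff_id (by exact_mod_cast le_top)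
      exact ((h2.comp continuous_snd).prodMk (hL.continuous i)).continuousOn

/-- The candidate is the pointwise derivative `w`, to which the difference quotients converge with
all their `t`-derivatives. Closedness of the image of `j` then places it in `Y`. -/
theorem exists_directionalDerivative {j : Y →ₗ[ℝ] BasedLoopSpace E} (hj : IsInducing j)
    (hcl : IsClosed (range j))
    {L : Z →ₗ[ℝ] (ℝ → V)} (hL : IsSmoothFamily L) {f : ℝ × V → E} {W : Set (ℝ × V)}
    (hW : IsOpen W) (hf : ContDiffOn ℝ ∞ f W) {F : Z → Y} {U : Set Z} (hU : IsOpen U)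
    (hUW : ∀ z ∈ U, ∀ t, (t, L z t) ∈ W)
    (hF : ∀ z ∈ U, ∀ t, curve (j (F z)) t = f (t, L z t)) {z : Z} (hz : z ∈ U) (v : Z) :
    ∃ y : Y, (∀ t, curve (j y) t = fderiv ℝ f (t, L z t) (0, L v t)) ∧
      Tendsto (fun s : ℝ => s⁻¹ • (F (z + s • v) - F z)) (𝓝[≠] 0) (𝓝 y) := by
  set w : ℝ → E := fun t => fderiv ℝ f (t, L z t) (0, L v t) with hw
  set Q : ℝ → Y := fun s => s⁻¹ • (F (z + s • v) - F z) with hQ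
  have hu : ContDiff ℝ ∞ (fun t => (t, L z t)) := contDiff_id.prodMk (hL.contDiff z)
  have hv : ContDiff ℝ ∞ (fun t => ((0 : ℝ), L v t)) := contDiff_const.prodMk (hL.contDiff v)
  have hws : ContDiff ℝ ∞ w := by
    have := (contDiffOn_fderiv_apply hW hf).comp_contDiff (hu.prodMk hv)
      fun t => ⟨hUW z hz t, mem_univ _⟩
    exact this
  have hlim := fun k t₀ => tendsto_iteratedDeriv_quotient k hW hf hu hv (hUW z hz) t₀
  have hev : ∀ᶠ s : ℝ in 𝓝[≠] 0, ∀ t, curve (j (Q s)) t =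
      s⁻¹ • (f ((t, L z t) + s • ((0 : ℝ), L v t)) - f (t, L z t)) := by
    filter_upwards [eventually_line_mem hU hz v] with s hs t
    simp only [hQ, map_smul, map_sub, Pi.smul_apply, Pi.sub_apply, hF _ hs, hF _ hz, map_add,
      Pi.add_apply, Prod.smul_mk, Prod.mk_add_mk, smul_zero, add_zero]
  have hlim' : ∀ k t₀, Tendsto (fun s => iteratedDeriv k (curve (j (Q s))) t₀) (𝓝[≠] 0)
      (𝓝 (iteratedDeriv k w t₀)) := fun k t₀ => by
    have h1 : Tendsto (fun s : ℝ => (s, t₀)) (𝓝[≠] 0) ((𝓝[≠] 0) ×ˢ 𝓝 t₀) :=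
      tendsto_id.prodMk tendsto_const_nhds
    refine ((hlim k t₀).comp h1).congr' ?_
    filter_upwards [hev] with s hs
    rw [(funext hs : curve (j (Q s)) = _)]
    rfl
  -- Periodicity and flatness of `w` cannot be read off from its formula, since `f` is not assumed
  -- periodic in `t`; they are inherited from the difference quotients, which are based loops.
  have hper : Function.Periodic w (2 * Real.pi) := fun t => by
    have h1 := hlim' 0 (t + 2 * Real.pi)
    have h2 := hlim' 0 t
    simp only [iteratedDeriv_zero] at h1 h2
    exact tendsto_nhds_unique h1 (h2.congr fun s => (periodic_curve _ t).symm)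
  have hflat : ∀ k, iteratedDeriv k w 0 = 0 := fun k =>
    tendsto_nhds_unique (hlim' k 0)
      (tendsto_const_nhds.congr fun s => (iteratedDeriv_curve_zero _ k).symm)
  have hX : Tendsto (fun s => j (Q s)) (𝓝[≠] 0) (𝓝 (ofPeriodic w hper hws hflat)) := by
    refine tendsto_of_curve (j := LinearMap.id) .id hev fun k t₀ => ?_
    exact hlim k t₀
  obtain ⟨y, hy⟩ : ofPeriodic w hper hws hflat ∈ range j :=
    hcl.mem_of_tendsto hX (Eventually.of_forall fun s => mem_range_self _)
  refine ⟨y, fun t => by rw [hy]; rfl, ?_⟩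
  rw [hj.tendsto_nhds_iff, hy]
  exact hX

theorem bastianiContDiffOn_superposition (k : ℕ) {j : Y →ₗ[ℝ] BasedLoopSpace E} (hj : IsInducing j)
    (hcl : IsClosed (range j))
    {L : Z →ₗ[ℝ] (ℝ → V)} (hL : IsSmoothFamily L) {f : ℝ × V → E} {W : Set (ℝ × V)}
    (hW : IsOpen W) (hf : ContDiffOn ℝ ∞ f W) {F : Z → Y} {U : Set Z} (hU : IsOpen U)
    (hUW : ∀ z ∈ U, ∀ t, (t, L z t) ∈ W)
    (hF : ∀ z ∈ U, ∀ t, curve (j (F z)) t = f (t, L z t)) : BastianiContDiffOn k Z F U := by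
  induction k generalizing Z V with
  | zero => exact continuousOn_superposition hj hL hW hf hUW hF
  | succ k ih =>
    have h := fun (z : Z) (hz : z ∈ U) =>
      exists_directionalDerivative hj hcl hL hW hf hU hUW hF hz
    choose! dF hdF hlim using h
    refine ⟨continuousOn_superposition hj hL hW hf hUW hF, fun q => dF q.1 q.2, hlim, ?_⟩
    -- The derivative is the superposition operator on `Z × Z` of `(t, x, w) ↦ Df(t, x)(0, w)`: the
    -- parameter `t` is not displaced.
    refine ih (L := prodFamily L L) (hL.prod hL fun q t => rfl)
      (f := fun q => fderiv ℝ f (q.1, q.2.1) (0, q.2.2))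
      (W := (fun q : ℝ × V × V => (q.1, q.2.1)) ⁻¹' W) (hW.preimage (by fun_prop)) ?_
      (hU.prod isOpen_univ) (fun z hz t => hUW z.1 hz.1 t) fun z hz t => hdF z.1 hz.1 z.2 t
    have hl : ContDiff ℝ ∞ (fun q : ℝ × V × V => ((q.1, q.2.1), ((0 : ℝ), q.2.2))) := by fun_prop
    exact (contDiffOn_fderiv_apply hW hf).comp hl.contDiffOn fun q hq => ⟨hq, mem_univ _⟩

theorem bastianiSmoothOn_superposition {j : Y →ₗ[ℝ] BasedLoopSpace E} (hj : IsInducing j)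
    (hcl : IsClosed (range j))
    {L : Z →ₗ[ℝ] (ℝ → V)} (hL : IsSmoothFamily L) {f : ℝ × V → E} {W : Set (ℝ × V)}
    (hW : IsOpen W) (hf : ContDiffOn ℝ ∞ f W) {F : Z → Y} {U : Set Z} (hU : IsOpen U)
    (hUW : ∀ z ∈ U, ∀ t, (t, L z t) ∈ W)
    (hF : ∀ z ∈ U, ∀ t, curve (j (F z)) t = f (t, L z t)) : BastianiSmoothOn F U :=
  fun k => bastianiContDiffOn_superposition k hj hcl hL hW hf hU hUW hF

end Superposition

/-! ### The Fréchet spaces `Ω_I E` and `P_0 E` -/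

section ModelSpaces

variable {E : Type*} [NormedAddCommGroup E] [NormedSpace ℝ E]

open BasedLoopSpace

theorem continuous_iteratedDeriv_eval (k : ℕ) (t : ℝ) :
    Continuous fun X : BasedLoopSpace E => iteratedDeriv k (curve X) t :=
  (continuous_iteratedDeriv_curve_uncurry k).comp (by fun_prop : Continuous fun X => (X, t))

theorem continuous_curve_eval (t : ℝ) : Continuous fun X : BasedLoopSpace E => curve X t := by
  simpa using continuous_iteratedDeriv_eval (E := E) 0 t

theorem isSmoothFamily_curve {Y : Type*} [AddCommGroup Y] [Module ℝ Y] [TopologicalSpace Y]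
    {j : Y →ₗ[ℝ] BasedLoopSpace E} (hj : Continuous j) : IsSmoothFamily (curve.comp j) where
  contDiff y := contDiff_curve (j y)
  continuous k := (continuous_iteratedDeriv_curve_uncurry k).comp
    ((hj.comp continuous_fst).prodMk continuous_snd)

theorem isUniformInducing_subtype (I : Set S1) :
    IsUniformInducing (basedLoopSpaceIn E I).subtype := ⟨rfl⟩

theorem isClosed_range_subtype (I : Set S1) :
    IsClosed (range (basedLoopSpaceIn E I).subtype) := by
  have h : range (basedLoopSpaceIn E I).subtype =
      ⋂ t : {t : ℝ // (t : S1) ∉ I}, {X : BasedLoopSpace E | curve X t = 0} := by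
    ext X
    simp only [Submodule.coe_subtype, Subtype.range_coe_subtype, mem_iInter, mem_ofPred_eq]
    refine ⟨fun hX t => hX _ t.2, fun hX t ht => ?_⟩
    induction t using QuotientAddGroup.induction_on with
    | H t => exact hX ⟨t, ht⟩
  rw [h]
  exact isClosed_iInter fun t => isClosed_eq (continuous_curve_eval _) continuous_const

instance isFrechetSpace_basedLoopSpaceIn [CompleteSpace E] (I : Set S1) :
    IsFrechetSpace (basedLoopSpaceIn E I) :=
  .of_isUniformInducing (basedLoopSpaceIn E I).subtype (isUniformInducing_subtype I)
    Subtype.val_injective (isClosed_range_subtype I)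

/-- The map `S¹ → [0, π]` folding the circle. -/
noncomputable def fold : S1 → HalfInterval := cup id id

theorem cup_eq_or {X : Type*} (t : S1) :
    (∀ γ₁ γ₂ : HalfInterval → X, cup γ₁ γ₂ t = γ₁ (fold t)) ∨
      ∀ γ₁ γ₂ : HalfInterval → X, cup γ₁ γ₂ t = γ₂ (fold t) := by
  rw [← AddCircle.coe_equivIco (p := 2 * Real.pi) (a := 0) (y := t)]
  simp only [fold, cup, AddCircle.liftIco_coe_apply (AddCircle.equivIco _ 0 t).2]
  split_ifs
  · exact .inl fun _ _ => rfl
  · exact .inr fun _ _ => rfl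

theorem cup_self {X : Type*} (γ : HalfInterval → X) (t : S1) : cup γ γ t = γ (fold t) :=
  (cup_eq_or t).elim (fun h => h γ γ) fun h => h γ γ

theorem fold_coe {t : ℝ} (ht : t ∈ Icc 0 Real.pi) : fold (t : S1) = ⟨t, ht⟩ := by
  rw [fold, cup_left _ _ ht, extendPath_of_mem _ ht]
  rfl

theorem fold_surjective : Function.Surjective fold := fun s => ⟨((s : ℝ) : S1), fold_coe s.2⟩

/-! ### The space `P_0 E` as a closed subspace of `ΩE` by doubling -/

namespace PathSpace

/-- The `k`-th derivative of a path. -/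
noncomputable def halfDeriv (k : ℕ) (X : PathSpace E) : HalfInterval → E :=
  fun t => iteratedDerivWithin k (extendPath X.1) (Icc 0 Real.pi) t

theorem halfDeriv_zero (X : PathSpace E) : halfDeriv 0 X = X.1 := by
  ext1 t
  rw [halfDeriv, iteratedDerivWithin_zero, extendPath_of_mem _ t.2]

theorem halfDeriv_start (k : ℕ) (X : PathSpace E) : halfDeriv k X startPt = 0 := by
  rcases k.eq_zero_or_pos with rfl | hk
  · rw [halfDeriv_zero]; exact X.2.2.1
  · exact (X.2.2.2 k hk).1

theorem halfDeriv_end {k : ℕ} (hk : 1 ≤ k) (X : PathSpace E) : halfDeriv k X endPt = 0 :=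
  (X.2.2.2 k hk).2

theorem hasDerivWithinAt_halfDeriv (k : ℕ) (X : PathSpace E) {t : ℝ} (ht : t ∈ Icc 0 Real.pi) :
    HasDerivWithinAt (extendPath (halfDeriv k X)) (extendPath (halfDeriv (k + 1) X) t)
      (Icc 0 Real.pi) t := by
  have h1 : ∀ k, EqOn (extendPath (halfDeriv k X))
      (iteratedDerivWithin k (extendPath X.1) (Icc 0 Real.pi)) (Icc 0 Real.pi) := fun k t ht => by
    rw [extendPath_of_mem _ ht]; rfl
  have h2 := (X.2.1.differentiableOn_iteratedDerivWithin (m := k)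
    (by exact_mod_cast WithTop.coe_lt_top _) (uniqueDiffOn_Icc Real.pi_pos)) t ht
  have h3 := h2.hasDerivWithinAt
  rw [← iteratedDerivWithin_succ, ← h1 (k + 1) ht] at h3
  exact h3.congr (h1 k) (h1 k ht)

/-- The `k`-th derivative of the loop `X ∪ X`. -/
noncomputable def loopDeriv (X : PathSpace E) (k : ℕ) (t : ℝ) : E :=
  cup (halfDeriv k X) ((-1 : ℝ) ^ k • halfDeriv k X) (t : S1)

theorem halfDeriv_match_start (k : ℕ) (X : PathSpace E) :
    halfDeriv k X startPt = ((-1 : ℝ) ^ k • halfDeriv k X) startPt := by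
  simp [halfDeriv_start]

/-- In order zero the sign is `1`, and in higher orders both sides vanish by flatness. Hence the
value of the path at `π` may be arbitrary. -/
theorem halfDeriv_match_end (k : ℕ) (X : PathSpace E) :
    halfDeriv k X endPt = ((-1 : ℝ) ^ k • halfDeriv k X) endPt := by
  rcases k.eq_zero_or_pos with rfl | hk
  · simp
  · simp [halfDeriv_end hk]

theorem periodic_loopDeriv (X : PathSpace E) (k : ℕ) :
    Function.Periodic (loopDeriv X k) (2 * Real.pi) := fun t => by simp [loopDeriv]

theorem extendPath_smul (c : ℝ) (f : HalfInterval → E) (t : ℝ) :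
    extendPath (c • f) t = c • extendPath f t := rfl

/-- The reflection has derivative `-1`, which accounts for the additional sign in each order. -/
theorem hasDerivWithinAt_reflect (k : ℕ) (X : PathSpace E) {c t : ℝ} {s : Set ℝ}
    (ht : c - t ∈ Icc 0 Real.pi) (hs : ∀ x ∈ s, c - x ∈ Icc 0 Real.pi) :
    HasDerivWithinAt (fun x => extendPath ((-1 : ℝ) ^ k • halfDeriv k X) (c - x))
      (extendPath ((-1 : ℝ) ^ (k + 1) • halfDeriv (k + 1) X) (c - t)) s t := by
  have h1 := (hasDerivWithinAt_halfDeriv k X ht).const_smul ((-1 : ℝ) ^ k)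
  have h2 : HasDerivWithinAt (fun x => c - x) (-1) s t :=
    ((hasDerivAt_id t).const_sub c).hasDerivWithinAt
  have h3 := h1.scomp t h2 hs
  refine HasDerivWithinAt.congr_deriv (f' := _) h3 ?_
  rw [extendPath_smul, pow_succ', neg_one_mul, neg_smul, neg_smul, one_smul]

/-- The derivatives within `[-π, 0]`, `[0, π]` and `[π, 2π]` agree at the common end points `0` and
`π`, where they glue to two-sided ones. Periodicity extends the result from one period to the line.
-/
theorem hasDerivAt_loopDeriv (X : PathSpace E) (k : ℕ) (t : ℝ) :
    HasDerivAt (loopDeriv X k) (loopDeriv X (k + 1) t) t := by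
  have hpi := Real.pi_pos
  have a : ∀ t ∈ Icc 0 Real.pi,
      HasDerivWithinAt (loopDeriv X k) (loopDeriv X (k + 1) t) (Icc 0 Real.pi) t := fun t ht => by
    have := hasDerivWithinAt_halfDeriv k X ht
    rw [loopDeriv, cup_left _ _ ht]
    exact this.congr (fun s hs => cup_left _ _ hs) (cup_left _ _ ht)
  have b : ∀ t ∈ Icc Real.pi (2 * Real.pi), HasDerivWithinAt (loopDeriv X k)
      (loopDeriv X (k + 1) t) (Icc Real.pi (2 * Real.pi)) t := fun t ht => by
    have hs : ∀ x ∈ Icc Real.pi (2 * Real.pi), 2 * Real.pi - x ∈ Icc 0 Real.pi := fun x hx =>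
      ⟨by linarith [hx.2], by linarith [hx.1]⟩
    have := hasDerivWithinAt_reflect k X (hs t ht) hs
    rw [loopDeriv, cup_right _ _ (halfDeriv_match_start _ X) (halfDeriv_match_end _ X) ht]
    exact this.congr
      (fun s hs => cup_right _ _ (halfDeriv_match_start _ X) (halfDeriv_match_end _ X) hs)
      (cup_right _ _ (halfDeriv_match_start _ X) (halfDeriv_match_end _ X) ht)
  have c : ∀ t ∈ Icc (-Real.pi) 0, HasDerivWithinAt (loopDeriv X k)
      (loopDeriv X (k + 1) t) (Icc (-Real.pi) 0) t := fun t ht => by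
    have hs : ∀ x ∈ Icc (-Real.pi) 0, 0 - x ∈ Icc 0 Real.pi := fun x hx =>
      ⟨by linarith [hx.2], by linarith [hx.1]⟩
    have := hasDerivWithinAt_reflect k X (hs t ht) hs
    rw [loopDeriv, cup_neg _ _ (halfDeriv_match_start _ X) (halfDeriv_match_end _ X) ht]
    exact this.congr
      (fun s hs => cup_neg _ _ (halfDeriv_match_start _ X) (halfDeriv_match_end _ X) hs)
      (cup_neg _ _ (halfDeriv_match_start _ X) (halfDeriv_match_end _ X) ht)
  have glue : ∀ x y z : ℝ, x < y → y < z →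
      HasDerivWithinAt (loopDeriv X k) (loopDeriv X (k + 1) y) (Icc x y) y →
      HasDerivWithinAt (loopDeriv X k) (loopDeriv X (k + 1) y) (Icc y z) y →
      HasDerivAt (loopDeriv X k) (loopDeriv X (k + 1) y) y := fun x y z hx hz h1 h2 => by
    have h3 := h1.union h2
    rw [Icc_union_Icc_eq_Icc hx.le hz.le] at h3
    exact h3.hasDerivAt (Icc_mem_nhds hx hz)
  have gen : ∀ t ∈ Ico (0 : ℝ) (0 + 2 * Real.pi),
      HasDerivAt (loopDeriv X k) (loopDeriv X (k + 1) t) t := by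
    rintro t ⟨h0, h1⟩
    rw [zero_add] at h1
    rcases h0.eq_or_lt with rfl | h0
    · exact glue _ _ _ (by linarith) hpi (c 0 ⟨by linarith, le_rfl⟩) (a 0 ⟨le_rfl, hpi.le⟩)
    rcases lt_trichotomy t Real.pi with h | rfl | h
    · exact (a t ⟨h0.le, h.le⟩).hasDerivAt (Icc_mem_nhds h0 h)
    · exact glue _ _ _ hpi (by linarith) (a _ ⟨hpi.le, le_rfl⟩) (b _ ⟨le_rfl, by linarith⟩)
    · exact (b t ⟨h.le, h1.le⟩).hasDerivAt (Icc_mem_nhds h h1)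
  have hmem := sub_toIcoDiv_zsmul_mem_Ico Real.two_pi_pos 0 t
  have := (gen _ hmem).comp_sub_const t (toIcoDiv Real.two_pi_pos 0 t • (2 * Real.pi))
  rw [(periodic_loopDeriv X (k + 1)).sub_zsmul_eq] at this
  refine this.congr_of_eventuallyEq (Eventually.of_forall fun s => ?_)
  exact ((periodic_loopDeriv X k).sub_zsmul_eq _).symm

/-- The loop `X ∪ X`. -/
noncomputable def double : PathSpace E →ₗ[ℝ] BasedLoopSpace E where
  toFun X := ofPeriodic (loopDeriv X 0) (periodic_loopDeriv X 0)
    (contDiff_of_hasDerivAt (hasDerivAt_loopDeriv X)) fun k => by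
      rw [iteratedDeriv_eq_of_hasDerivAt (hasDerivAt_loopDeriv X)]
      have := cup_left (halfDeriv k X) ((-1 : ℝ) ^ k • halfDeriv k X)
        (left_mem_Icc.2 Real.pi_pos.le)
      rw [extendPath_of_mem _ (left_mem_Icc.2 Real.pi_pos.le)] at this
      exact this.trans (halfDeriv_start k X)
  map_add' X Y := by
    refine curve_injective (funext fun t => ?_)
    rw [map_add]
    change loopDeriv (X + Y) 0 t = loopDeriv X 0 t + loopDeriv Y 0 t
    simp only [loopDeriv, pow_zero, one_smul, halfDeriv_zero, cup_self]
    rfl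
  map_smul' a X := by
    refine curve_injective (funext fun t => ?_)
    rw [map_smul]
    change loopDeriv (a • X) 0 t = a • loopDeriv X 0 t
    simp only [loopDeriv, pow_zero, one_smul, halfDeriv_zero, cup_self]
    rfl

theorem iteratedDeriv_curve_double (X : PathSpace E) (k : ℕ) :
    iteratedDeriv k (curve (double X)) = loopDeriv X k :=
  iteratedDeriv_eq_of_hasDerivAt (hasDerivAt_loopDeriv X) k

theorem double_apply (X : PathSpace E) (t : S1) : (double X).1 t = X.1 (fold t) := by
  induction t using QuotientAddGroup.induction_on with
  | H t =>
    change loopDeriv X 0 t = _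
    simp only [loopDeriv, pow_zero, one_smul, halfDeriv_zero, cup_self]

theorem double_injective : Function.Injective (double (E := E)) := fun X Y h => by
  refine Subtype.ext (funext fun s => ?_)
  obtain ⟨t, rfl⟩ := fold_surjective s
  rw [← double_apply, ← double_apply, h]

theorem isUniformInducing_halfDeriv : IsUniformInducing
    (fun (X : PathSpace E) (k : ℕ) => UniformFun.ofFun (halfDeriv k X)) := ⟨rfl⟩

theorem isUniformInducing_piMap {ι : Type*} {α β : ι → Type*} [∀ i, UniformSpace (α i)]
    [∀ i, UniformSpace (β i)] {θ : ∀ i, α i → β i} (h : ∀ i, IsUniformInducing (θ i)) :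
    IsUniformInducing (Pi.map θ) where
  comap_uniformity := by
    simp only [Pi.uniformity, comap_iInf, comap_comap, ← (h _).comap_uniformity]
    rfl

/-- The sign does not change distances, and folding maps the line onto `[0, π]`, so both suprema run
over the same values. Applied in every order, this makes doubling induce the uniformity of the path
space. -/
theorem isometry_cup_smul (k : ℕ) : Isometry (fun f : UniformFun HalfInterval E =>
    UniformFun.ofFun (fun t : ℝ => cup (UniformFun.toFun f)
      ((-1 : ℝ) ^ k • UniformFun.toFun f) (t : S1))) := by
  intro f g
  rw [UniformFun.edist_def, UniformFun.edist_def]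
  have h : ∀ t : ℝ, edist (cup (UniformFun.toFun f) ((-1 : ℝ) ^ k • UniformFun.toFun f) (t : S1))
      (cup (UniformFun.toFun g) ((-1 : ℝ) ^ k • UniformFun.toFun g) (t : S1)) =
      edist (UniformFun.toFun f (fold t)) (UniformFun.toFun g (fold t)) := fun t => by
    rcases cup_eq_or (X := E) (t : S1) with h | h
    · rw [h, h]
    · rw [h, h, Pi.smul_apply, Pi.smul_apply, edist_eq_enorm_sub, ← smul_sub, enorm_smul,
        ← edist_eq_enorm_sub]
      simp
  simp only [UniformFun.toFun_ofFun, h]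
  refine le_antisymm (iSup_le fun t => ?_) (iSup_le fun s => ?_)
  · exact le_iSup (fun s => edist (UniformFun.toFun f s) (UniformFun.toFun g s)) (fold t)
  · refine le_trans ?_ (le_iSup _ (s : ℝ))
    rw [fold_coe s.2]

theorem isUniformInducing_double : IsUniformInducing (double (E := E)) := by
  rw [← isUniformInducing_iteratedDeriv.of_comp_iff]
  have h := (isUniformInducing_piMap fun k : ℕ => (isometry_cup_smul (E := E) k).isUniformInducing).comp
    isUniformInducing_halfDeriv
  convert h using 1
  ext1 X
  ext1 k
  change UniformFun.ofFun (iteratedDeriv k (curve (double X))) = _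
  rw [iteratedDeriv_curve_double]
  rfl

theorem iteratedDerivWithin_restrictHalf (X : BasedLoopSpace E) (k : ℕ) {t : ℝ}
    (ht : t ∈ Icc 0 Real.pi) :
    iteratedDerivWithin k (extendPath (restrictHalf X.1)) (Icc 0 Real.pi) t =
      iteratedDeriv k (curve X) t := by
  have h : EqOn (extendPath (restrictHalf X.1)) (curve X) (Icc 0 Real.pi) := fun s hs => by
    rw [extendPath_of_mem _ hs]; rfl
  rw [iteratedDerivWithin_congr h ht]
  exact iteratedDerivWithin_eq_iteratedDeriv (uniqueDiffOn_Icc Real.pi_pos)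
    ((contDiff_curve X).contDiffAt.of_le (by exact_mod_cast le_top)) ht

theorem restrictHalf_mem_pathModule {X : BasedLoopSpace E}
    (h : ∀ k, 1 ≤ k → iteratedDeriv k (curve X) Real.pi = 0) :
    restrictHalf X.1 ∈ pathModule E := by
  have m0 := left_mem_Icc.2 Real.pi_pos.le
  have m1 := right_mem_Icc.2 Real.pi_pos.le
  refine ⟨(contDiff_curve X).contDiffOn.congr fun s hs => ?_, ?_, fun k hk => ⟨?_, ?_⟩⟩
  · rw [extendPath_of_mem _ hs]; rfl
  · have := iteratedDeriv_curve_zero X 0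
    rw [iteratedDeriv_zero] at this
    exact this
  · rw [iteratedDerivWithin_restrictHalf X k m0, iteratedDeriv_curve_zero]
  · rw [iteratedDerivWithin_restrictHalf X k m1, h k hk]

theorem coe_fold (t : S1) : (((fold t : HalfInterval) : ℝ) : S1) = t ∨
    (((fold t : HalfInterval) : ℝ) : S1) = -t := by
  rw [← AddCircle.coe_equivIco (p := 2 * Real.pi) (a := 0) (y := t)]
  have hm := (AddCircle.equivIco (2 * Real.pi) 0 t).2
  set s : ℝ := (AddCircle.equivIco (2 * Real.pi) 0 t : ℝ) with hs
  rw [zero_add] at hm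
  rcases le_total s Real.pi with h | h
  · left
    rw [fold_coe ⟨hm.1, h⟩]
  · right
    rw [fold, cup_right _ _ rfl rfl ⟨h, hm.2.le⟩, extendPath_of_mem _ ⟨by linarith [hm.2], by linarith⟩]
    simp

/-- An even loop is determined by its first half, and flatness at `π` is what this half needs in
order to be a path of the required kind. Both conditions are closed. -/
theorem range_double : range (double (E := E)) =
    {X | (∀ t, curve X (-t) = curve X t) ∧
      ∀ k, 1 ≤ k → iteratedDeriv k (curve X) Real.pi = 0} := by
  ext X
  constructor
  · rintro ⟨Y, rfl⟩
    refine ⟨fun t => ?_, fun k hk => ?_⟩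
    · change (double Y).1 ((-t : ℝ) : S1) = (double Y).1 (t : S1)
      -- With a representative in `[-π, π)`, changing the sign exchanges the two halves of the
      -- doubled path.
      obtain ⟨n, hn⟩ : ∃ n : ℤ, t - n • (2 * Real.pi) ∈ Ico (-Real.pi) (-Real.pi + 2 * Real.pi) :=
        ⟨_, sub_toIcoDiv_zsmul_mem_Ico Real.two_pi_pos (-Real.pi) t⟩
      set s := t - n • (2 * Real.pi) with hs
      have hts : (t : S1) = (s : S1) := by
        have h0 : ((n • (2 * Real.pi) : ℝ) : S1) = 0 := (AddCircle.coe_eq_zero_iff _).2 ⟨n, rfl⟩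
        rw [hs, AddCircle.coe_sub, h0, sub_zero]
      have key : ∀ s ∈ Icc 0 Real.pi, fold ((-s : ℝ) : S1) = fold (s : S1) := fun s h => by
        rw [fold_coe h, fold, cup_neg _ _ rfl rfl ⟨by linarith [h.2], by linarith [h.1]⟩,
          extendPath_of_mem _ ⟨by linarith [h.1], by linarith [h.2]⟩]
        simp
      have hneg : ((-t : ℝ) : S1) = ((-s : ℝ) : S1) := by
        rw [AddCircle.coe_neg, AddCircle.coe_neg, hts]
      rw [double_apply, double_apply, hneg, hts]
      rcases le_total 0 s with h | h
      · rw [key s ⟨h, by linarith [hn.2]⟩]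
      · rw [← key (-s) ⟨by linarith, by linarith [hn.1]⟩, neg_neg]
    · rw [iteratedDeriv_curve_double, loopDeriv, cup_left _ _ ⟨Real.pi_pos.le, le_rfl⟩,
        extendPath_of_mem _ ⟨Real.pi_pos.le, le_rfl⟩]
      exact halfDeriv_end hk Y
  · rintro ⟨h1, h2⟩
    refine ⟨⟨restrictHalf X.1, restrictHalf_mem_pathModule h2⟩, ?_⟩
    refine Subtype.ext (funext fun t => ?_)
    refine (double_apply _ t).trans ?_
    change X.1 (((fold t : HalfInterval) : ℝ) : S1) = X.1 t
    rcases coe_fold t with h | h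
    · rw [h]
    · rw [h]
      induction t using QuotientAddGroup.induction_on with
      | H t => exact h1 t

theorem isClosed_range_double : IsClosed (range (double (E := E))) := by
  rw [range_double]
  have h : {X : BasedLoopSpace E | (∀ t, curve X (-t) = curve X t) ∧
      ∀ k, 1 ≤ k → iteratedDeriv k (curve X) Real.pi = 0} =
      (⋂ t : ℝ, {X : BasedLoopSpace E | curve X (-t) = curve X t}) ∩
      ⋂ k : {k : ℕ // 1 ≤ k}, {X : BasedLoopSpace E | iteratedDeriv k (curve X) Real.pi = 0} := by
    ext X
    simp
  rw [h]
  exact (isClosed_iInter fun t => isClosed_eq (continuous_curve_eval _)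
    (continuous_curve_eval _)).inter (isClosed_iInter fun k =>
      isClosed_eq (continuous_iteratedDeriv_eval _ _) continuous_const)

instance [CompleteSpace E] : IsFrechetSpace (PathSpace E) :=
  .of_isUniformInducing double isUniformInducing_double double_injective isClosed_range_double

end PathSpace

/-! ### Restriction of loops supported in `(0, π)` -/

open PathSpace

/-- The loop vanishes on `[π, 2π]`, and its derivatives at `π` can be computed within this interval.
-/
theorem iteratedDeriv_pi_eq_zero (X : basedLoopSpaceIn E upperHalf) (k : ℕ) :
    iteratedDeriv k (curve X.1) Real.pi = 0 := by
  have hpi := Real.pi_pos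
  have hu : UniqueDiffOn ℝ (Icc Real.pi (2 * Real.pi)) := uniqueDiffOn_Icc (by linarith)
  have hm : Real.pi ∈ Icc Real.pi (2 * Real.pi) := ⟨le_rfl, by linarith⟩
  rw [← iteratedDerivWithin_eq_iteratedDeriv hu
    ((contDiff_curve X.1).contDiffAt.of_le (by exact_mod_cast le_top)) hm]
  have h : EqOn (curve X.1) (fun _ => (0 : E)) (Icc Real.pi (2 * Real.pi)) := fun t ht =>
    X.2 _ (coe_notMem_upperHalf ht)
  rw [iteratedDerivWithin_congr h hm, iteratedDerivWithin_const]
  simp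

/-- The restriction `Ω_{(0,π)} E → P_0 E`. -/
noncomputable def restrictSpace : basedLoopSpaceIn E upperHalf →ₗ[ℝ] PathSpace E where
  toFun X := ⟨restrictHalf X.1.1,
    restrictHalf_mem_pathModule fun k _ => iteratedDeriv_pi_eq_zero X k⟩
  map_add' _ _ := rfl
  map_smul' _ _ := rfl

theorem continuous_restrictSpace : Continuous (restrictSpace (E := E)) := by
  rw [isUniformInducing_halfDeriv.isInducing.continuous_iff]
  refine continuous_pi fun k => ?_
  have h1 : Continuous fun X : basedLoopSpaceIn E upperHalf =>
      UniformFun.ofFun (iteratedDeriv k (curve X.1)) :=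
    ((continuous_apply k).comp isUniformInducing_iteratedDeriv.isInducing.continuous).comp
      continuous_subtype_val
  have h2 : Continuous fun f : UniformFun ℝ E =>
      UniformFun.ofFun (UniformFun.toFun f ∘ ((↑) : HalfInterval → ℝ)) :=
    UniformFun.precomp_uniformContinuous.continuous
  refine (h2.comp h1).congr fun X => ?_
  refine congrArg UniformFun.ofFun (funext fun t => ?_)
  exact (iteratedDerivWithin_restrictHalf X.1 k t.2).symm

end ModelSpaces

/-! ### Charts of the target group and flat maps -/

section TargetCharts

variable {E : Type*} [NormedAddCommGroup E] [NormedSpace ℝ E]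
  {G : Type*} [TopologicalSpace G] [ChartedSpace E G]

theorem contDiffWithinAt_chart_comp {φ : OpenPartialHomeomorph G E}
    (hφ : φ ∈ IsManifold.maximalAtlas 𝓘(ℝ, E) ∞ G) {f : ℝ → G} {s : Set ℝ} {p : ℝ}
    (hf : ContMDiffWithinAt 𝓘(ℝ, ℝ) 𝓘(ℝ, E) ∞ f s p) (hfp : f p ∈ φ.source) :
    ContDiffWithinAt ℝ ∞ (fun t => φ (f t)) s p := by
  rw [← contMDiffWithinAt_iff_contDiffWithinAt]
  exact (contMDiffAt_of_mem_maximalAtlas hφ hfp).comp_contMDiffWithinAt p hf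

theorem contMDiffWithinAt_chart_symm_comp {φ : OpenPartialHomeomorph G E}
    (hφ : φ ∈ IsManifold.maximalAtlas 𝓘(ℝ, E) ∞ G) {c : ℝ → E} {s : Set ℝ} {p : ℝ}
    (hc : ContDiffWithinAt ℝ ∞ c s p) (hcp : c p ∈ φ.target) :
    ContMDiffWithinAt 𝓘(ℝ, ℝ) 𝓘(ℝ, E) ∞ (fun t => φ.symm (c t)) s p :=
  (contMDiffAt_symm_of_mem_maximalAtlas hφ hcp).comp_contMDiffWithinAt p
    (contMDiffWithinAt_iff_contDiffWithinAt.2 hc)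

variable [IsManifold 𝓘(ℝ, E) ∞ G]

/-- Flatness does not depend on the chart: the change of chart is smooth, and each term in the
higher chain rule contains a derivative of the inner curve of positive order. -/
theorem FlatAt.chart_comp {φ : OpenPartialHomeomorph G E}
    (hφ : φ ∈ IsManifold.maximalAtlas 𝓘(ℝ, E) ∞ G) {f : ℝ → G} {s : Set ℝ} {p : ℝ}
    (hs : UniqueDiffOn ℝ s) (hp : p ∈ s)
    (hf : ContMDiffWithinAt 𝓘(ℝ, ℝ) 𝓘(ℝ, E) ∞ f s p) (hfp : f p ∈ φ.source)
    (h0 : FlatAt E f s p) (k : ℕ) (hk : 1 ≤ k) :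
    iteratedDerivWithin k (fun t => φ (f t)) s p = 0 := by
  set ψ := chartAt E (f p)
  have hψ : ψ ∈ IsManifold.maximalAtlas 𝓘(ℝ, E) ∞ G := IsManifold.chart_mem_maximalAtlas _
  have hx : ψ (f p) ∈ ψ.target := ψ.map_source (mem_chart_source E (f p))
  have hg : ContDiffAt ℝ ∞ (fun v => φ (ψ.symm v)) (ψ (f p)) := by
    rw [← contMDiffAt_iff_contDiffAt]
    refine ContMDiffAt.comp (I' := 𝓘(ℝ, E)) (g := φ) _ ?_ (contMDiffAt_symm_of_mem_maximalAtlas hψ hx)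
    rw [ψ.left_inv (mem_chart_source E (f p))]
    exact contMDiffAt_of_mem_maximalAtlas hφ hfp
  rw [← flat_comp_aux hs hp (contDiffWithinAt_chart hf) hg h0 k hk]
  refine Filter.EventuallyEq.iteratedDerivWithin_eq ?_ ?_
  · filter_upwards [hf.continuousWithinAt.preimage_mem_nhdsWithin (chart_source_mem_nhds E (f p))]
      with t ht
    rw [ψ.left_inv ht]
  · rw [ψ.left_inv (mem_chart_source E (f p))]

theorem flatAt_chart_symm_comp {φ : OpenPartialHomeomorph G E}
    (hφ : φ ∈ IsManifold.maximalAtlas 𝓘(ℝ, E) ∞ G) {c : ℝ → E} {s : Set ℝ} {p : ℝ}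
    (hs : UniqueDiffOn ℝ s) (hp : p ∈ s)
    (hc : ContDiffWithinAt ℝ ∞ c s p) (hcp : c p ∈ φ.target)
    (h0 : ∀ k, 1 ≤ k → iteratedDerivWithin k c s p = 0) :
    FlatAt E (fun t => φ.symm (c t)) s p := by
  intro k hk
  set ψ := chartAt E (φ.symm (c p))
  have hψ : ψ ∈ IsManifold.maximalAtlas 𝓘(ℝ, E) ∞ G := IsManifold.chart_mem_maximalAtlas _
  have hg : ContDiffAt ℝ ∞ (fun v => ψ (φ.symm v)) (c p) := by
    rw [← contMDiffAt_iff_contDiffAt]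
    exact ContMDiffAt.comp (I' := 𝓘(ℝ, E)) (g := ψ) _
      (contMDiffAt_of_mem_maximalAtlas hψ (mem_chart_source E _))
      (contMDiffAt_symm_of_mem_maximalAtlas hφ hcp)
  exact flat_comp_aux hs hp hc hg h0 k hk

variable (E) in
/-- Around every point there is a smooth chart sending it to zero. -/
theorem exists_centered_chart (x : G) : ∃ φ ∈ IsManifold.maximalAtlas 𝓘(ℝ, E) ∞ G,
    x ∈ φ.source ∧ φ x = 0 := by
  set ψ := chartAt E x
  set τ : OpenPartialHomeomorph E E := (Homeomorph.addRight (-ψ x)).toOpenPartialHomeomorph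
  have hτ : τ ∈ contDiffGroupoid ∞ 𝓘(ℝ, E) := by
    rw [contDiffGroupoid, mem_groupoid_of_pregroupoid, contDiffPregroupoid]
    constructor
    · have : ContDiff ℝ ∞ (fun y : E => y + -ψ x) := by fun_prop
      simpa [τ, Function.comp_def] using this.contDiffOn
    · have : ContDiff ℝ ∞ (fun y : E => y + ψ x) := by fun_prop
      simpa [τ, Function.comp_def, Homeomorph.addRight_symm] using this.contDiffOn
  refine ⟨ψ.trans τ, ?_, ?_, ?_⟩
  · refine mem_maximalAtlas_iff.2 fun e he => ⟨?_, ?_⟩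
    · rw [OpenPartialHomeomorph.trans_symm_eq_symm_trans_symm, OpenPartialHomeomorph.trans_assoc]
      exact (contDiffGroupoid ∞ 𝓘(ℝ, E)).trans ((contDiffGroupoid ∞ 𝓘(ℝ, E)).symm hτ)
        (HasGroupoid.compatible (chart_mem_atlas E x) he)
    · rw [← OpenPartialHomeomorph.trans_assoc]
      exact (contDiffGroupoid ∞ 𝓘(ℝ, E)).trans
        (HasGroupoid.compatible he (chart_mem_atlas E x)) hτ
  · simp [τ, ψ]
  · simp [τ]

/-- Charts make points closed, and a topological group with closed points is Hausdorff. -/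
theorem t2Space_of_lieGroup (E G : Type*) [NormedAddCommGroup E] [NormedSpace ℝ E]
    [TopologicalSpace G] [ChartedSpace E G] [Group G] [LieGroup 𝓘(ℝ, E) ∞ G] : T2Space G := by
  have : IsTopologicalGroup G := topologicalGroup_of_lieGroup 𝓘(ℝ, E) ∞
  have : T1Space G := ChartedSpace.t1Space E G
  infer_instance

end TargetCharts

/-! ### Mapping groups -/

section MappingGroups

universe u

variable {E : Type u} [NormedAddCommGroup E] [NormedSpace ℝ E]
  {G : Type*} [TopologicalSpace G] [ChartedSpace E G] [Group G] [LieGroup 𝓘(ℝ, E) ∞ G]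

open BasedLoopSpace

variable (G) in
/-- A group `Γ` with charts in `Y` is, through the embeddings `j` and `i`, a closed subgroup of the
based loop group with the standard charts. -/
structure IsMappingGroup {Γ Y : Type*} [Group Γ] [AddCommGroup Y] [Module ℝ Y] [UniformSpace Y]
    (A : Set (PartialEquiv Γ Y)) (j : Γ →* basedLoopGroup E G) (i : Y →ₗ[ℝ] BasedLoopSpace E) :
    Prop where
  isUniformInducing : IsUniformInducing i
  injective_space : Function.Injective i
  isClosed_range : IsClosed (range i)
  injective_group : Function.Injective j
  charts_eq : A = mappingGroupCharts (fun γ (t : S1) => (j γ).1 t) fun y t => (i y).1 t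
  exists_coord : ∀ φ ∈ IsManifold.maximalAtlas 𝓘(ℝ, E) ∞ G, (1 : G) ∈ φ.source → φ 1 = 0 →
    ∀ γ : Γ, (∀ t, (j γ).1 t ∈ φ.source) → ∃ y, ∀ t, (i y).1 t = φ ((j γ).1 t)
  exists_elt : ∀ φ ∈ IsManifold.maximalAtlas 𝓘(ℝ, E) ∞ G, (1 : G) ∈ φ.source → φ 1 = 0 →
    ∀ y : Y, (∀ t, (i y).1 t ∈ φ.target) → ∃ γ, ∀ t, (j γ).1 t = φ.symm ((i y).1 t)

theorem basedLoop_ext {a b : basedLoopGroup E G} (h : ∀ t : ℝ, a.1 t = b.1 t) : a = b := by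
  refine Subtype.ext (funext fun t => ?_)
  induction t using QuotientAddGroup.induction_on with
  | H t => exact h t

theorem contMDiff_basedLoop (γ : basedLoopGroup E G) :
    ContMDiff 𝓘(ℝ, ℝ) 𝓘(ℝ, E) ∞ fun t : ℝ => γ.1 (t : S1) := γ.2.1

/-- If the property `P z t` is periodic in `t` and open, then so is `∀ t, P z t`. -/
theorem isOpen_forall_of_periodic {Z : Type*} [TopologicalSpace Z] {O : Set Z} (hO : IsOpen O)
    {P : Z → S1 → Prop}
    (hP : ∀ z ∈ O, ∀ t : ℝ, P z t → ∀ᶠ q : Z × ℝ in 𝓝 (z, t), q.1 ∈ O → P q.1 (q.2 : S1)) :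
    IsOpen {z ∈ O | ∀ t, P z t} := by
  rw [isOpen_iff_mem_nhds]
  rintro z ⟨hz, hzt⟩
  -- One period is compact, so the neighbourhoods of `z` for the various `t` can be replaced by a
  -- single one.
  have h1 := (isCompact_Icc (a := (0 : ℝ)) (b := 2 * Real.pi)).eventually_forall_of_forall_eventually
    (x₀ := z) (P := fun z t => z ∈ O → P z (t : S1)) fun t _ => hP z hz t (hzt t)
  filter_upwards [h1, hO.mem_nhds hz] with x hx hxO
  refine ⟨hxO, fun t => ?_⟩
  have hm := (AddCircle.equivIco (2 * Real.pi) 0 t).2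
  rw [← AddCircle.coe_equivIco (p := 2 * Real.pi) (a := 0) (y := t)]
  exact hx _ ⟨hm.1, by linarith [hm.2]⟩ hxO

variable {Γ Y : Type*} [Group Γ] [AddCommGroup Y] [Module ℝ Y] [UniformSpace Y]
  {A : Set (PartialEquiv Γ Y)} {j : Γ →* basedLoopGroup E G} {i : Y →ₗ[ℝ] BasedLoopSpace E}

theorem contMDiff_basedLoop_fst {V : Type*} [NormedAddCommGroup V] [NormedSpace ℝ V]
    (γ : basedLoopGroup E G) :
    ContMDiff 𝓘(ℝ, ℝ × V) 𝓘(ℝ, E) ∞ fun q : ℝ × V => γ.1 (q.1 : S1) :=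
  (contMDiff_basedLoop γ).comp (contDiff_fst.contMDiff)

/-- A map to a mapping group is smooth if it is pointwise given by a smooth map. -/
theorem IsMappingGroup.smoothOn_of_pointwise (hA : IsMappingGroup G A j i)
    {Z V : Type*} [AddCommGroup Z] [Module ℝ Z] [TopologicalSpace Z] [ContinuousAdd Z]
    [ContinuousSMul ℝ Z] [NormedAddCommGroup V] [NormedSpace ℝ V] {O : Set Z} (hO : IsOpen O)
    {L : Z →ₗ[ℝ] (ℝ → V)} (hL : IsSmoothFamily L) {m : ℝ × V → G} {W : Set (ℝ × V)}
    (hW : IsOpen W) (hm : ContMDiffOn 𝓘(ℝ, ℝ × V) 𝓘(ℝ, E) ∞ m W) {F : Z → Γ}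
    (hOW : ∀ z ∈ O, ∀ t, (t, L z t) ∈ W) (hF : ∀ z ∈ O, ∀ t : ℝ, (j (F z)).1 t = m (t, L z t))
    {q : PartialEquiv Γ Y} (hq : q ∈ A) :
    IsOpen (O ∩ F ⁻¹' q.source) ∧ BastianiSmoothOn (fun z => q (F z)) (O ∩ F ⁻¹' q.source) := by
  rw [hA.charts_eq] at hq
  obtain ⟨g, φ, hφ, h1, h0, hsrc, -, hval⟩ := hq
  have hm' : ContMDiffOn 𝓘(ℝ, ℝ × V) 𝓘(ℝ, E) ∞
      (fun q : ℝ × V => ((j g).1 (q.1 : S1))⁻¹ * m q) W :=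
    (contMDiff_basedLoop_fst (j g)).inv.contMDiffOn.mul hm
  -- On this open set the chart at `g` is applicable pointwise, so `q ∘ F` is the superposition
  -- operator of `φ (g(t)⁻¹ m(t, x))`.
  set W' := W ∩ (fun q : ℝ × V => ((j g).1 (q.1 : S1))⁻¹ * m q) ⁻¹' φ.source with hW'
  have hW'o : IsOpen W' := hm'.continuousOn.isOpen_inter_preimage hW φ.open_source
  have hf : ContDiffOn ℝ ∞ (fun q : ℝ × V => φ (((j g).1 (q.1 : S1))⁻¹ * m q)) W' := by
    rw [← contMDiffOn_iff_contDiffOn]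
    exact (contMDiffOn_of_mem_maximalAtlas hφ).comp (hm'.mono inter_subset_left)
      fun q hq => hq.2
  have hLc : Continuous fun q : Z × ℝ => (q.2, L q.1 q.2) := by
    have := hL.continuous 0
    simp only [iteratedDeriv_zero] at this
    exact continuous_snd.prodMk this
  have hopen : IsOpen (O ∩ F ⁻¹' q.source) := by
    have := isOpen_forall_of_periodic hO
      (P := fun z t => ((j g).1 t)⁻¹ * (j (F z)).1 t ∈ φ.source) fun z hz t ht => by
        have hmem : (t, L z t) ∈ W' := ⟨hOW z hz t, by
          simp only [mem_preimage]; rw [← hF z hz]; exact ht⟩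
        filter_upwards [(hLc.continuousAt (x := (z, t))).eventually_mem (hW'o.mem_nhds hmem)]
          with q hq hqO
        rw [hF q.1 hqO]
        exact hq.2
    convert this using 1
    ext z
    simp only [mem_inter_iff, mem_preimage, hsrc, mem_ofPred_eq]
  refine ⟨hopen, bastianiSmoothOn_superposition hA.isUniformInducing.isInducing hA.isClosed_range hL
    hW'o hf hopen ?_ ?_⟩
  · rintro z ⟨hz, hzq⟩ t
    refine ⟨hOW z hz t, ?_⟩
    rw [mem_preimage, hsrc] at hzq
    have : ((j g).1 (t : S1))⁻¹ * (j (F z)).1 (t : S1) ∈ φ.source := hzq t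
    rwa [hF z hz] at this
  · rintro z ⟨hz, hzq⟩ t
    rw [← hF z hz]
    exact hval _ hzq t

/-- The local form of a family of curves `c x` in `G`, depending on a point `x` of a set with
charts: in each chart, it is pointwise given by a smooth map. -/
def HasLocalForm {M Z V : Type*} [AddCommGroup Z] [Module ℝ Z] [TopologicalSpace Z]
    [NormedAddCommGroup V] [NormedSpace ℝ V]
    (B : Set (PartialEquiv M Z)) (c : M → ℝ → G) (L : Z →ₗ[ℝ] (ℝ → V)) : Prop :=
  IsSmoothFamily L ∧ ∀ p ∈ B, IsOpen p.target ∧ ∃ m : ℝ × V → G, ∃ W : Set (ℝ × V), IsOpen W ∧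
    ContMDiffOn 𝓘(ℝ, ℝ × V) 𝓘(ℝ, E) ∞ m W ∧
    ∀ y ∈ p.target, ∀ t, (t, L y t) ∈ W ∧ c (p.symm y) t = m (t, L y t)

end MappingGroups

/-! ### Charts and Lie group structure of a mapping group -/

section MappingGroupsLie

set_option linter.unusedSectionVars false

universe u

variable {E : Type u} [NormedAddCommGroup E] [NormedSpace ℝ E]
  {G : Type*} [TopologicalSpace G] [ChartedSpace E G] [Group G] [LieGroup 𝓘(ℝ, E) ∞ G]

open BasedLoopSpace

variable {Γ Y : Type*} [Group Γ] [AddCommGroup Y] [Module ℝ Y] [UniformSpace Y]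
  {A : Set (PartialEquiv Γ Y)} {j : Γ →* basedLoopGroup E G} {i : Y →ₗ[ℝ] BasedLoopSpace E}
  {M Z V : Type*} [AddCommGroup Z] [Module ℝ Z] [TopologicalSpace Z]
  [ContinuousAdd Z] [ContinuousSMul ℝ Z] [NormedAddCommGroup V] [NormedSpace ℝ V]
  {B : Set (PartialEquiv M Z)} {c : M → ℝ → G} {L : Z →ₗ[ℝ] (ℝ → V)}
  {M' Z' V' : Type*} [AddCommGroup Z'] [Module ℝ Z'] [TopologicalSpace Z']
  [ContinuousAdd Z'] [ContinuousSMul ℝ Z'] [NormedAddCommGroup V'] [NormedSpace ℝ V']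
  {B' : Set (PartialEquiv M' Z')} {c' : M' → ℝ → G} {L' : Z' →ₗ[ℝ] (ℝ → V')}

theorem IsMappingGroup.smoothMap_of_unary (hA : IsMappingGroup G A j i)
    (hc : HasLocalForm (E := E) B c L) {op : G → G} (hop : ContMDiff 𝓘(ℝ, E) 𝓘(ℝ, E) ∞ op)
    {f : M → Γ} (hf : ∀ x (t : ℝ), (j (f x)).1 t = op (c x t)) : SmoothMap B A f := by
  rw [SmoothMap, smoothMapOn_iff]
  intro p hp q hq
  obtain ⟨hO, m, W, hW, hm, h⟩ := hc.2 p hp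
  have := hA.smoothOn_of_pointwise hO hc.1 hW (hop.comp_contMDiffOn hm)
    (F := fun z => f (p.symm z)) (fun z hz t => (h z hz t).1)
    (fun z hz t => by rw [hf, (h z hz t).2]; rfl) hq
  rw [univ_inter]
  exact this

/-- A smooth pointwise operation on two local forms is one smooth map with parameters in `V × V'`.
Multiplication and conjugation are both of this kind. -/
theorem IsMappingGroup.smoothMap_of_binary (hA : IsMappingGroup G A j i)
    (hc : HasLocalForm (E := E) B c L) (hc' : HasLocalForm (E := E) B' c' L') {op : G × G → G}
    (hop : ContMDiff (𝓘(ℝ, E).prod 𝓘(ℝ, E)) 𝓘(ℝ, E) ∞ op)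
    {f : M × M' → Γ} (hf : ∀ x (t : ℝ), (j (f x)).1 t = op (c x.1 t, c' x.2 t)) :
    SmoothMap (prodCharts B B') A f := by
  rw [SmoothMap, smoothMapOn_iff]
  rintro _ ⟨p, hp, p', hp', rfl⟩ q hq
  obtain ⟨hO, m, W, hW, hm, h⟩ := hc.2 p hp
  obtain ⟨hO', m', W', hW', hm', h'⟩ := hc'.2 p' hp'
  have e1 : ContDiff ℝ ∞ (fun q : ℝ × V × V' => (q.1, q.2.1)) := by fun_prop
  have e2 : ContDiff ℝ ∞ (fun q : ℝ × V × V' => (q.1, q.2.2)) := by fun_prop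
  have hmm : ContMDiffOn 𝓘(ℝ, ℝ × V × V') 𝓘(ℝ, E) ∞
      (fun q : ℝ × V × V' => op (m (q.1, q.2.1), m' (q.1, q.2.2)))
      ((fun q : ℝ × V × V' => (q.1, q.2.1)) ⁻¹' W ∩ (fun q : ℝ × V × V' => (q.1, q.2.2)) ⁻¹' W') :=
    hop.comp_contMDiffOn
      ((hm.comp e1.contMDiff.contMDiffOn fun q hq => hq.1).prodMk
        (hm'.comp e2.contMDiff.contMDiffOn fun q hq => hq.2))
  have := hA.smoothOn_of_pointwise (hO.prod hO') (L := prodFamily L L')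
    (hc.1.prod hc'.1 fun _ _ => rfl)
    ((hW.preimage e1.continuous).inter (hW'.preimage e2.continuous)) hmm
    (F := fun z => f (p.symm z.1, p'.symm z.2))
    (fun z hz t => ⟨(h z.1 hz.1 t).1, (h' z.2 hz.2 t).1⟩)
    (fun z hz t => by rw [hf, (h z.1 hz.1 t).2, (h' z.2 hz.2 t).2]; rfl) hq
  rw [univ_inter]
  exact this

omit [ContinuousAdd Z] [ContinuousSMul ℝ Z] in
theorem HasLocalForm.isOpen_eval (hc : HasLocalForm (E := E) B c L) {p : PartialEquiv M Z}
    (hp : p ∈ B) (t : ℝ) {O : Set G} (hO : IsOpen O) :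
    IsOpen (p.target ∩ p.symm ⁻¹' {x | c x t ∈ O}) := by
  obtain ⟨hT, m, W, hW, hm, h⟩ := hc.2 p hp
  have hLc : Continuous fun z : Z => (t, L z t) := by
    have := hc.1.continuous 0
    simp only [iteratedDeriv_zero] at this
    exact continuous_const.prodMk (this.comp (by fun_prop : Continuous fun z : Z => (z, t)))
  have h1 : ContinuousOn (fun z => m (t, L z t)) p.target :=
    hm.continuousOn.comp hLc.continuousOn fun z hz => (h z hz t).1
  convert h1.isOpen_inter_preimage hT hO using 1
  ext z
  simp only [mem_inter_iff, mem_preimage, mem_ofPred_eq]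
  exact and_congr_right fun hz => by rw [(h z hz t).2]

namespace IsMappingGroup

/-- `mappingGroupCharts` only collects the partial equivalences with prescribed properties, so their
existence must be shown. The coordinate is that of `g⁻¹γ`, and the inverse multiplies by `g` again.
-/
theorem exists_chart (hA : IsMappingGroup G A j i) (g : Γ) {φ : OpenPartialHomeomorph G E}
    (hφ : φ ∈ IsManifold.maximalAtlas 𝓘(ℝ, E) ∞ G) (h1 : (1 : G) ∈ φ.source) (h0 : φ 1 = 0) :
    ∃ p ∈ A, p.source = {γ | ∀ t, ((j g).1 t)⁻¹ * (j γ).1 t ∈ φ.source} ∧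
      p.target = {y | ∀ t, (i y).1 t ∈ φ.target} ∧
      ∀ γ ∈ p.source, ∀ t, (i (p γ)).1 t = φ (((j g).1 t)⁻¹ * (j γ).1 t) := by
  classical
  set S : Set Γ := {γ | ∀ t, ((j g).1 t)⁻¹ * (j γ).1 t ∈ φ.source} with hS
  set D : Set Y := {y | ∀ t, (i y).1 t ∈ φ.target} with hD
  have hc : ∀ γ ∈ S, ∃ y, ∀ t, (i y).1 t = φ (((j g).1 t)⁻¹ * (j γ).1 t) := fun γ hγ => by
    obtain ⟨y, hy⟩ := hA.exists_coord φ hφ h1 h0 (g⁻¹ * γ) (fun t => by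
      rw [map_mul, map_inv]; exact hγ t)
    refine ⟨y, fun t => ?_⟩
    rw [hy, map_mul, map_inv]
    rfl
  have he : ∀ y ∈ D, ∃ γ, ∀ t, (j γ).1 t = (j g).1 t * φ.symm ((i y).1 t) := fun y hy => by
    obtain ⟨γ, hγ⟩ := hA.exists_elt φ hφ h1 h0 y hy
    refine ⟨g * γ, fun t => ?_⟩
    rw [map_mul, ← hγ]
    rfl
  choose! F hF using hc
  choose! K hK using he
  have hFD : ∀ γ ∈ S, F γ ∈ D := fun γ hγ t => by
    rw [hF γ hγ]; exact φ.map_source (hγ t)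
  have hKS : ∀ y ∈ D, K y ∈ S := fun y hy t => by
    rw [hK y hy, inv_mul_cancel_left]; exact φ.map_target (hy t)
  let p : PartialEquiv Γ Y :=
    { toFun := F
      invFun := K
      source := S
      target := D
      map_source' := fun γ hγ => hFD γ hγ
      map_target' := fun y hy => hKS y hy
      left_inv' := fun γ hγ => hA.injective_group <| basedLoop_ext fun t => by
        rw [hK _ (hFD γ hγ), hF γ hγ, φ.left_inv (hγ t), mul_inv_cancel_left]
      right_inv' := fun y hy => hA.injective_space <| Subtype.ext <| funext fun t => by
        rw [hF _ (hKS y hy), hK y hy, inv_mul_cancel_left, φ.right_inv (hy t)] }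
  refine ⟨p, ?_, rfl, rfl, hF⟩
  rw [hA.charts_eq]
  exact ⟨g, φ, hφ, h1, h0, rfl, rfl, hF⟩

/-- A chart is specified by its source, its target and its values; these already determine the
inverse on the target. -/
theorem exists_symm_apply (hA : IsMappingGroup G A j i) {p : PartialEquiv Γ Y} (hp : p ∈ A) :
    ∃ g : Γ, ∃ φ ∈ IsManifold.maximalAtlas 𝓘(ℝ, E) ∞ G, (1 : G) ∈ φ.source ∧ φ 1 = 0 ∧
      p.source = {γ | ∀ t, ((j g).1 t)⁻¹ * (j γ).1 t ∈ φ.source} ∧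
      p.target = {y | ∀ t, (i y).1 t ∈ φ.target} ∧
      (∀ γ ∈ p.source, ∀ t, (i (p γ)).1 t = φ (((j g).1 t)⁻¹ * (j γ).1 t)) ∧
      ∀ y ∈ p.target, ∀ t, (j (p.symm y)).1 t = (j g).1 t * φ.symm ((i y).1 t) := by
  rw [hA.charts_eq] at hp
  obtain ⟨g, φ, hφ, h1, h0, hs, ht, hv⟩ := hp
  refine ⟨g, φ, hφ, h1, h0, hs, ht, hv, fun y hy t => ?_⟩
  have hm := p.map_target hy
  have h2 : (i (p (p.symm y))).1 t = φ (((j g).1 t)⁻¹ * (j (p.symm y)).1 t) := hv _ hm t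
  rw [p.right_inv hy] at h2
  have h3 : ((j g).1 t)⁻¹ * (j (p.symm y)).1 t ∈ φ.source := by
    rw [hs] at hm
    exact hm t
  rw [h2, φ.left_inv h3, mul_inv_cancel_left]

theorem isOpen_target (hA : IsMappingGroup G A j i) {p : PartialEquiv Γ Y} (hp : p ∈ A) :
    IsOpen p.target := by
  obtain ⟨g, φ, hφ, h1, h0, hs, ht, -⟩ := hA.exists_symm_apply hp
  have hL := (isSmoothFamily_curve hA.isUniformInducing.isInducing.continuous).continuous 0
  simp only [iteratedDeriv_zero] at hL
  have := isOpen_forall_of_periodic isOpen_univ (P := fun y t => (i y).1 t ∈ φ.target)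
    fun y _ t hyt => by
      filter_upwards [(hL.continuousAt (x := (y, t))).eventually_mem
        (φ.open_target.mem_nhds hyt)] with q hq _ using hq
  simpa [ht] using this

theorem hasLocalForm (hA : IsMappingGroup G A j i) :
    HasLocalForm (E := E) A (fun γ t => (j γ).1 (t : S1)) (curve.comp i) := by
  refine ⟨isSmoothFamily_curve hA.isUniformInducing.isInducing.continuous, fun p hp =>
    ⟨hA.isOpen_target hp, ?_⟩⟩
  obtain ⟨g, φ, hφ, h1, h0, hs, ht, hv, hsymm⟩ := hA.exists_symm_apply hp
  refine ⟨fun q => (j g).1 (q.1 : S1) * φ.symm q.2, Prod.snd ⁻¹' φ.target,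
    φ.open_target.preimage continuous_snd, ?_, fun y hy t => ⟨?_, hsymm y hy t⟩⟩
  · exact (contMDiff_basedLoop_fst (j g)).contMDiffOn.mul
      ((contMDiffOn_symm_of_mem_maximalAtlas hφ).comp contDiff_snd.contMDiff.contMDiffOn
        fun q hq => hq)
  · rw [ht] at hy
    exact hy t

theorem chartsCover (hA : IsMappingGroup G A j i) : ChartsCover A := fun γ => by
  obtain ⟨φ, hφ, h1, h0⟩ := exists_centered_chart E (1 : G)
  obtain ⟨p, hp, hs, -⟩ := hA.exists_chart γ hφ h1 h0
  exact ⟨p, hp, by rw [hs]; intro t; rwa [inv_mul_cancel]⟩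

variable [CompleteSpace E]

theorem isFrechetSpace (hA : IsMappingGroup G A j i) : IsFrechetSpace Y :=
  .of_isUniformInducing i hA.isUniformInducing hA.injective_space hA.isClosed_range

theorem smoothMap_id (hA : IsMappingGroup G A j i) : SmoothMap A A fun γ => γ :=
  have := hA.isFrechetSpace
  hA.smoothMap_of_unary hA.hasLocalForm contMDiff_id fun _ _ => rfl

/-- Evaluation at all times is a continuous injection into a power of the Hausdorff group `G`. -/
theorem t2Space (hA : IsMappingGroup G A j i) : @T2Space Γ (chartTopology A) := by
  let : TopologicalSpace Γ := chartTopology A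
  have := t2Space_of_lieGroup E G
  refine T2Space.of_injective_continuous (f := fun γ (t : ℝ) => (j γ).1 (t : S1))
    (fun a b h => hA.injective_group (basedLoop_ext fun t => congrFun h t)) ?_
  refine continuous_pi fun t => continuous_def.2 fun O hO => ?_
  exact SmoothMapOn.mem_chartTopology hA.chartsCover fun p hp => hA.hasLocalForm.isOpen_eval hp t hO

theorem isFrechetLieGroup (hA : IsMappingGroup G A j i) : IsFrechetLieGroup A where
  frechet := hA.isFrechetSpace
  cover := hA.chartsCover
  isOpen_overlap p hp q hq := by
    have := (hA.smoothMap_id p hp q hq).1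
    simpa using this
  smooth_transition p hp q hq := by
    have := (hA.smoothMap_id p hp q hq).2
    simpa using this
  hausdorff := hA.t2Space
  smooth_mul := by
    have := hA.isFrechetSpace
    refine hA.smoothMap_of_binary hA.hasLocalForm hA.hasLocalForm (contMDiff_mul 𝓘(ℝ, E) ∞)
      fun x t => ?_
    rw [map_mul]
    rfl
  smooth_inv := by
    have := hA.isFrechetSpace
    refine hA.smoothMap_of_unary hA.hasLocalForm (contMDiff_inv 𝓘(ℝ, E) ∞) fun x t => ?_
    rw [map_inv]
    rfl

end IsMappingGroup

end MappingGroupsLie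

/-! ### The Fréchet Lie groups `ΩG`, `Ω_I G` and `P_e G` -/

section LoopGroups

set_option linter.unusedSectionVars false

universe u

variable {E : Type u} [NormedAddCommGroup E] [NormedSpace ℝ E]
  {G : Type*} [TopologicalSpace G] [ChartedSpace E G] [Group G] [LieGroup 𝓘(ℝ, E) ∞ G]

open BasedLoopSpace PathSpace

theorem exists_basedLoop_coord {φ : OpenPartialHomeomorph G E}
    (hφ : φ ∈ IsManifold.maximalAtlas 𝓘(ℝ, E) ∞ G) (h0 : φ 1 = 0)
    (γ : basedLoopGroup E G) (hγ : ∀ t, γ.1 t ∈ φ.source) :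
    ∃ y : BasedLoopSpace E, ∀ t, y.1 t = φ (γ.1 t) := by
  have hs : ContDiff ℝ ∞ fun t : ℝ => φ (γ.1 (t : S1)) := contDiff_iff_contDiffAt.2 fun t => by
    rw [← contDiffWithinAt_univ]
    exact contDiffWithinAt_chart_comp hφ (contMDiff_basedLoop γ).contMDiffAt.contMDiffWithinAt
      (hγ _)
  refine ⟨⟨fun t => φ (γ.1 t), hs, fun k => ?_⟩, fun t => rfl⟩
  rcases k.eq_zero_or_pos with rfl | hk
  · rw [iteratedDeriv_zero]
    change φ (γ.1 0) = 0
    rw [γ.2.2.1, h0]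
  · rw [← iteratedDerivWithin_univ]
    exact FlatAt.chart_comp hφ uniqueDiffOn_univ (mem_univ _)
      (contMDiff_basedLoop γ).contMDiffAt.contMDiffWithinAt (hγ _) γ.2.2.2 k hk

theorem exists_basedLoop_elt {φ : OpenPartialHomeomorph G E}
    (hφ : φ ∈ IsManifold.maximalAtlas 𝓘(ℝ, E) ∞ G) (h1 : (1 : G) ∈ φ.source) (h0 : φ 1 = 0)
    (y : BasedLoopSpace E) (hy : ∀ t, y.1 t ∈ φ.target) :
    ∃ γ : basedLoopGroup E G, ∀ t, γ.1 t = φ.symm (y.1 t) := by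
  have hyc : ∀ t : ℝ, ContDiffWithinAt ℝ ∞ (curve y) univ t := fun t =>
    (contDiff_curve y).contDiffAt.contDiffWithinAt
  have hs : ContMDiff 𝓘(ℝ, ℝ) 𝓘(ℝ, E) ∞ fun t : ℝ => φ.symm (y.1 (t : S1)) := fun t => by
    rw [← contMDiffWithinAt_univ]
    exact contMDiffWithinAt_chart_symm_comp hφ (hyc t) (hy _)
  refine ⟨⟨fun t => φ.symm (y.1 t), hs, ?_, ?_⟩, fun t => rfl⟩
  · have := iteratedDeriv_curve_zero y 0
    rw [iteratedDeriv_zero] at this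
    change φ.symm (curve y 0) = 1
    rw [this, ← h0, φ.left_inv h1]
  · refine flatAt_chart_symm_comp hφ uniqueDiffOn_univ (mem_univ _) (hyc 0) (hy _) fun k _ => ?_
    rw [iteratedDerivWithin_univ]
    exact iteratedDeriv_curve_zero y k

variable (E G)

theorem isMappingGroup_basedLoop : IsMappingGroup G (basedLoopCharts E G)
    (MonoidHom.id (basedLoopGroup E G)) (LinearMap.id : BasedLoopSpace E →ₗ[ℝ] _) where
  isUniformInducing := .id
  injective_space := Function.injective_id
  isClosed_range := by
    rw [LinearMap.id_coe, range_id]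
    exact isClosed_univ
  injective_group := Function.injective_id
  charts_eq := rfl
  exists_coord _ hφ _ h0 γ hγ := exists_basedLoop_coord hφ h0 γ hγ
  exists_elt _ hφ h1 h0 y hy := exists_basedLoop_elt hφ h1 h0 y hy

/-- The inclusion `Ω_I G → ΩG`. -/
def inclHom (I : Set S1) : basedLoopGroupIn E G I →* basedLoopGroup E G :=
  Subgroup.inclusion fun _ h => h.1

theorem isMappingGroup_basedLoopIn (I : Set S1) : IsMappingGroup G (basedLoopInCharts E G I)
    (inclHom E G I) (basedLoopSpaceIn E I).subtype where
  isUniformInducing := isUniformInducing_subtype I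
  injective_space := Subtype.val_injective
  isClosed_range := isClosed_range_subtype I
  injective_group := Subgroup.inclusion_injective _
  charts_eq := rfl
  exists_coord φ hφ _ h0 γ hγ := by
    obtain ⟨y, hy⟩ := exists_basedLoop_coord hφ h0 (inclHom E G I γ) hγ
    refine ⟨⟨y, fun t ht => ?_⟩, hy⟩
    refine (hy t).trans ?_
    have : (inclHom E G I γ).1 t = 1 := γ.2.2 t ht
    rw [this, h0]
  exists_elt φ hφ h1 h0 y hy := by
    obtain ⟨γ, hγ⟩ := exists_basedLoop_elt hφ h1 h0 y.1 hy
    refine ⟨⟨γ.1, γ.2, fun t ht => ?_⟩, hγ⟩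
    refine (hγ t).trans ?_
    have : y.1.1 t = 0 := y.2 t ht
    rw [this, ← h0, φ.left_inv h1]

variable {E G}

/-- The parameter occurs only in statements quantified over all of `D`, so charts of paths on `[0,
π]` can be read on the circle through `fold`. -/
theorem mappingGroupCharts_comp_surjective {Γ Y D D' : Type*} (ev : Γ → D → G) (evY : Y → D → E)
    {r : D' → D} (hr : Function.Surjective r) :
    mappingGroupCharts (E := E) ev evY =
      mappingGroupCharts (fun γ t => ev γ (r t)) fun y t => evY y (r t) := by
  unfold mappingGroupCharts
  simp only [hr.forall]

theorem doubleHom_apply (γ : pathGroup E G) (t : S1) : (doubleHom γ).1 t = γ.1 (fold t) :=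
  cup_self γ.1 t

variable (E G)

/-- Coordinates and elements are constructed on `[0, π]`, where smoothness and flatness are given.
Surjectivity of `fold` transfers the conditions on doubled loops to paths. -/
theorem isMappingGroup_path : IsMappingGroup G (pathCharts E G) doubleHom (double (E := E)) where
  isUniformInducing := isUniformInducing_double
  injective_space := double_injective
  isClosed_range := isClosed_range_double
  injective_group a b h := by
    refine Subtype.ext (funext fun s => ?_)
    obtain ⟨t, rfl⟩ := fold_surjective s
    rw [← doubleHom_apply, ← doubleHom_apply, h]
  charts_eq := by
    simp only [doubleHom_apply, double_apply]
    exact mappingGroupCharts_comp_surjective (E := E) (fun γ : pathGroup E G => γ.1)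
      (fun X : PathSpace E => X.1) fold_surjective
  exists_coord φ hφ _ h0 γ hγ := by
    have m0 := left_mem_Icc.2 Real.pi_pos.le
    have m1 := right_mem_Icc.2 Real.pi_pos.le
    have hu := uniqueDiffOn_Icc Real.pi_pos
    have hs : ∀ s, γ.1 s ∈ φ.source := fun s => by
      obtain ⟨t, rfl⟩ := fold_surjective s
      rw [← doubleHom_apply]
      exact hγ t
    refine ⟨⟨fun s => φ (γ.1 s), fun t ht => contDiffWithinAt_chart_comp hφ (γ.2.1 t ht) (hs _),
      (congrArg φ γ.2.2.1).trans h0, fun k hk => ⟨?_, ?_⟩⟩, fun t => ?_⟩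
    · exact FlatAt.chart_comp hφ hu m0 (γ.2.1 _ m0) (hs _) γ.2.2.2.1 k hk
    · exact FlatAt.chart_comp hφ hu m1 (γ.2.1 _ m1) (hs _) γ.2.2.2.2 k hk
    · rw [doubleHom_apply]
      exact double_apply _ t
  exists_elt φ hφ h1 h0 y hy := by
    have m0 := left_mem_Icc.2 Real.pi_pos.le
    have m1 := right_mem_Icc.2 Real.pi_pos.le
    have hu := uniqueDiffOn_Icc Real.pi_pos
    have hs : ∀ s, y.1 s ∈ φ.target := fun s => by
      obtain ⟨t, rfl⟩ := fold_surjective s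
      rw [← double_apply]
      exact hy t
    refine ⟨⟨fun s => φ.symm (y.1 s), fun t ht =>
      contMDiffWithinAt_chart_symm_comp hφ (y.2.1 t ht) (hs _), ?_, ?_, ?_⟩, fun t => ?_⟩
    · exact (congrArg φ.symm y.2.2.1).trans (by rw [← h0, φ.left_inv h1])
    · exact flatAt_chart_symm_comp hφ hu m0 (y.2.1 _ m0) (hs _) fun k hk => (y.2.2.2 k hk).1
    · exact flatAt_chart_symm_comp hφ hu m1 (y.2.1 _ m1) (hs _) fun k hk => (y.2.2.2 k hk).2
    · rw [double_apply]
      exact doubleHom_apply _ t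

/-! ### Smooth homomorphisms between loop and path groups -/

variable [CompleteSpace E]

theorem smoothMap_doubleHom : SmoothMap (pathCharts E G) (basedLoopCharts E G) doubleHom :=
  (isMappingGroup_basedLoop E G).smoothMap_of_unary (isMappingGroup_path E G).hasLocalForm
    contMDiff_id fun _ _ => rfl

/-- Restricting and then doubling evaluates a loop at `fold t`, which is not smooth in `t`. The
local form therefore uses the doubled base loop and the doubled coordinate, both smooth in `t`,
instead of reparametrizing by `fold`. -/
theorem smoothMap_restrictHom :
    SmoothMap (basedLoopInCharts E G upperHalf) (pathCharts E G) restrictHom := by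
  refine (isMappingGroup_path E G).smoothMap_of_unary
    (c := fun γ t => (doubleHom (restrictHom γ)).1 (t : S1))
    (L := curve.comp (double.comp restrictSpace)) ?_ contMDiff_id fun _ _ => rfl
  refine ⟨isSmoothFamily_curve
    (isUniformInducing_double.isInducing.continuous.comp continuous_restrictSpace), fun p hp =>
    ⟨(isMappingGroup_basedLoopIn E G upperHalf).isOpen_target hp, ?_⟩⟩
  obtain ⟨g, φ, hφ, h1, h0, hs, ht, hv, hsymm⟩ :=
    (isMappingGroup_basedLoopIn E G upperHalf).exists_symm_apply hp
  refine ⟨fun q => (doubleHom (restrictHom g)).1 (q.1 : S1) * φ.symm q.2, Prod.snd ⁻¹' φ.target,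
    φ.open_target.preimage continuous_snd, ?_, fun y hy t => ?_⟩
  · exact (contMDiff_basedLoop_fst (doubleHom (restrictHom g))).contMDiffOn.mul
      ((contMDiffOn_symm_of_mem_maximalAtlas hφ).comp contDiff_snd.contMDiff.contMDiffOn
        fun q hq => hq)
  · have hL : (curve.comp (double.comp restrictSpace)) y t =
        ((basedLoopSpaceIn E upperHalf).subtype y).1 (((fold (t : S1) : HalfInterval) : ℝ) : S1) :=
      double_apply (restrictSpace y) t
    have hc : ∀ γ : basedLoopGroupIn E G upperHalf, (doubleHom (restrictHom γ)).1 (t : S1) =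
        (inclHom E G upperHalf γ).1 (((fold (t : S1) : HalfInterval) : ℝ) : S1) := fun γ =>
      doubleHom_apply (restrictHom γ) t
    have hyt := hy
    rw [ht] at hyt
    refine ⟨?_, (hc _).trans ((hsymm y hy _).trans
      (congrArg₂ (fun a b => a * φ.symm b) (hc g).symm hL.symm))⟩
    rw [mem_preimage, hL]
    exact hyt _

variable {E G} in
/-- The conjugation action of `P_e G` on `Ω_I G` is smooth. -/
theorem smoothMap_conj {I : Set S1}
    {f : pathGroup E G × basedLoopGroupIn E G I → basedLoopGroupIn E G I}
    (hf : ∀ x, inclHom E G I (f x) = doubleHom x.1 * inclHom E G I x.2 * (doubleHom x.1)⁻¹) :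
    SmoothMap (prodCharts (pathCharts E G) (basedLoopInCharts E G I)) (basedLoopInCharts E G I)
      f := by
  refine (isMappingGroup_basedLoopIn E G I).smoothMap_of_binary
    (isMappingGroup_path E G).hasLocalForm (isMappingGroup_basedLoopIn E G I).hasLocalForm
    (op := fun q => q.1 * q.2 * q.1⁻¹) ((contMDiff_fst.mul contMDiff_snd).mul contMDiff_fst.inv)
    fun x t => ?_
  rw [hf]
  rfl

end LoopGroups

/-! ### The restriction of a central extension to `Ω_I G` -/

theorem chartsCover_circleCharts : ChartsCover circleCharts := fun z =>
  ⟨(chartAt LineModel z).toPartialEquiv, ⟨_, chart_mem_atlas _ z, rfl⟩, mem_chart_source _ z⟩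

instance isFrechetSpace_of_normed {V : Type*} [NormedAddCommGroup V] [NormedSpace ℝ V]
    [CompleteSpace V] : IsFrechetSpace V where

section Restriction

set_option linter.unusedSectionVars false

universe u

variable {E : Type u} [NormedAddCommGroup E] [NormedSpace ℝ E]
  {G : Type*} [TopologicalSpace G] [ChartedSpace E G] [Group G] [LieGroup 𝓘(ℝ, E) ∞ G]

/-- Every chart of `Ω_I G` is the restriction of a chart of `ΩG`. -/
theorem exists_chart_inclHom {I : Set S1}
    {c : PartialEquiv (basedLoopGroupIn E G I) (basedLoopSpaceIn E I)}
    (hc : c ∈ basedLoopInCharts E G I) :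
    ∃ b ∈ basedLoopCharts E G, (∀ γ, inclHom E G I γ ∈ b.source ↔ γ ∈ c.source) ∧
      (∀ y : basedLoopSpaceIn E I, y.1 ∈ b.target ↔ y ∈ c.target) ∧
      ∀ y ∈ c.target, b.symm y.1 = inclHom E G I (c.symm y) := by
  obtain ⟨g, φ, hφ, h1, h0, hs, ht, hv, -⟩ :=
    (isMappingGroup_basedLoopIn E G I).exists_symm_apply hc
  obtain ⟨b, hb, hbs, hbt, hbv⟩ :=
    (isMappingGroup_basedLoop E G).exists_chart (inclHom E G I g) hφ h1 h0
  have hsource : ∀ γ, inclHom E G I γ ∈ b.source ↔ γ ∈ c.source := fun γ => by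
    rw [hbs, hs]; rfl
  refine ⟨b, hb, hsource, fun y => by rw [hbt, ht]; rfl, fun y hy => ?_⟩
  have hγ := c.map_target hy
  have hγb := (hsource _).2 hγ
  have : b (inclHom E G I (c.symm y)) = y.1 := by
    refine Subtype.ext (funext fun t => (hbv _ hγb t).trans ?_)
    refine (hv _ hγ t).symm.trans ?_
    rw [c.right_inv hy]
    rfl
  rw [← this, b.left_inv hγb]

namespace LoopExtension

variable {T F : Type*} [Group T] [AddCommGroup F] [Module ℝ F] [UniformSpace F]
  (X : LoopExtension E G T F) (I : Set S1)

theorem inclHom_projAbove (Φ : X.above I) : inclHom E G I (X.projAbove I Φ) = X.proj Φ := rfl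

variable {X I}

theorem exists_above {V : Set (basedLoopGroup E G)}
    {τ : PartialEquiv T (basedLoopGroup E G × Circle)}
    (hτ : IsLocalTrivialization (basedLoopCharts E G) X.charts X.incl X.proj V τ)
    {γ : basedLoopGroupIn E G I} (hγ : inclHom E G I γ ∈ V) (z : Circle) :
    ∃ Φ : X.above I, (Φ : T) = τ.symm (inclHom E G I γ, z) ∧ X.projAbove I Φ = γ ∧
      τ Φ = (inclHom E G I γ, z) := by
  have ht : (inclHom E G I γ, z) ∈ τ.target := by
    rw [hτ.target_eq]
    exact ⟨hγ, mem_univ _⟩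
  have hp : X.proj (τ.symm (inclHom E G I γ, z)) = inclHom E G I γ := by
    rw [← hτ.fst_eq _ (τ.map_target ht), τ.right_inv ht]
  have hm : τ.symm (inclHom E G I γ, z) ∈ X.above I := by
    change (X.proj _ : S1 → G) ∈ basedLoopGroupIn E G I
    rw [hp]
    exact γ.2
  exact ⟨⟨_, hm⟩, rfl, Subtype.ext (congrArg (fun g => g.1) hp),
    τ.right_inv ht⟩

/-- The definition of the charts fixes only the source and the values. The target and the inverse
follow, since `exists_above` gives a point over any base element in `V` with any fibre coordinate.
-/
theorem aboveCharts_symm {V : Set (basedLoopGroup E G)}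
    {τ : PartialEquiv T (basedLoopGroup E G × Circle)}
    (hτ : IsLocalTrivialization (basedLoopCharts E G) X.charts X.incl X.proj V τ)
    {c : PartialEquiv (basedLoopGroupIn E G I) (basedLoopSpaceIn E I)}
    {u : PartialEquiv Circle LineModel}
    {p : PartialEquiv (X.above I) (basedLoopSpaceIn E I × LineModel)}
    (hs : p.source =
      {Φ : X.above I | X.proj Φ ∈ V ∧ X.projAbove I Φ ∈ c.source ∧ (τ Φ).2 ∈ u.source})
    (hv : ∀ Φ ∈ p.source, p Φ = (c (X.projAbove I Φ), u (τ Φ).2)) :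
    p.target = {z | z.1 ∈ c.target ∧ inclHom E G I (c.symm z.1) ∈ V ∧ z.2 ∈ u.target} ∧
      ∀ z ∈ p.target, X.projAbove I (p.symm z) = c.symm z.1 ∧
        (p.symm z : T) = τ.symm (inclHom E G I (c.symm z.1), u.symm z.2) := by
  have key : ∀ z : basedLoopSpaceIn E I × LineModel, z.1 ∈ c.target →
      inclHom E G I (c.symm z.1) ∈ V → z.2 ∈ u.target →
      z ∈ p.target ∧ X.projAbove I (p.symm z) = c.symm z.1 ∧
        (p.symm z : T) = τ.symm (inclHom E G I (c.symm z.1), u.symm z.2) := by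
    intro z h1 h2 h3
    obtain ⟨Φ, hΦ, hΦp, hΦτ⟩ := exists_above hτ h2 (u.symm z.2)
    have hm : Φ ∈ p.source := by
      rw [hs]
      refine ⟨?_, ?_, ?_⟩
      · rwa [← inclHom_projAbove, hΦp]
      · rw [hΦp]
        exact c.map_target h1
      · rw [hΦτ]
        exact u.map_target h3
    have hz : p Φ = z := by
      rw [hv Φ hm, hΦp, hΦτ, c.right_inv h1, u.right_inv h3]
    have hz' : p.symm z = Φ := by rw [← hz, p.left_inv hm]
    exact ⟨hz ▸ p.map_source hm, hz' ▸ hΦp, hz' ▸ hΦ⟩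
  have hsub : ∀ z ∈ p.target,
      z.1 ∈ c.target ∧ inclHom E G I (c.symm z.1) ∈ V ∧ z.2 ∈ u.target := by
    intro z hz
    have hm := p.map_target hz
    have hz' : z = (c (X.projAbove I (p.symm z)), u (τ (p.symm z)).2) := by
      rw [← hv _ hm, p.right_inv hz]
    rw [hs] at hm
    obtain ⟨m1, m2, m3⟩ := hm
    rw [hz']
    refine ⟨c.map_source m2, ?_, u.map_source m3⟩
    rwa [c.left_inv m2]
  exact ⟨Subset.antisymm hsub fun z hz => (key z hz.1 hz.2.1 hz.2.2).1,
    fun z hz => (key z (hsub z hz).1 (hsub z hz).2.1 (hsub z hz).2.2).2⟩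

variable (X I)

theorem chartsCover_charts : ChartsCover X.charts := X.isFrechetLieGroup.cover

/-- The coordinate map is injective because `c`, `u` and `τ` are; as the definition leaves the
target free, the bijection onto the image is a chart. -/
theorem chartsCover_aboveCharts : ChartsCover (X.aboveCharts I) := fun Φ => by
  classical
  obtain ⟨V, hV, τ, hτ⟩ := X.locallyTrivial (X.proj Φ)
  obtain ⟨c, hc, hΦc⟩ := (isMappingGroup_basedLoopIn E G I).chartsCover (X.projAbove I Φ)
  obtain ⟨u, hu, hΦu⟩ := chartsCover_circleCharts (τ Φ).2
  set S : Set (X.above I) :=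
    {Φ | X.proj Φ ∈ V ∧ X.projAbove I Φ ∈ c.source ∧ (τ Φ).2 ∈ u.source} with hS
  set f : X.above I → basedLoopSpaceIn E I × LineModel :=
    fun Φ => (c (X.projAbove I Φ), u (τ Φ).2) with hf
  have hinj : InjOn f S := by
    rintro a ⟨a1, a2, a3⟩ b ⟨b1, b2, b3⟩ hab
    have e1 : X.projAbove I a = X.projAbove I b := c.injOn a2 b2 (congrArg Prod.fst hab)
    have e2 : (τ a).2 = (τ b).2 := u.injOn a3 b3 (congrArg Prod.snd hab)
    have ha : (a : T) ∈ τ.source := by rw [hτ.source_eq]; exact a1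
    have hb : (b : T) ∈ τ.source := by rw [hτ.source_eq]; exact b1
    refine Subtype.ext (τ.injOn ha hb (Prod.ext ?_ e2))
    rw [hτ.fst_eq _ ha, hτ.fst_eq _ hb, ← inclHom_projAbove, ← inclHom_projAbove, e1]
  have : Nonempty (X.above I) := ⟨Φ⟩
  exact ⟨hinj.bijOn_image.toPartialEquiv, ⟨V, τ, hτ, c, hc, u, hu, rfl, fun _ _ => rfl⟩,
    hV, hΦc, hΦu⟩

variable [CompleteSpace E]

/-- When `c` is extended to a chart `b` of `ΩG`, the inclusion is locally `τ⁻¹` preceded by the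
continuous linear inclusion of the model spaces. -/
theorem smoothMap_subtype_above :
    SmoothMap (X.aboveCharts I) X.charts fun Φ : X.above I => (Φ : T) := by
  rw [SmoothMap, smoothMapOn_iff]
  rintro p ⟨V, τ, hτ, c, hc, u, hu, hs, hv⟩ q hq
  obtain ⟨b, hb, -, hbt, hbc⟩ := exists_chart_inclHom hc
  obtain ⟨ht, hsymm⟩ := aboveCharts_symm hτ hs hv
  obtain ⟨h1, h2⟩ := smoothMapOn_iff.1 hτ.smooth_symm (b.prod u) ⟨b, hb, u, hu, rfl⟩ q hq
  set L : basedLoopSpaceIn E I × LineModel →L[ℝ] BasedLoopSpace E × LineModel :=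
    (basedLoopSpaceIn E I).subtypeL.prodMap (ContinuousLinearMap.id ℝ LineModel) with hL
  have hsymm' : ∀ z ∈ p.target, (p.symm z : T) = τ.symm ((b.prod u).symm (L z)) := fun z hz => by
    rw [(hsymm z hz).2]
    rw [ht] at hz
    exact congrArg (fun g => τ.symm (g, u.symm z.2)) (hbc z.1 hz.1).symm
  have hdom : p.target ∩ p.symm ⁻¹' (univ ∩ (fun Φ : X.above I => (Φ : T)) ⁻¹' q.source) =
      L ⁻¹' ((b.prod u).target ∩ (b.prod u).symm ⁻¹' (τ.target ∩ τ.symm ⁻¹' q.source)) := by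
    ext z
    constructor
    · rintro ⟨hz, -, hzq⟩
      have hz' := hz
      rw [ht] at hz'
      refine ⟨⟨(hbt _).2 hz'.1, hz'.2.2⟩, ?_, ?_⟩
      · rw [hτ.target_eq]
        refine ⟨?_, mem_univ _⟩
        change b.symm z.1.1 ∈ V
        rw [hbc _ hz'.1]
        exact hz'.2.1
      · rw [mem_preimage, ← hsymm' z hz]
        exact hzq
    · rintro ⟨⟨hz1, hz2⟩, hz3, hz4⟩
      have hz1' := (hbt z.1).1 hz1
      have hz : z ∈ p.target := by
        rw [ht]
        refine ⟨hz1', ?_, hz2⟩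
        rw [hτ.target_eq] at hz3
        rw [← hbc _ hz1']
        exact hz3.1
      refine ⟨hz, mem_univ _, ?_⟩
      rw [mem_preimage, ← hsymm' z hz] at hz4
      exact hz4
  rw [hdom]
  refine ⟨h1.preimage L.continuous, (h2.comp_clm L).congr (h1.preimage L.continuous) ?_⟩
  rw [← hdom]
  rintro z ⟨hz, -⟩
  exact congrArg q (hsymm' z hz).symm

/-- The target is covered by the domains of the local representatives of the inclusion, which are
open. -/
theorem isOpen_target_aboveCharts {p} (hp : p ∈ X.aboveCharts I) : IsOpen p.target := by
  have h := smoothMapOn_iff.1 (X.smoothMap_subtype_above I) p hp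
  refine isOpen_iff_forall_mem_open.2 fun z hz => ?_
  obtain ⟨q, hq, hzq⟩ := X.chartsCover_charts (p.symm z : T)
  exact ⟨_, inter_subset_left, (h q hq).1, hz, mem_univ _, hzq⟩

theorem smoothMap_projAbove :
    SmoothMap (X.aboveCharts I) (basedLoopInCharts E G I) (X.projAbove I) := by
  rw [SmoothMap, smoothMapOn_iff]
  intro p hp q hq
  have hO := X.isOpen_target_aboveCharts I hp
  obtain ⟨V, τ, hτ, c, hc, u, hu, hs, hv⟩ := hp
  obtain ⟨ht, hsymm⟩ := aboveCharts_symm hτ hs hv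
  have := (isMappingGroup_basedLoopIn E G I).isFrechetSpace
  obtain ⟨h1, h2⟩ := smoothMapOn_iff.1 (isMappingGroup_basedLoopIn E G I).smoothMap_id c hc q hq
  have hdom : p.target ∩ p.symm ⁻¹' (univ ∩ X.projAbove I ⁻¹' q.source) =
      p.target ∩ Prod.fst ⁻¹' (c.target ∩ c.symm ⁻¹' (univ ∩ (fun x => x) ⁻¹' q.source)) := by
    ext z
    simp only [mem_inter_iff, mem_preimage, mem_univ, true_and]
    refine and_congr_right fun hz => ?_
    rw [(hsymm z hz).1]
    rw [ht] at hz
    simp [hz.1]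
  have hO' := hO.inter (h1.preimage continuous_fst)
  rw [hdom]
  refine ⟨hO', (((h2.comp_clm (ContinuousLinearMap.fst ℝ _ LineModel)).mono
    inter_subset_right)).congr hO' ?_⟩
  rintro z ⟨hz, -⟩
  exact congrArg q (hsymm z hz).1.symm

-- The `U(1)`-coordinate is smooth by `hT` and the trivialization, and the base coordinate by `hP`.
-- The latter is needed since coordinates in `ΩE` do not by themselves give a map to `Ω_I E`.
-- Openness of the domain already follows from `hT`, since `c` restricts a chart of `ΩG`.
variable {X I} in
theorem smoothMap_above_of {M H : Type*} [AddCommGroup H] [Module ℝ H] [UniformSpace H]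
    [IsFrechetSpace H] {A : Set (PartialEquiv M H)} {f : M → X.above I}
    (hT : SmoothMap A X.charts fun x => (f x : T))
    (hP : SmoothMap A (basedLoopInCharts E G I) fun x => X.projAbove I (f x)) :
    SmoothMap A (X.aboveCharts I) f := by
  have := X.isFrechetLieGroup.frechet
  have := (isMappingGroup_basedLoopIn E G I).isFrechetSpace
  rw [SmoothMap, smoothMapOn_iff]
  rintro p hp q ⟨V, τ, hτ, c, hc, u, hu, hs, hv⟩
  obtain ⟨b, hb, hbs, -, -⟩ := exists_chart_inclHom hc
  obtain ⟨h1, h2⟩ := smoothMapOn_iff.1 (SmoothMapOn.comp hτ.smooth hT X.chartsCover_charts)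
    p hp (b.prod u) ⟨b, hb, u, hu, rfl⟩
  obtain ⟨-, h4⟩ := smoothMapOn_iff.1 hP p hp c hc
  set D := p.target ∩ p.symm ⁻¹' (univ ∩ (fun x => (f x : T)) ⁻¹' τ.source ∩
    (fun x => τ (f x)) ⁻¹' (b.prod u).source) with hD
  have hdom : p.target ∩ p.symm ⁻¹' (univ ∩ f ⁻¹' q.source) = D := by
    ext z
    simp only [hD, mem_inter_iff, mem_preimage, mem_univ, true_and, hs, mem_ofPred_eq,
      hτ.source_eq, PartialEquiv.prod_source, mem_prod]
    refine and_congr_right fun _ => and_congr_right fun hz => and_congr_left fun _ => ?_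
    rw [hτ.fst_eq _ (by rw [hτ.source_eq]; exact hz), ← inclHom_projAbove, hbs]
  rw [hdom]
  have hsub : D ⊆ p.target ∩ p.symm ⁻¹' (univ ∩ (fun x => X.projAbove I (f x)) ⁻¹' c.source) := by
    rw [← hdom]
    rintro z ⟨hz, -, hzq⟩
    have hzq' : f (p.symm z) ∈ q.source := hzq
    rw [hs] at hzq'
    exact ⟨hz, mem_univ _, hzq'.2.1⟩
  refine ⟨h1, ((h4.mono hsub).prodMk
    (h2.clm_comp (ContinuousLinearMap.snd ℝ (BasedLoopSpace E) LineModel))).congr h1 ?_⟩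
  rw [← hdom]
  rintro z ⟨-, -, hzq⟩
  exact (hv _ hzq).symm

theorem smoothMap_above_id : SmoothMap (X.aboveCharts I) (X.aboveCharts I) fun Φ => Φ := by
  have := (isMappingGroup_basedLoopIn E G I).isFrechetSpace
  exact smoothMap_above_of (X.smoothMap_subtype_above I) (X.smoothMap_projAbove I)

theorem smoothMap_above_mul :
    SmoothMap (prodCharts (X.aboveCharts I) (X.aboveCharts I)) (X.aboveCharts I)
      fun x : X.above I × X.above I => x.1 * x.2 := by
  have := X.isFrechetLieGroup.frechet
  have hI := isMappingGroup_basedLoopIn E G I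
  have := hI.isFrechetSpace
  have hcov := X.chartsCover_aboveCharts I
  have h1 := smoothMap_fst (X.smoothMap_above_id I) (X.smoothMap_above_id I)
  have h2 := smoothMap_snd (X.smoothMap_above_id I) (X.smoothMap_above_id I)
  have hT := X.smoothMap_subtype_above I
  have hP := X.smoothMap_projAbove I
  refine smoothMap_above_of ?_ ?_
  · exact X.isFrechetLieGroup.smooth_mul.comp ((hT.comp h1 hcov).prodMk (hT.comp h2 hcov))
      (X.chartsCover_charts.prod X.chartsCover_charts)
  · have h3 := (hP.comp h1 hcov).prodMk (hP.comp h2 hcov)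
    refine (SmoothMap.comp hI.isFrechetLieGroup.smooth_mul h3
      (hI.chartsCover.prod hI.chartsCover)).congr fun x => ?_
    exact (map_mul (X.projAbove I) x.1 x.2).symm

theorem smoothMap_above_inv :
    SmoothMap (X.aboveCharts I) (X.aboveCharts I) fun x : X.above I => x⁻¹ := by
  have := X.isFrechetLieGroup.frechet
  have hI := isMappingGroup_basedLoopIn E G I
  have := hI.isFrechetSpace
  refine smoothMap_above_of ?_ ?_
  · exact X.isFrechetLieGroup.smooth_inv.comp (X.smoothMap_subtype_above I) X.chartsCover_charts
  · refine (SmoothMap.comp hI.isFrechetLieGroup.smooth_inv (X.smoothMap_projAbove I)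
      hI.chartsCover).congr fun x => ?_
    exact (map_inv (X.projAbove I) x).symm

theorem isFrechetLieGroup_above : IsFrechetLieGroup (X.aboveCharts I) := by
  have := X.isFrechetLieGroup.frechet
  have := (isMappingGroup_basedLoopIn E G I).isFrechetSpace
  refine ⟨⟨inferInstance, X.chartsCover_aboveCharts I, fun p hp q hq => ?_, fun p hp q hq => ?_,
    ?_⟩, X.smoothMap_above_mul I, X.smoothMap_above_inv I⟩
  · simpa using (X.smoothMap_above_id I p hp q hq).1
  · simpa using (X.smoothMap_above_id I p hp q hq).2
  · let : TopologicalSpace (X.above I) := chartTopology (X.aboveCharts I)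
    let : TopologicalSpace T := chartTopology X.charts
    have : T2Space T := X.isFrechetLieGroup.hausdorff
    exact T2Space.of_injective_continuous Subtype.val_injective
      ((X.smoothMap_subtype_above I).continuous_chartTopology (X.chartsCover_aboveCharts I))

end LoopExtension

end Restriction

/-! ### Restriction of smooth maps to open sets -/

section Restrict

variable {M E : Type*} [AddCommGroup E] [Module ℝ E] [TopologicalSpace E]
  {N F : Type*} [AddCommGroup F] [Module ℝ F] [TopologicalSpace F]
  {A : Set (PartialEquiv M E)} {B : Set (PartialEquiv N F)}

theorem SmoothMapOn.isOpen {f : M → N} {S : Set M} (hf : SmoothMapOn A B f S)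
    (hB : ChartsCover B) {p : PartialEquiv M E} (hp : p ∈ A) :
    IsOpen (p.target ∩ p.symm ⁻¹' S) := by
  refine isOpen_iff_forall_mem_open.2 fun z hz => ?_
  obtain ⟨q, hq, hzq⟩ := hB (f (p.symm z))
  exact ⟨_, fun y hy => ⟨hy.1, hy.2.1⟩, (smoothMapOn_iff.1 hf p hp q hq).1, hz.1, hz.2, hzq⟩

theorem SmoothMap.smoothMapOn {f : M → N} {S : Set M} (hf : SmoothMap A B f)
    (hS : ∀ p ∈ A, IsOpen (p.target ∩ p.symm ⁻¹' S)) : SmoothMapOn A B f S := by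
  rw [SmoothMap, smoothMapOn_iff] at hf
  rw [smoothMapOn_iff]
  intro p hp q hq
  obtain ⟨h1, h2⟩ := hf p hp q hq
  refine ⟨?_, h2.mono fun z hz => ⟨hz.1, mem_univ _, hz.2.2⟩⟩
  convert h1.inter (hS p hp) using 1
  ext z
  simp only [mem_inter_iff, mem_preimage, mem_univ, true_and]
  tauto

end Restrict

/-! ### The crossed module -/

section CrossedModule

set_option linter.unusedSectionVars false

universe u

variable {E : Type u} [NormedAddCommGroup E] [NormedSpace ℝ E]
  {G : Type*} [TopologicalSpace G] [ChartedSpace E G] [Group G] [LieGroup 𝓘(ℝ, E) ∞ G]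

theorem doubleHom_coe (γ : pathGroup E G) (s : HalfInterval) :
    (doubleHom γ).1 ((s : ℝ) : S1) = γ.1 s :=
  (doubleHom_apply γ _).trans (congrArg γ.1 (fold_coe s.2))

namespace LoopExtension

variable {T F : Type*} [Group T] [AddCommGroup F] [Module ℝ F] [UniformSpace F]
  (X : LoopExtension E G T F)

theorem toPath_apply (Φ : X.above upperHalf) (s : HalfInterval) :
    (X.toPath Φ).1 s = (X.proj Φ).1 ((s : ℝ) : S1) := rfl

theorem toPath_canonicalAction (γ : pathGroup E G) (Φ : X.above upperHalf) :
    X.toPath (X.canonicalAction γ Φ) = γ * X.toPath Φ * γ⁻¹ := by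
  obtain ⟨Ψ, hΨ⟩ := X.proj_surjective (doubleHom γ)
  refine Subtype.ext (funext fun s => ?_)
  rw [toPath_apply, X.canonicalAction_apply γ Ψ hΨ, map_mul, map_mul, map_inv, hΨ]
  change (doubleHom γ).1 _ * (X.proj Φ).1 _ * ((doubleHom γ).1 _)⁻¹ = _
  rw [doubleHom_coe]
  rfl

theorem doubleHom_toPath_apply (Φ : X.above upperHalf) {t : S1} (ht : t ∈ upperHalf) :
    (doubleHom (X.toPath Φ)).1 t = (X.proj Φ).1 t := by
  obtain ⟨s, hs, rfl⟩ := ht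
  exact doubleHom_coe (X.toPath Φ) ⟨s, Ioo_subset_Icc_self hs⟩

-- `Θ` differs from `Φ` by an element over the complement of `(0, π)`, which commutes with `Ψ`. This
-- is the only place where disjoint commutativity enters.
variable {X} in
theorem canonicalAction_toPath (hX : X.DisjointCommutative) (Φ Ψ : X.above upperHalf) :
    X.canonicalAction (X.toPath Φ) Ψ = Φ * Ψ * Φ⁻¹ := by
  obtain ⟨Θ, hΘ⟩ := X.proj_surjective (doubleHom (X.toPath Φ))
  have hm : (Φ : T)⁻¹ * Θ ∈ X.above upperHalfᶜ := by
    refine ⟨(X.proj _).2, fun t ht => ?_⟩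
    rw [map_mul, map_inv, hΘ]
    change ((X.proj Φ).1 t)⁻¹ * (doubleHom (X.toPath Φ)).1 t = 1
    rw [X.doubleHom_toPath_apply Φ (notMem_compl_iff.1 ht), inv_mul_cancel]
  have hc := hX _ _ disjoint_compl_right _ Ψ.2 _ hm
  refine Subtype.ext ?_
  rw [X.canonicalAction_apply _ Θ hΘ, Subgroup.coe_mul, Subgroup.coe_mul, Subgroup.coe_inv]
  calc Θ * Ψ * Θ⁻¹ = Φ * ((Φ : T)⁻¹ * Θ * Ψ) * Θ⁻¹ := by group
    _ = Φ * (Ψ * ((Φ : T)⁻¹ * Θ)) * Θ⁻¹ := by rw [hc]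
    _ = Φ * Ψ * (Φ : T)⁻¹ := by group

/-- A loop supported in `(0, π)` is determined by its first half, so `Φ` lies in the kernel of the
projection and hence in the central `U(1)`. -/
theorem canonicalAction_of_toPath_eq_one (γ : pathGroup E G) {Φ : X.above upperHalf}
    (hΦ : X.toPath Φ = 1) : X.canonicalAction γ Φ = Φ := by
  obtain ⟨Ψ, hΨ⟩ := X.proj_surjective (doubleHom γ)
  have h1 : X.proj Φ = 1 := by
    refine Subtype.ext (funext fun t => ?_)
    by_cases ht : t ∈ upperHalf
    · rw [← X.doubleHom_toPath_apply Φ ht, hΦ, map_one]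
    · exact Φ.2.2 t ht
  rw [← MonoidHom.mem_ker, X.ker_eq_range] at h1
  obtain ⟨z, hz⟩ := h1
  refine Subtype.ext ?_
  rw [X.canonicalAction_apply γ Ψ hΨ, ← hz, ← X.central, mul_inv_cancel_right]

/-! ### Smoothness of `t` and of the action -/

variable [CompleteSpace E]

theorem smoothMap_toPath : SmoothMap (X.aboveCharts upperHalf) (pathCharts E G) X.toPath := by
  have := (isMappingGroup_basedLoopIn E G upperHalf).isFrechetSpace
  have := (isMappingGroup_path E G).isFrechetSpace
  have hcov := (isMappingGroup_basedLoopIn E G upperHalf).chartsCover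
  have hr := smoothMap_restrictHom E G
  exact hr.comp (X.smoothMap_projAbove upperHalf) hcov

theorem exists_smooth_lift (γ : pathGroup E G) : ∃ S, γ ∈ S ∧ ∃ s : pathGroup E G → T,
    SmoothMapOn (pathCharts E G) X.charts s S ∧ ∀ γ' ∈ S, X.proj (s γ') = doubleHom γ' := by
  have := X.isFrechetLieGroup.frechet
  have hP := isMappingGroup_path E G
  have := hP.isFrechetSpace
  obtain ⟨V, hV, τ, hτ⟩ := X.locallyTrivial (doubleHom γ)
  -- The lift is the section of a local trivialization with constant fibre coordinate `1`, composed
  -- with doubling.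
  have h1 := (smoothMap_doubleHom E G).prodMk
    (smoothMap_const (B := circleCharts) hP.smoothMap_id (1 : Circle))
  have h2 := SmoothMapOn.comp hτ.smooth_symm h1
    ((isMappingGroup_basedLoop E G).chartsCover.prod chartsCover_circleCharts)
  refine ⟨_, ?_, _, h2, ?_⟩
  · rw [hτ.target_eq]
    exact ⟨mem_univ _, hV, mem_univ _⟩
  · rintro γ' ⟨-, hγ'⟩
    have := hτ.fst_eq _ (τ.map_target hγ')
    rw [τ.right_inv hγ'] at this
    exact this.symm

/-- Smoothness is checked in the total group, where the action is locally conjugation by a smooth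
lift, and on the base, where it is pointwise conjugation and no lift is needed. -/
theorem smoothMap_canonicalAction :
    SmoothMap (prodCharts (pathCharts E G) (X.aboveCharts upperHalf)) (X.aboveCharts upperHalf)
      fun x : pathGroup E G × X.above upperHalf => X.canonicalAction x.1 x.2 := by
  have := X.isFrechetLieGroup.frechet
  have hP := isMappingGroup_path E G
  have := hP.isFrechetSpace
  have hI := isMappingGroup_basedLoopIn E G upperHalf
  have := hI.isFrechetSpace
  have hid := X.smoothMap_above_id upperHalf
  have h1 := smoothMap_fst hP.smoothMap_id hid
  have h2 := smoothMap_snd hP.smoothMap_id hid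
  refine smoothMap_above_of ?_ ?_
  · refine smoothMap_of_locally fun x => ?_
    obtain ⟨S, hxS, s, hs, hsl⟩ := X.exists_smooth_lift x.1
    have hs1 := SmoothMapOn.comp hs h1 hP.chartsCover
    have hv := ((X.smoothMap_subtype_above upperHalf).comp h2
      (X.chartsCover_aboveCharts upperHalf)).smoothMapOn
        fun p hp => hs1.isOpen X.chartsCover_charts hp
    have hmul := X.isFrechetLieGroup.smooth_mul
    have hcov := X.chartsCover_charts
    have hsv := SmoothMapOn.comp hmul (hs1.prodMk hv) (hcov.prod hcov)
    rw [preimage_univ, inter_univ] at hsv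
    have hsi := SmoothMapOn.comp X.isFrechetLieGroup.smooth_inv hs1 hcov
    rw [preimage_univ, inter_univ] at hsi
    have h := SmoothMapOn.comp hmul (hsv.prodMk hsi) (hcov.prod hcov)
    rw [preimage_univ, inter_univ] at h
    refine ⟨univ ∩ Prod.fst ⁻¹' S, ⟨mem_univ x, hxS⟩, h.congr ?_⟩
    rintro y ⟨-, hy⟩
    exact (X.canonicalAction_apply y.1 _ (hsl _ hy) y.2).symm
  · let f : pathGroup E G × basedLoopGroupIn E G upperHalf → basedLoopGroupIn E G upperHalf :=
      fun x => ⟨((doubleHom x.1 * inclHom E G upperHalf x.2 * (doubleHom x.1)⁻¹ :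
        basedLoopGroup E G) : S1 → G), SetLike.coe_mem _, fun t ht => by
          have : (inclHom E G upperHalf x.2).1 t = 1 := x.2.2.2 t ht
          simp [this]⟩
    have hconj := smoothMap_conj (f := f) fun _ => rfl
    have h3 := h1.prodMk ((X.smoothMap_projAbove upperHalf).comp h2
      (X.chartsCover_aboveCharts upperHalf))
    refine (SmoothMap.comp hconj h3 (hP.chartsCover.prod hI.chartsCover)).congr fun x => ?_
    obtain ⟨Ψ, hΨ⟩ := X.proj_surjective (doubleHom x.1)
    refine Subtype.ext ?_
    change _ = (X.proj (X.canonicalAction x.1 x.2)).1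
    rw [X.canonicalAction_apply x.1 Ψ hΨ, map_mul, map_mul, map_inv, hΨ]
    rfl

theorem isCentralCrossedModule (hX : X.DisjointCommutative) :
    IsCentralCrossedModule (X.aboveCharts upperHalf) (pathCharts E G) X.toPath
      X.canonicalAction where
  lieGroup_H := X.isFrechetLieGroup_above upperHalf
  lieGroup_K := (isMappingGroup_path E G).isFrechetLieGroup
  smooth_t := X.smoothMap_toPath
  smooth_action := X.smoothMap_canonicalAction
  equivariant := X.toPath_canonicalAction
  peiffer := canonicalAction_toPath hX
  central γ _ hΦ := X.canonicalAction_of_toPath_eq_one γ hΦ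

end LoopExtension

end CrossedModule

end LoopCrossed

theorem mainTheorem2
    {E : Type*} [NormedAddCommGroup E] [NormedSpace ℝ E] [FiniteDimensional ℝ E]
    {G : Type*} [TopologicalSpace G] [ChartedSpace E G] [Group G] [LieGroup 𝓘(ℝ, E) ∞ G]
    [ConnectedSpace G]
    {T F : Type*} [Group T] [AddCommGroup F] [Module ℝ F] [UniformSpace F]
    (X : LoopExtension E G T F) (hX : X.DisjointCommutative) :
    IsCentralCrossedModule (X.aboveCharts upperHalf) (pathCharts E G) X.toPath X.canonicalAction ∧
      ∀ γ : pathGroup E G, ∃ Ψ : T, (X.proj Ψ : S1 → G) = cup γ γ ∧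
        ∀ (Ψ' : T), (X.proj Ψ' : S1 → G) = cup γ γ →
          ∀ Φ : X.above upperHalf, (X.canonicalAction γ Φ : T) = Ψ' * Φ * Ψ'⁻¹ := by
  -- Completeness of `E` makes the model spaces of loops and paths complete; finite dimension serves
  -- only this purpose.
  have : CompleteSpace E := FiniteDimensional.complete ℝ E
  refine ⟨X.isCentralCrossedModule hX, fun γ => ?_⟩
  obtain ⟨Ψ, hΨ⟩ := X.proj_surjective (doubleHom γ)
  exact ⟨Ψ, congrArg Subtype.val hΨ, fun Ψ' hΨ' Φ =>
    X.canonicalAction_apply γ Ψ' (Subtype.ext hΨ') Φ⟩
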